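/- Let $\mathbb K=\mathbb R$ or $\mathbb C$, $G=\mathrm{SL}(2,\mathbb K)$, and let $K\subset G$ be the maximal compact subgroup $\mathrm{SO}(2)$, respectively $\mathrm{SU}(2)$. Put $\kappa=\tfrac12$ if $\mathbb K=\mathbb R$ and $\kappa=1$ if $\mathbb K=\mathbb C$. Let $\tilde A[1]$ be the closed ball of non-negative symmetric, respectively Hermitian, $2\times2$ matrices of trace $1$, and let $G[1]=K\times\tilde A[1]$, a compact manifold with boundary. By the polar decomposition $g=ka$, $k\in K$, $a=(g^*g)^{1/2}$, the map $g\mapsto (k,a/\operatorname{tr}a)$ is a diffeomorphism of $G$ onto the interior of $G[1]$, and functions on $G$ are identified with functions on this interior. Let $\|g\|=(\operatorname{tr} g^*g)^{1/2}$ and let $\Xi(g)=\mathrm{Vol}(K)^{-1}\int_K r(gk^{-1})^{-2\kappa}\,dk$ be Harish-Chandra's spherical function, where $dk$ is Haar measure on $K$ and $r(g)>0$ is the upper left entry of the factor $\operatorname{diag}(r,r^{-1})$ of $g$ in the Iwasawa decomposition $G=KAN$ with $N$ upper triangular unipotent. The Schwartz space $\mathcal S(G)$ consists of the smooth $u:G\to\mathbb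 C$ with $\sup_G\|g\|^{N}|D_1D_2u|<\infty$, and Harish-Chandra's Schwartz space $\mathcal C_{HC}(G)$ of the smooth $u:G\to\mathbb C$ with $\sup_G(1+\log\|g\|)^{m}\,\Xi^{-1}|D_1D_2u|<\infty$, in each case for all real exponents $N$, respectively $m$, and all $D_1$ and $D_2$ in the left-invariant and right-invariant enveloping algebras. A boundary defining function is a smooth $\rho:G[1]\to[0,\infty)$ vanishing exactly on $\partial G[1]$ with $d\rho\neq0$ there; if $\rho<1$ put $\operatorname{ilog}\rho=1/\log(1/\rho)$. Let $\mathrm{Diff}^*_b(G[1])$ be the algebra of differential operators generated by the smooth functions on $G[1]$ and the smooth vector fields on $G[1]$ tangent to $\partial G[1]$. For a weight $\alpha>0$ on the interior let $\alpha\mathcal A(G[1])$ be the space of smooth functions $u$ on the interior such that $(Pu)/\alpha$ is bounded for every $P\in\mathrm{Diff}^*_b(G[1])$, and put $(\operatorname{ilog}\rho)^\infty\rho^\kappa\mathcal A(G[1])=\bigcap_{m\in\mathbb R}(\operatorname{ilog}\rho)^m\rho^\kappa\mathcal A(G[1])$. Then: (1) $\mathcal S(G)$ is the space of (restrictions to the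 interior of) smooth functions on $G[1]$ which vanish to infinite order at $\partial G[1]$. (2) For every boundary defining function $\rho<1$, $\mathcal C_{HC}(G)=(\operatorname{ilog}\rho)^\infty\rho^\kappa\mathcal A(G[1])$. (3) For every boundary defining function $\rho<1$ there are $c,C,\varepsilon>0$ such that $c\,\rho^\kappa\le\Xi\le C\,\rho^\kappa\log(1/\rho)$ on the part of the interior where $\rho<\varepsilon$. -/

import Mathlib

open scoped ContDiff ComplexOrder Matrix Topology

noncomputable section

namespace SL2Cpt

-- Matrices carry the Frobenius (Hilbert-Schmidt) norm.
attribute [local instance] Matrix.frobeniusNormedAddCommGroup Matrix.frobeniusNormedSpace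

/-! ### Calculus on embedded submanifolds

`ι : M → E` is an injection identifying `M` with a smoothly embedded submanifold (possibly with
boundary) of the real normed space `E`. -/

section Calculus

variable {M E F : Type*} [NormedAddCommGroup E] [NormedSpace ℝ E]
  [NormedAddCommGroup F] [NormedSpace ℝ F]

/-- `f` is smooth on the embedded submanifold `M` (up to and including its boundary, if any):
transported to the image of `ι` it is smooth there in the sense of Taylor series within the set,
equivalently it is locally the restriction of smooth functions on `E`. -/
def IsSmooth (ι : M → E) (f : M → F) : Prop :=
  ContDiffOn ℝ ∞ (Function.extend ι f 0) (Set.range ι)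

/-- The derivative `df_p(v)`. It is only used for vectors `v` tangent to `M` at `p`, on which all
derivatives within the image of `ι` agree. -/
def dirDeriv (ι : M → E) (f : M → F) (p : M) (v : E) : F :=
  fderivWithin ℝ (Function.extend ι f 0) (Set.range ι) (ι p) v

/-- The action `f ↦ V f` of a vector field, written as an `E`-valued map on `M`. -/
def vecDeriv (ι : M → E) (V : M → E) (f : M → F) : M → F :=
  fun p => dirDeriv ι f p (V p)

/-- The enveloping algebra of differential operators on `M` generated by the multiplications by
the functions in `𝒜` and the derivations by the vector fields in `𝒱`. -/
inductive IsDiffOp (ι : M → E) (𝒜 : Set (M → ℂ)) (𝒱 : Set (M → E)) :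
    ((M → ℂ) → (M → ℂ)) → Prop
  | mul (a : M → ℂ) (ha : a ∈ 𝒜) : IsDiffOp ι 𝒜 𝒱 (fun f => a * f)
  | vec (V : M → E) (hV : V ∈ 𝒱) : IsDiffOp ι 𝒜 𝒱 (fun f => vecDeriv ι V f)
  | add (P Q : (M → ℂ) → (M → ℂ)) (hP : IsDiffOp ι 𝒜 𝒱 P) (hQ : IsDiffOp ι 𝒜 𝒱 Q) :
      IsDiffOp ι 𝒜 𝒱 (fun f => P f + Q f)
  | comp (P Q : (M → ℂ) → (M → ℂ)) (hP : IsDiffOp ι 𝒜 𝒱 P) (hQ : IsDiffOp ι 𝒜 𝒱 Q) :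
      IsDiffOp ι 𝒜 𝒱 (fun f => P (Q f))

end Calculus

/-- The algebra of `2 × 2` matrices. -/
abbrev Mat (𝕜 : Type*) : Type _ := Matrix (Fin 2) (Fin 2) 𝕜

/-- The group `G = SL(2, 𝕜)`. -/
abbrev G (𝕜 : Type*) [RCLike 𝕜] : Type _ := Matrix.SpecialLinearGroup (Fin 2) 𝕜

/-- The maximal compact subgroup: `SO(2)` for `𝕜 = ℝ`, `SU(2)` for `𝕜 = ℂ`. -/
abbrev K (𝕜 : Type*) [RCLike 𝕜] : Type _ := Matrix.specialUnitaryGroup (Fin 2) 𝕜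

/-! ### The group and its invariant differential operators -/

section Group

variable (𝕜 : Type*) [RCLike 𝕜]

/-- The embedding of `G` in the space of matrices. -/
def embG : G 𝕜 → Mat 𝕜 := fun g => (g : Mat 𝕜)

/-- The vector fields `g ↦ g ξ` with `ξ` in the (real) Lie algebra `sl(2, 𝕜)`, which generate the
right translations. -/
def leftInvariantFields : Set (G 𝕜 → Mat 𝕜) :=
  {V | ∃ ξ : Mat 𝕜, ξ.trace = 0 ∧ V = fun g : G 𝕜 => (g : Mat 𝕜) * ξ}

/-- The vector fields `g ↦ ξ g` with `ξ` in the (real) Lie algebra `sl(2, 𝕜)`, which generate the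
left translations. -/
def rightInvariantFields : Set (G 𝕜 → Mat 𝕜) :=
  {V | ∃ ξ : Mat 𝕜, ξ.trace = 0 ∧ V = fun g : G 𝕜 => ξ * (g : Mat 𝕜)}

/-- The constant functions on `G`. -/
def constantFunctions : Set (G 𝕜 → ℂ) := {a | ∃ c : ℂ, a = fun _ => c}

variable {𝕜}

/-- `D` is the action of an element of the complexified enveloping algebra by left-invariant
operators. -/
def IsLeftInvariantOp (D : (G 𝕜 → ℂ) → (G 𝕜 → ℂ)) : Prop :=
  IsDiffOp (embG 𝕜) (constantFunctions 𝕜) (leftInvariantFields 𝕜) D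

/-- `D` is the action of an element of the complexified enveloping algebra by right-invariant
operators. -/
def IsRightInvariantOp (D : (G 𝕜 → ℂ) → (G 𝕜 → ℂ)) : Prop :=
  IsDiffOp (embG 𝕜) (constantFunctions 𝕜) (rightInvariantFields 𝕜) D

variable (𝕜)

/-- The Schwartz space of `G`: all left and right invariant derivatives decay faster than any
power of the matrix norm. -/
def schwartzSpace : Set (G 𝕜 → ℂ) :=
  {u | IsSmooth (embG 𝕜) u ∧
    ∀ (N : ℝ) (D₁ D₂ : (G 𝕜 → ℂ) → (G 𝕜 → ℂ)), IsLeftInvariantOp D₁ → IsRightInvariantOp D₂ →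
      ∃ C : ℝ, ∀ g : G 𝕜, ‖embG 𝕜 g‖ ^ N * ‖D₁ (D₂ u) g‖ ≤ C}

end Group

/-! ### The spherical function and Harish-Chandra's Schwartz space -/

section HarishChandra

variable {𝕜 : Type*} [RCLike 𝕜]

/-- The inclusion of `K` in `G`. -/
def K.toG (k : K 𝕜) : G 𝕜 := ⟨k.1, (Matrix.mem_specialUnitaryGroup_iff.1 k.2).2⟩

/-- The positive entry `r` of the diagonal factor `diag(r, r⁻¹)` in the Iwasawa decomposition
`G = K A N` with `N` the upper triangular unipotent group; it is the length of the first column. -/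
def iwasawaEntry (g : G 𝕜) : ℝ := √(‖g.1 0 0‖ ^ 2 + ‖g.1 1 0‖ ^ 2)

instance : IsTopologicalGroup (K 𝕜) where
  continuous_mul := continuous_mul
  continuous_inv := by
    refine Continuous.subtype_mk (f := fun k : K 𝕜 => star k.1) ?_ _
    exact Continuous.matrix_conjTranspose continuous_subtype_val

instance : CompactSpace (K 𝕜) := by
  suffices h : IsCompact ((Matrix.specialUnitaryGroup (Fin 2) 𝕜 : Submonoid (Mat 𝕜)) :
      Set (Mat 𝕜)) from isCompact_iff_compactSpace.1 h
  have h1 : IsCompact {A : Mat 𝕜 | ∀ i j, A i j ∈ Metric.closedBall (0 : 𝕜) 1} := by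
    have h2 := isCompact_univ_pi (X := fun _ : Fin 2 => Fin 2 → 𝕜) fun _ : Fin 2 =>
      isCompact_univ_pi fun _ : Fin 2 => isCompact_closedBall (0 : 𝕜) 1
    have h3 : {A : Mat 𝕜 | ∀ i j, A i j ∈ Metric.closedBall (0 : 𝕜) 1} =
        (Set.univ.pi fun _ : Fin 2 => Set.univ.pi fun _ : Fin 2 =>
          Metric.closedBall (0 : 𝕜) 1 : Set (Fin 2 → Fin 2 → 𝕜)) :=
      Set.ext fun A => ⟨fun h i _ j _ => h i j, fun h i j => h i trivial j trivial⟩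
    rw [h3]
    exact h2
  refine h1.of_isClosed_subset ?_ ?_
  · have : ((Matrix.specialUnitaryGroup (Fin 2) 𝕜 : Submonoid (Mat 𝕜)) : Set (Mat 𝕜)) =
        {A | A * Aᴴ = 1} ∩ {A | A.det = 1} := by
      ext A
      simp [Matrix.mem_specialUnitaryGroup_iff, Matrix.mem_unitaryGroup_iff,
        Matrix.star_eq_conjTranspose]
    rw [this]
    exact (isClosed_eq (by fun_prop) continuous_const).inter
      (isClosed_eq (by fun_prop) continuous_const)
  · intro A hA i j
    simpa using entry_norm_bound_of_unitary (Matrix.mem_specialUnitaryGroup_iff.1 hA).1 i j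

instance : MeasurableSpace (K 𝕜) := borel _

instance : BorelSpace (K 𝕜) := ⟨rfl⟩

/-- Harish-Chandra's spherical function `Ξ(g) = Vol(K)⁻¹ ∫_K e^{-σ(H(g k⁻¹))} dk`, where
`H` is the logarithm of the Iwasawa projection to `A` and `σ` is half the sum of the positive
restricted roots counted with multiplicity. Here there is one positive root, with value `2 log r` on
`log diag(r, r⁻¹)`, and its multiplicity is the real dimension of `𝕜`. -/
def sphericalFunction (g : G 𝕜) : ℝ :=
  ⨍ k : K 𝕜, iwasawaEntry (g * (K.toG k)⁻¹) ^ (-(Module.finrank ℝ 𝕜 : ℝ))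
    ∂(MeasureTheory.Measure.haar : MeasureTheory.Measure (K 𝕜))

variable (𝕜)

/-- Harish-Chandra's Schwartz space of `G`. -/
def harishChandraSpace : Set (G 𝕜 → ℂ) :=
  {u | IsSmooth (embG 𝕜) u ∧
    ∀ (m : ℝ) (D₁ D₂ : (G 𝕜 → ℂ) → (G 𝕜 → ℂ)), IsLeftInvariantOp D₁ → IsRightInvariantOp D₂ →
      ∃ C : ℝ, ∀ g : G 𝕜,
        (1 + Real.log ‖embG 𝕜 g‖) ^ m / sphericalFunction g * ‖D₁ (D₂ u) g‖ ≤ C}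

end HarishChandra

/-! ### The compactification -/

section Compactification

variable (𝕜 : Type*) [RCLike 𝕜]

/-- The closed ball of non-negative Hermitian (symmetric if `𝕜 = ℝ`) matrices of trace one. -/
abbrev PosBall : Type _ := {b : Mat 𝕜 // b.PosSemidef ∧ b.trace = 1}

/-- The compactification `G[1]`, the product of `K` and `PosBall`. -/
abbrev Cpt : Type _ := K 𝕜 × PosBall 𝕜

variable {𝕜}

/-- Interior points of `G[1]`: the second factor is positive definite. The remaining points form
the boundary. -/
def Cpt.IsInterior (p : Cpt 𝕜) : Prop := (p.2 : Mat 𝕜).PosDef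

variable (𝕜)

/-- The interior of `G[1]`. -/
abbrev Interior : Type _ := {p : Cpt 𝕜 // p.IsInterior}

/-- The embedding of `G[1]` as a smooth submanifold with boundary of a product of two spaces of
matrices. -/
def emb : Cpt 𝕜 → Mat 𝕜 × Mat 𝕜 := fun p => ((p.1 : Mat 𝕜), (p.2 : Mat 𝕜))

/-- The induced embedding of the interior. -/
def embInterior : Interior 𝕜 → Mat 𝕜 × Mat 𝕜 := fun p => emb 𝕜 p.1

variable {𝕜}

/-- The diffeomorphism from the interior of `G[1]` to `G` given by the polar decomposition: its
inverse is `g = k a ↦ (k, a / tr a)` with `k ∈ K` and `a = (g* g)^{1/2}`, since a positive definite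
`b` of trace one is `a / tr a` exactly for the matrix `a = (det b)^{-1/2} b` of determinant one. -/
def toG (p : Interior 𝕜) : G 𝕜 :=
  ⟨(p.1.1 : Mat 𝕜) * (((√(RCLike.re (p.1.2 : Mat 𝕜).det))⁻¹ : ℝ) • (p.1.2 : Mat 𝕜)), by
    have hd := p.2.det_pos
    have h0 : 0 < RCLike.re (p.1.2 : Mat 𝕜).det := (RCLike.pos_iff.1 hd).1
    have hre : ((RCLike.re (p.1.2 : Mat 𝕜).det : ℝ) : 𝕜) = (p.1.2 : Mat 𝕜).det :=
      RCLike.conj_eq_iff_re.1 (RCLike.conj_eq_iff_im.2 (RCLike.pos_iff.1 hd).2)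
    have hs : (√(RCLike.re (p.1.2 : Mat 𝕜).det))⁻¹ ^ 2 * RCLike.re (p.1.2 : Mat 𝕜).det = 1 := by
      rw [inv_pow, Real.sq_sqrt h0.le, inv_mul_cancel₀ h0.ne']
    have hk := (Matrix.mem_specialUnitaryGroup_iff.1 p.1.1.2).2
    rw [Matrix.det_mul, hk, one_mul, Matrix.det_smul_of_tower, Fintype.card_fin, ← hre,
      RCLike.real_smul_eq_coe_mul, ← RCLike.ofReal_mul]
    simp only [RCLike.ofReal_re]
    rw [hs, RCLike.ofReal_one]⟩

/-- The tangent space of `G[1]` at `(k, b)`: pairs `(k X, H)` with `X` skew-Hermitian of trace zero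
and `H` Hermitian of trace zero. -/
def tangentSpace (p : Cpt 𝕜) : Set (Mat 𝕜 × Mat 𝕜) :=
  {v | (∃ X : Mat 𝕜, Xᴴ = -X ∧ X.trace = 0 ∧ v.1 = (p.1 : Mat 𝕜) * X) ∧
    v.2.IsHermitian ∧ v.2.trace = 0}

variable (𝕜)

/-- Smooth functions on `G[1]`. -/
def smoothFunctions : Set (Cpt 𝕜 → ℂ) := {a | IsSmooth (emb 𝕜) a}

/-- Smooth vector fields on `G[1]`. -/
def vectorFields : Set (Cpt 𝕜 → Mat 𝕜 × Mat 𝕜) :=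
  {V | IsSmooth (emb 𝕜) V ∧ ∀ p, V p ∈ tangentSpace p}

/-- Smooth vector fields on `G[1]` which are tangent to the boundary. The boundary is `det b = 0`
and the derivative of `det` at `b` in the direction `H` is `tr (adj(b) H)`. -/
def bVectorFields : Set (Cpt 𝕜 → Mat 𝕜 × Mat 𝕜) :=
  {V | V ∈ vectorFields 𝕜 ∧
    ∀ p : Cpt 𝕜, ¬ p.IsInterior → ((p.2 : Mat 𝕜).adjugate * (V p).2).trace = 0}

variable {𝕜}

/-- Linear differential operators on `G[1]` with smooth coefficients. -/
def IsSmoothOp (P : (Cpt 𝕜 → ℂ) → (Cpt 𝕜 → ℂ)) : Prop :=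
  IsDiffOp (emb 𝕜) (smoothFunctions 𝕜) (vectorFields 𝕜) P

/-- The b-differential operators of `G[1]`, acting on functions on the interior. -/
def IsBDiffOp (P : (Interior 𝕜 → ℂ) → (Interior 𝕜 → ℂ)) : Prop :=
  IsDiffOp (embInterior 𝕜) ((fun a => fun p : Interior 𝕜 => a p.1) '' smoothFunctions 𝕜)
    ((fun V => fun p : Interior 𝕜 => V p.1) '' bVectorFields 𝕜) P

variable (𝕜)

/-- Smooth functions on `G[1]` which vanish to infinite order at the boundary. -/
def flatFunctions : Set (Cpt 𝕜 → ℂ) :=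
  {f | IsSmooth (emb 𝕜) f ∧ ∀ P : (Cpt 𝕜 → ℂ) → (Cpt 𝕜 → ℂ), IsSmoothOp P →
    ∀ p : Cpt 𝕜, ¬ p.IsInterior → P f p = 0}

variable {𝕜}

/-- Boundary defining functions: smooth, non-negative, vanishing exactly on the boundary, and
with non-zero differential at each boundary point. -/
def IsBoundaryDefining (ρ : Cpt 𝕜 → ℝ) : Prop :=
  IsSmooth (emb 𝕜) ρ ∧ (∀ p, 0 ≤ ρ p) ∧ (∀ p, ρ p = 0 ↔ ¬ p.IsInterior) ∧
    ∀ p : Cpt 𝕜, ¬ p.IsInterior → ∃ v ∈ tangentSpace p, dirDeriv (emb 𝕜) ρ p v ≠ 0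

/-- The weighted conormal space `α 𝒜(G[1])`: functions on the interior all of whose
b-derivatives are bounded by multiples of `α`. -/
def weightedConormal (α : Interior 𝕜 → ℝ) : Set (Interior 𝕜 → ℂ) :=
  {u | IsSmooth (embInterior 𝕜) u ∧ ∀ P : (Interior 𝕜 → ℂ) → (Interior 𝕜 → ℂ), IsBDiffOp P →
    ∃ C : ℝ, ∀ p, ‖P u p‖ ≤ C * α p}

/-- `ilog x = 1 / log (1 / x)`. -/
def ilog (x : ℝ) : ℝ := 1 / Real.log (1 / x)

/-- The space `(ilog ρ)^∞ ρ^κ 𝒜(G[1])`, the intersection over all real `m` of the weighted spaces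
`(ilog ρ)^m ρ^κ 𝒜(G[1])`. -/
def logRapidConormal (ρ : Cpt 𝕜 → ℝ) (κ : ℝ) : Set (Interior 𝕜 → ℂ) :=
  ⋂ m : ℝ, weightedConormal (fun p : Interior 𝕜 => ilog (ρ p.1) ^ m * ρ p.1 ^ κ)

end Compactification

end SL2Cpt

end

open SL2Cpt

/-!
The three assertions are proved for a general field `𝕜` with `RCLike 𝕜`; the exponent `κ` is half
the real dimension `d` of `𝕜`, and the theorem is the specialization to `ℝ` and `ℂ`.

*The model.* For `g = k a` in `G` one has `a + a⁻¹ = tr a`, so that the polar decomposition is given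
by the explicit smooth formulas of `polarDecomp`, and the function `δ = det b` on `G[1]` becomes
`1 / (‖g‖² + 2)` on `G` (`polarSq_toG`). Every boundary defining function `ρ` is comparable to `δ`
(`IsBoundaryDefining.comparable`): `ρ` vanishes on the boundary and its radial derivative does not,
so the mean value theorem along rays bounds it from both sides. Hence `ρ`
may be replaced by `‖g‖⁻²` and `log (1 / ρ)` by `1 + log ‖g‖` (`IsBoundaryDefining.exists_weights`).

*Invariant fields and b-vector fields.* The left- and right-invariant vector fields of `G` extend to
smooth vector fields on `G[1]` tangent to the boundary (`invL`, `invR`, `polarMulDeriv_invL`,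
`polarMulDeriv_invR`). Conversely, a vector field tangent to the boundary is a combination of
invariant ones (`polarMulDeriv_eq`). The coefficients are not smooth on `G[1]`, but they are of the
form `f₁ + f₂ / δ` with `f₁`, `f₂` smooth and `f₂` vanishing on the boundary, so that they are
bounded together with all their invariant derivatives (`div_bdetC_mem_conormal`). Therefore bounds
on all `D₁ D₂ u` are equivalent to bounds on all `P u` with `P` a b-differential operator, for every
weight (`IsBDiffOp.map_conormal` and the two lemmas `exists_bDiffOp`). To handle the non-smooth
coefficients and the commutation of `D₁` with `D₂` at once, estimates are phrased through `Conormal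
B`, the largest set of smooth functions inside `B` that is stable under invariant derivatives.

*The Schwartz space.* A function on `G[1]` all of whose derivatives vanish on the boundary is
`O(δⁿ)` for all `n`, by integration along rays (`flat_norm_le`), and invariant operators preserve
such functions, since they extend smoothly to `G[1]`. Conversely, a Schwartz function is extended
by zero. As the form `δ g⁻¹ dg` is smooth on `G[1]` (`maurerCartan`), the differential of the
extension is a sum of smooth forms times extensions of `δ⁻¹ Lu` with `L` left-invariant
(`hasFDerivWithinAt_hat`), and `δ⁻¹ Lu` decreases rapidly again. By induction the extension is smooth
(`contDiffOn_hat`), and all its derivatives vanish on the boundary (`IsSmoothOp.map_hatSums`).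

*The spherical function.* The number `r = r(g k⁻¹)` is the length of the first column of `g k⁻¹`,
and `‖g‖⁻¹ ≤ r ≤ ‖g‖`. The upper bound of `r` gives `Ξ ≥ ‖g‖⁻ᵈ` (`le_sphericalFunction`). The set of
`k` with `r ≤ s ‖g‖` has measure `O(sᵈ)`, because by invariance of the Haar measure the first column
may be averaged over the combinations of both columns with coefficients `(1, z)`, `|z| < 1`
(`haar_iwasawaEntry_le`). So each of the `O(1 + log ‖g‖)` dyadic shells of values of `r` contributes
`O(‖g‖⁻ᵈ)` to the integral of `r⁻ᵈ` (`sphericalFunction_le`). These bounds are the third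
assertion, and since the powers of the logarithm are arbitrary the factor `log ‖g‖` between them is
harmless in the second (`IsBoundaryDefining.harishChandraSpace_eq`).
-/


open scoped ContDiff ComplexOrder Matrix Topology

noncomputable section

namespace SL2Cpt

attribute [local instance] Matrix.frobeniusNormedAddCommGroup Matrix.frobeniusNormedSpace
attribute [local instance] Matrix.frobeniusNormedRing Matrix.frobeniusNormedAlgebra

/-! ### Calculus on embedded sets -/

lemma extend_self {M E F : Type*} [Zero F] {ι : M → E} (hι : Function.Injective ι) (f : M → F)
    (p : M) : Function.extend ι f 0 (ι p) = f p := hι.extend_apply _ _ _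

section EmbeddedCalculus

variable {M M' E E' F F' : Type*} [NormedAddCommGroup E] [NormedSpace ℝ E]
  [NormedAddCommGroup E'] [NormedSpace ℝ E']
  [NormedAddCommGroup F] [NormedSpace ℝ F] [NormedAddCommGroup F'] [NormedSpace ℝ F']
  {ι : M → E} {ι' : M' → E'}

/-- The vectors at `ι p` on which all derivatives within the image of `ι` agree: the span of the
tangent cone of the image. -/
def tanSpan (ι : M → E) (p : M) : Submodule ℝ E :=
  Submodule.span ℝ (tangentConeAt ℝ (Set.range ι) (ι p))

lemma eqOn_tanSpan {f : E → F} {A B : E →L[ℝ] F} {p : M} {v : E}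
    (hA : HasFDerivWithinAt f A (Set.range ι) (ι p))
    (hB : HasFDerivWithinAt f B (Set.range ι) (ι p)) (hv : v ∈ tanSpan ι p) : A v = B v :=
  LinearMap.eqOn_span (f := A.toLinearMap) (g := B.toLinearMap) (hA.unique_on hB) hv

lemma dirDeriv_eq {f : M → F} {A : E →L[ℝ] F} {p : M} {v : E}
    (hA : HasFDerivWithinAt (Function.extend ι f 0) A (Set.range ι) (ι p))
    (hv : v ∈ tanSpan ι p) : dirDeriv ι f p v = A v :=
  eqOn_tanSpan hA.differentiableWithinAt.hasFDerivWithinAt hA hv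

/-- A function is smooth as soon as it is the pullback of an ambient smooth function. -/
lemma isSmooth_of_eq (hι : Function.Injective ι) {f : M → F} {g : E → F}
    (hg : ContDiffOn ℝ ∞ g (Set.range ι)) (h : ∀ p, f p = g (ι p)) : IsSmooth ι f := by
  refine hg.congr ?_
  rintro _ ⟨p, rfl⟩
  rw [extend_self hι, h]

lemma isSmooth_comp_emb (hι : Function.Injective ι) {g : E → F} (hg : ContDiff ℝ ∞ g) :
    IsSmooth ι (fun p => g (ι p)) := isSmooth_of_eq hι hg.contDiffOn fun _ => rfl

lemma isSmooth_const (hι : Function.Injective ι) (c : F) : IsSmooth ι (fun _ : M => c) :=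
  isSmooth_comp_emb hι (g := fun _ => c) contDiff_const

lemma IsSmooth.comp_contDiffOn (hι : Function.Injective ι) {f : M → F} (hf : IsSmooth ι f)
    {g : F → F'} {s : Set F} (hg : ContDiffOn ℝ ∞ g s) (hs : ∀ p, f p ∈ s) :
    IsSmooth ι (fun p => g (f p)) := by
  refine isSmooth_of_eq hι (g := fun x => g (Function.extend ι f 0 x)) (hg.comp hf ?_) ?_
  · rintro _ ⟨p, rfl⟩
    simpa [extend_self hι] using hs p
  · intro p
    rw [extend_self hι]

lemma IsSmooth.comp_contDiff (hι : Function.Injective ι) {f : M → F} (hf : IsSmooth ι f)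
    {g : F → F'} (hg : ContDiff ℝ ∞ g) : IsSmooth ι (fun p => g (f p)) :=
  hf.comp_contDiffOn hι (s := Set.univ) hg.contDiffOn fun _ => trivial

lemma IsSmooth.prodMk (hι : Function.Injective ι) {f : M → F} {g : M → F'} (hf : IsSmooth ι f)
    (hg : IsSmooth ι g) : IsSmooth ι (fun p => (f p, g p)) := by
  refine isSmooth_of_eq hι (ContDiffOn.prodMk hf hg) ?_
  intro p
  rw [extend_self hι, extend_self hι]

lemma IsSmooth.add (hι : Function.Injective ι) {f g : M → F} (hf : IsSmooth ι f)
    (hg : IsSmooth ι g) : IsSmooth ι (fun p => f p + g p) :=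
  (hf.prodMk hι hg).comp_contDiff hι (g := fun z : F × F => z.1 + z.2) (by fun_prop)

lemma IsSmooth.mul (hι : Function.Injective ι) {A : Type*} [NormedRing A] [NormedAlgebra ℝ A]
    {f g : M → A} (hf : IsSmooth ι f)
    (hg : IsSmooth ι g) : IsSmooth ι (fun p => f p * g p) :=
  (hf.prodMk hι hg).comp_contDiff hι (g := fun z : A × A => z.1 * z.2) (by fun_prop)

lemma IsSmooth.smul (hι : Function.Injective ι) {f : M → ℝ} {g : M → F} (hf : IsSmooth ι f)
    (hg : IsSmooth ι g) : IsSmooth ι (fun p => f p • g p) :=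
  (hf.prodMk hι hg).comp_contDiff hι (g := fun z : ℝ × F => z.1 • z.2) (by fun_prop)

lemma IsSmooth.hasFDerivWithinAt {f : M → F} (hf : IsSmooth ι f) (p : M) :
    HasFDerivWithinAt (Function.extend ι f 0)
      (fderivWithin ℝ (Function.extend ι f 0) (Set.range ι) (ι p)) (Set.range ι) (ι p) :=
  ((hf.differentiableOn (by simp)) _ ⟨p, rfl⟩).hasFDerivWithinAt

/-- Pulling back a smooth function along a map which is smooth in the ambient coordinates. -/
lemma IsSmooth.pullback (hι : Function.Injective ι) (hι' : Function.Injective ι') {φ : M → M'}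
    {Φ : E → E'} (hΦ : ContDiffOn ℝ ∞ Φ (Set.range ι)) (h : ∀ p, ι' (φ p) = Φ (ι p))
    {u : M' → F} (hu : IsSmooth ι' u) : IsSmooth ι (fun p => u (φ p)) := by
  refine isSmooth_of_eq hι (g := fun x => Function.extend ι' u 0 (Φ x)) (hu.comp hΦ ?_) ?_
  · rintro _ ⟨p, rfl⟩
    exact ⟨φ p, h p⟩
  · intro p
    rw [← h, extend_self hι']

/-- The chain rule for pulling back. -/
lemma hasFDerivWithinAt_pullback (hι : Function.Injective ι) (hι' : Function.Injective ι')
    {φ : M → M'} {Φ : E → E'} {Φ' : E →L[ℝ] E'} {p : M}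
    (hΦ : HasFDerivWithinAt Φ Φ' (Set.range ι) (ι p))
    (h : ∀ p, ι' (φ p) = Φ (ι p)) {u : M' → F} {A : E' →L[ℝ] F}
    (hA : HasFDerivWithinAt (Function.extend ι' u 0) A (Set.range ι') (ι' (φ p))) :
    HasFDerivWithinAt (Function.extend ι (fun p => u (φ p)) 0) (A.comp Φ') (Set.range ι)
      (ι p) := by
  rw [h] at hA
  have h1 : HasFDerivWithinAt (fun x => Function.extend ι' u 0 (Φ x)) (A.comp Φ') (Set.range ι)
      (ι p) := by
    refine hA.comp (ι p) hΦ ?_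
    rintro _ ⟨q, rfl⟩
    exact ⟨φ q, h q⟩
  have h2 : ∀ q, Function.extend ι (fun p => u (φ p)) 0 (ι q) =
      Function.extend ι' u 0 (Φ (ι q)) := fun q => by
    rw [extend_self hι, ← h, extend_self hι']
  refine h1.congr ?_ (h2 p)
  rintro _ ⟨q, rfl⟩
  exact h2 q

lemma dirDeriv_pullback (hι : Function.Injective ι) (hι' : Function.Injective ι') {φ : M → M'}
    {Φ : E → E'} {Φ' : E →L[ℝ] E'} {p : M} (hΦ : HasFDerivWithinAt Φ Φ' (Set.range ι) (ι p))
    (h : ∀ p, ι' (φ p) = Φ (ι p)) {u : M' → F} (hu : IsSmooth ι' u) {v : E}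
    (hv : v ∈ tanSpan ι p) :
    dirDeriv ι (fun p => u (φ p)) p v = dirDeriv ι' u (φ p) (Φ' v) :=
  dirDeriv_eq (hasFDerivWithinAt_pullback hι hι' hΦ h (hu.hasFDerivWithinAt _)) hv

/-- A smooth vector field which is tangent in the sense of `tanSpan` maps smooth functions to
smooth functions. -/
lemma IsSmooth.vecDeriv (hι : Function.Injective ι) {f : M → F} (hf : IsSmooth ι f) {V : M → E}
    (hV : IsSmooth ι V) (hT : ∀ p, V p ∈ tanSpan ι p) : IsSmooth ι (vecDeriv ι V f) := by
  rintro _ ⟨p, rfl⟩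
  rw [contDiffWithinAt_infty]
  intro n
  have h1 : ContDiffWithinAt ℝ ((n : ℕ∞ω) + 1) (Function.extend ι f 0) (Set.range ι) (ι p) :=
    (hf (ι p) ⟨p, rfl⟩).of_le (by exact_mod_cast le_top)
  obtain ⟨s, hs, hsub, -, f', hf', hc⟩ :=
    (contDiffWithinAt_succ_iff_hasFDerivWithinAt' (by simp)).1 h1
  rw [Set.insert_eq_of_mem (Set.mem_range_self p)] at hs hsub
  have h2 : ContDiffWithinAt ℝ n (fun x => f' x (Function.extend ι V 0 x)) (Set.range ι) (ι p) :=
    hc.clm_apply ((hV (ι p) ⟨p, rfl⟩).of_le (by exact_mod_cast le_top))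
  refine h2.congr_of_eventuallyEq_of_mem ?_ (Set.mem_range_self p)
  filter_upwards [hs] with x hx
  obtain ⟨q, rfl⟩ := hsub hx
  rw [extend_self hι, extend_self hι]
  exact dirDeriv_eq (hf' _ hx) (hT q)

lemma dirDeriv_add_vec (f : M → F) (p : M) (v w : E) :
    dirDeriv ι f p (v + w) = dirDeriv ι f p v + dirDeriv ι f p w := map_add _ _ _

lemma dirDeriv_smul_vec (f : M → F) (p : M) (c : ℝ) (v : E) :
    dirDeriv ι f p (c • v) = c • dirDeriv ι f p v := map_smul _ _ _

lemma dirDeriv_sum_vec (f : M → F) (p : M) {J : Type*} (s : Finset J) (v : J → E) :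
    dirDeriv ι f p (∑ j ∈ s, v j) = ∑ j ∈ s, dirDeriv ι f p (v j) := map_sum _ _ _

lemma dirDeriv_add (hι : Function.Injective ι) {f g : M → F} (hf : IsSmooth ι f)
    (hg : IsSmooth ι g) {p : M} {v : E} (hv : v ∈ tanSpan ι p) :
    dirDeriv ι (fun q => f q + g q) p v = dirDeriv ι f p v + dirDeriv ι g p v := by
  have h := (hf.hasFDerivWithinAt p).add (hg.hasFDerivWithinAt p)
  refine dirDeriv_eq (h.congr ?_ ?_) hv
  · rintro _ ⟨q, rfl⟩
    simp [extend_self hι]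
  · simp [extend_self hι]

lemma dirDeriv_mul (hι : Function.Injective ι) {f g : M → ℂ} (hf : IsSmooth ι f)
    (hg : IsSmooth ι g) {p : M} {v : E} (hv : v ∈ tanSpan ι p) :
    dirDeriv ι (fun q => f q * g q) p v = f p * dirDeriv ι g p v + dirDeriv ι f p v * g p := by
  have h := (hf.hasFDerivWithinAt p).mul (hg.hasFDerivWithinAt p)
  have h2 := dirDeriv_eq (f := fun q => f q * g q) (h.congr ?_ ?_) hv
  · rw [h2]
    simp [extend_self hι, dirDeriv, mul_comm]
  · rintro _ ⟨q, rfl⟩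
    simp [extend_self hι]
  · simp [extend_self hι]

/-- Derivatives along curves in the image of `ι`. -/
lemma hasDerivWithinAt_curve (hι : Function.Injective ι) {f : M → F} (hf : IsSmooth ι f)
    {γ : ℝ → M} {s : Set ℝ} {t : ℝ} {v : E}
    (hγ : HasDerivWithinAt (fun t => ι (γ t)) v s t) :
    HasDerivWithinAt (fun t => f (γ t)) (dirDeriv ι f (γ t) v) s t := by
  have h1 := (hf.hasFDerivWithinAt (γ t)).comp_hasDerivWithinAt (f := fun t => ι (γ t)) t hγ
    (fun x _ => ⟨γ x, rfl⟩)
  refine h1.congr (fun x _ => ?_) ?_ <;> simp [extend_self hι]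

end EmbeddedCalculus

/-! ### Smooth operations on `2 × 2` matrices -/

/-- The topology of the Frobenius norm. It is the product topology, but only up to unfolding
definitions; with this instance continuous linear maps between spaces of matrices are
syntactically those of the normed spaces. -/
local instance matTopologicalSpace {𝕜 : Type*} [RCLike 𝕜] : TopologicalSpace (Mat 𝕜) :=
  (Matrix.frobeniusNormedAddCommGroup :
    NormedAddCommGroup (Mat 𝕜)).toMetricSpace.toPseudoMetricSpace.toUniformSpace.toTopologicalSpace

section MatrixCalculus

variable {𝕜 : Type*} [RCLike 𝕜]

/-- The entries of a matrix as real-linear functionals. -/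
def entryL (i j : Fin 2) : Mat 𝕜 →L[ℝ] 𝕜 :=
  LinearMap.toContinuousLinearMap (Matrix.entryLinearMap ℝ 𝕜 i j)

@[simp] lemma entryL_apply (i j : Fin 2) (x : Mat 𝕜) : entryL i j x = x i j := rfl

/-- The trace as a real-linear functional. -/
def traceL : Mat 𝕜 →L[ℝ] 𝕜 := LinearMap.toContinuousLinearMap (Matrix.traceLinearMap (Fin 2) ℝ 𝕜)

@[simp] lemma traceL_apply (x : Mat 𝕜) : traceL x = x.trace := rfl

/-- The conjugate transpose as a real-linear map. -/
def starL : Mat 𝕜 →L[ℝ] Mat 𝕜 :=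
  LinearMap.toContinuousLinearMap
    { toFun := fun x => xᴴ
      map_add' := Matrix.conjTranspose_add
      map_smul' := fun c x => by simp [Matrix.conjTranspose_smul] }

@[simp] lemma starL_apply (x : Mat 𝕜) : starL x = xᴴ := rfl

@[fun_prop] lemma contDiff_trace {n : ℕ∞ω} : ContDiff ℝ n (fun x : Mat 𝕜 => x.trace) :=
  (traceL (𝕜 := 𝕜)).contDiff

@[fun_prop] lemma contDiff_conjTranspose {n : ℕ∞ω} : ContDiff ℝ n (fun x : Mat 𝕜 => xᴴ) :=
  (starL (𝕜 := 𝕜)).contDiff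

@[fun_prop] lemma contDiff_re {n : ℕ∞ω} : ContDiff ℝ n (fun x : 𝕜 => RCLike.re x) :=
  (RCLike.reCLM (K := 𝕜)).contDiff

@[fun_prop] lemma contDiff_det {n : ℕ∞ω} : ContDiff ℝ n (fun x : Mat 𝕜 => x.det) := by
  simp only [Matrix.det_fin_two, ← entryL_apply]
  fun_prop

lemma adjugate_eq (x : Mat 𝕜) : x.adjugate = x.trace • 1 - x := by
  ext i j
  fin_cases i <;> fin_cases j <;> simp [Matrix.adjugate_fin_two, Matrix.trace_fin_two]

@[fun_prop] lemma contDiff_adjugate {n : ℕ∞ω} : ContDiff ℝ n (fun x : Mat 𝕜 => x.adjugate) := by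
  simp only [adjugate_eq]
  fun_prop

lemma hasFDerivAt_det (x : Mat 𝕜) :
    HasFDerivAt (fun x : Mat 𝕜 => x.det)
      (traceL.comp (ContinuousLinearMap.mul ℝ (Mat 𝕜) x.adjugate)) x := by
  have h := (((entryL (𝕜 := 𝕜) 0 0).hasFDerivAt (x := x)).mul ((entryL 1 1).hasFDerivAt)).sub
    (((entryL (𝕜 := 𝕜) 0 1).hasFDerivAt (x := x)).mul ((entryL 1 0).hasFDerivAt))
  have h2 : (fun x : Mat 𝕜 => x.det) =
      (⇑(entryL (𝕜 := 𝕜) 0 0) * ⇑(entryL 1 1) - ⇑(entryL (𝕜 := 𝕜) 0 1) * ⇑(entryL 1 0)) := by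
    ext x
    simp [Matrix.det_fin_two]
  rw [h2]
  refine h.congr_fderiv ?_
  ext w
  simp [Matrix.trace_fin_two, Matrix.adjugate_fin_two, Matrix.vecMul, dotProduct]
  ring

end MatrixCalculus

/-! ### Invariant derivatives on the group -/

section GroupCalculus

variable {𝕜 : Type*} [RCLike 𝕜]

lemma embG_injective : Function.Injective (embG 𝕜) := Subtype.coe_injective

lemma range_embG : Set.range (embG 𝕜) = {x | x.det = 1} := by
  ext x
  exact ⟨by rintro ⟨g, rfl⟩; exact g.2, fun h => ⟨⟨x, h⟩, rfl⟩⟩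

/-- The left-invariant derivative along `ξ`. -/
def leftDeriv (ξ : Mat 𝕜) (u : G 𝕜 → ℂ) : G 𝕜 → ℂ :=
  vecDeriv (embG 𝕜) (fun g => (g : Mat 𝕜) * ξ) u

/-- The right-invariant derivative along `ξ`. -/
def rightDeriv (ξ : Mat 𝕜) (u : G 𝕜 → ℂ) : G 𝕜 → ℂ :=
  vecDeriv (embG 𝕜) (fun g => ξ * (g : Mat 𝕜)) u

/-- The retraction `x ↦ x diag(1, 1 / det x)` of the invertible matrices onto `G`. -/
def retr (x : Mat 𝕜) : Mat 𝕜 := x * !![1, 0; 0, 0] + (x.det)⁻¹ • (x * !![0, 0; 0, 1])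

lemma det_retr {x : Mat 𝕜} (hx : x.det ≠ 0) : (retr x).det = 1 := by
  rw [Matrix.det_fin_two] at hx
  simp [retr, Matrix.det_fin_two, Matrix.mul_apply, Fin.sum_univ_two]
  field_simp

lemma retr_of_det {x : Mat 𝕜} (hx : x.det = 1) : retr x = x := by
  rw [retr, hx, inv_one, one_smul, ← mul_add]
  have : (!![1, 0; 0, 0] + !![0, 0; 0, 1] : Mat 𝕜) = 1 := by
    ext i j; fin_cases i <;> fin_cases j <;> simp
  rw [this, mul_one]

lemma isOpen_det_ne_zero : IsOpen {x : Mat 𝕜 | x.det ≠ 0} :=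
  isOpen_ne_fun (contDiff_det (n := 0)).continuous continuous_const

lemma contDiffOn_retr : ContDiffOn ℝ ∞ (retr (𝕜 := 𝕜)) {x | x.det ≠ 0} := by
  unfold retr
  refine ContDiffOn.add (by fun_prop) (ContDiffOn.smul (ContDiffOn.inv ?_ fun x hx => hx) ?_)
  all_goals fun_prop

/-- The projection `ξ ↦ ξ - diag(0, tr ξ)` onto the matrices of trace zero. -/
def slProj : Mat 𝕜 →L[ℝ] Mat 𝕜 :=
  ContinuousLinearMap.id ℝ _ - (traceL (𝕜 := 𝕜)).smulRight (!![0, 0; 0, 1] : Mat 𝕜)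

lemma slProj_apply (ξ : Mat 𝕜) : slProj ξ = ξ - ξ.trace • !![0, 0; 0, 1] := rfl

lemma trace_slProj (ξ : Mat 𝕜) : (slProj ξ).trace = 0 := by
  simp [slProj_apply, Matrix.trace_fin_two]

lemma slProj_of_trace {ξ : Mat 𝕜} (h : ξ.trace = 0) : slProj ξ = ξ := by
  simp [slProj_apply, h]

/-- The differential of the retraction at a point `g` of `G` is `w ↦ g slProj(g⁻¹ w)`; the adjugate stands
for the inverse. -/
lemma hasFDerivAt_retr {g : Mat 𝕜} (hg : g.det = 1) :
    HasFDerivAt (retr (𝕜 := 𝕜))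
      ((ContinuousLinearMap.mul ℝ (Mat 𝕜) g).comp
        (slProj.comp (ContinuousLinearMap.mul ℝ (Mat 𝕜) g.adjugate))) g := by
  have h1 : HasFDerivAt (fun x : Mat 𝕜 => (x.det)⁻¹) _ g :=
    (hasDerivAt_inv (𝕜 := 𝕜) (by rw [hg]; exact one_ne_zero : g.det ≠ 0)).hasFDerivAt.restrictScalars
      ℝ |>.comp g (hasFDerivAt_det g)
  have h2 (c : Mat 𝕜) : HasFDerivAt (fun x : Mat 𝕜 => x * c) _ g :=
    ((ContinuousLinearMap.mul ℝ (Mat 𝕜)).flip c).hasFDerivAt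
  refine ((h2 _).add (h1.smul (h2 _))).congr_fderiv ?_
  ext w : 1
  have h3 : g * (g.adjugate * w) = w := by
    rw [← mul_assoc, Matrix.mul_adjugate, hg, one_smul, one_mul]
  have h4 : w * (!![1, 0; 0, 0] + !![0, 0; 0, 1] : Mat 𝕜) = w := by
    have : (!![1, 0; 0, 0] + !![0, 0; 0, 1] : Mat 𝕜) = 1 := by
      ext i j; fin_cases i <;> fin_cases j <;> simp
    rw [this, mul_one]
  simp only [hg, add_apply, ContinuousLinearMap.flip_apply, ContinuousLinearMap.mul_apply',
    ContinuousLinearMap.comp_apply, ContinuousLinearMap.smulRight_apply, traceL_apply,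
    ContinuousLinearMap.coe_restrictScalars', ContinuousLinearMap.toSpanSingleton_apply,
    slProj_apply, inv_one, one_smul, ← add_assoc, ← mul_add, h4]
  rw [mul_sub, h3, mul_smul_comm, sub_eq_add_neg]
  simp

/-- The differential of a retraction onto `G` takes all vectors to tangent vectors of `G`. -/
lemma retr_fderiv_mem (g : G 𝕜) (w : Mat 𝕜) :
    (g : Mat 𝕜) * slProj ((g : Mat 𝕜).adjugate * w) ∈ tanSpan (embG 𝕜) g := by
  have h1 := (hasFDerivAt_retr g.2).hasFDerivWithinAt (s := {x | x.det ≠ 0})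
  have h2 : w ∈ tangentConeAt ℝ {x : Mat 𝕜 | x.det ≠ 0} g := by
    rw [tangentConeAt_of_mem_nhds (isOpen_det_ne_zero.mem_nhds (by simp [g.2]))]
    trivial
  have h3 := h1.mapsTo_tangent_cone h2
  rw [retr_of_det g.2] at h3
  refine Submodule.subset_span (tangentConeAt_mono ?_ h3)
  rintro _ ⟨x, hx, rfl⟩
  rw [range_embG]
  exact det_retr hx

lemma mul_mem_tanSpan (g : G 𝕜) {ξ : Mat 𝕜} (hξ : ξ.trace = 0) :
    (g : Mat 𝕜) * ξ ∈ tanSpan (embG 𝕜) g := by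
  have h := retr_fderiv_mem g ((g : Mat 𝕜) * ξ)
  rwa [← mul_assoc, Matrix.adjugate_mul, g.2, one_smul, one_mul, slProj_of_trace hξ] at h

lemma mul_mem_tanSpan' (g : G 𝕜) {ξ : Mat 𝕜} (hξ : ξ.trace = 0) :
    ξ * (g : Mat 𝕜) ∈ tanSpan (embG 𝕜) g := by
  have h1 : ξ * (g : Mat 𝕜) = (g : Mat 𝕜) * ((g : Mat 𝕜).adjugate * ξ * g) := by
    rw [mul_assoc, ← mul_assoc (g : Mat 𝕜), Matrix.mul_adjugate, g.2, one_smul, one_mul]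
  rw [h1]
  refine mul_mem_tanSpan g ?_
  rw [mul_assoc, Matrix.trace_mul_comm, mul_assoc, Matrix.mul_adjugate, g.2, one_smul, mul_one, hξ]

/-- The real Lie algebra `sl(2, 𝕜)`. -/
def sl2 (𝕜 : Type*) [RCLike 𝕜] : Submodule ℝ (Mat 𝕜) := LinearMap.ker (traceL (𝕜 := 𝕜)).toLinearMap

lemma mem_sl2 {ξ : Mat 𝕜} : ξ ∈ sl2 𝕜 ↔ ξ.trace = 0 := Iff.rfl

/-- The index set of the basis `slBasis`. -/
abbrev SlIdx (𝕜 : Type*) [RCLike 𝕜] : Type := Fin (Module.finrank ℝ (sl2 𝕜))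

/-- A real basis of `sl(2, 𝕜)`. -/
def slBasis (j : SlIdx 𝕜) : Mat 𝕜 := (Module.finBasis ℝ (sl2 𝕜) j : Mat 𝕜)

lemma trace_slBasis (j : SlIdx 𝕜) : (slBasis (𝕜 := 𝕜) j).trace = 0 :=
  (Module.finBasis ℝ (sl2 𝕜) j).2

/-- The coordinates of `slProj ξ` in the basis `slBasis`. -/
def slCoord (j : SlIdx 𝕜) : Mat 𝕜 →L[ℝ] ℝ :=
  LinearMap.toContinuousLinearMap (((Module.finBasis ℝ (sl2 𝕜)).coord j).comp
    (LinearMap.codRestrict (sl2 𝕜) slProj.toLinearMap fun ξ => mem_sl2.2 (trace_slProj ξ)))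

lemma slProj_eq_sum (ξ : Mat 𝕜) : slProj ξ = ∑ j : SlIdx 𝕜, slCoord j ξ • slBasis j := by
  have h := (Module.finBasis ℝ (sl2 𝕜)).sum_repr ⟨slProj ξ, mem_sl2.2 (trace_slProj ξ)⟩
  have h2 := congrArg (Submodule.subtype (sl2 𝕜)) h
  rw [map_sum] at h2
  exact h2.symm

lemma eq_sum_slBasis {ξ : Mat 𝕜} (hξ : ξ.trace = 0) :
    ξ = ∑ j : SlIdx 𝕜, slCoord j ξ • slBasis j := by
  rw [← slProj_eq_sum, slProj_of_trace hξ]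

/-- The differential of a function on `G` is determined by its left-invariant derivatives. -/
lemma hasFDerivWithinAt_embG {v : G 𝕜 → ℂ} (hv : IsSmooth (embG 𝕜) v) (g : G 𝕜) :
    HasFDerivWithinAt (Function.extend (embG 𝕜) v 0)
      (∑ j : SlIdx 𝕜, ((slCoord j).comp
        (ContinuousLinearMap.mul ℝ (Mat 𝕜) (g : Mat 𝕜).adjugate)).smulRight
          (leftDeriv (slBasis j) v g)) (Set.range (embG 𝕜)) (embG 𝕜 g) := by
  have h1 := hasFDerivWithinAt_pullback (ι := embG 𝕜) (ι' := embG 𝕜) (φ := id) (Φ := retr) (p := g)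
    embG_injective embG_injective (hasFDerivAt_retr g.2).hasFDerivWithinAt
    (fun p => (retr_of_det p.2).symm) (hv.hasFDerivWithinAt _)
  refine h1.congr_fderiv ?_
  ext w : 1
  simp only [ContinuousLinearMap.comp_apply, ContinuousLinearMap.mul_apply',
    sum_apply, ContinuousLinearMap.smulRight_apply]
  rw [slProj_eq_sum, Finset.mul_sum, map_sum]
  refine Finset.sum_congr rfl fun j _ => ?_
  rw [mul_smul_comm, map_smul]
  rfl

lemma isSmooth_mul_left (ξ : Mat 𝕜) : IsSmooth (embG 𝕜) (fun g => (g : Mat 𝕜) * ξ) :=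
  isSmooth_comp_emb embG_injective (g := fun x : Mat 𝕜 => x * ξ) (by fun_prop)

lemma isSmooth_mul_right (ξ : Mat 𝕜) : IsSmooth (embG 𝕜) (fun g => ξ * (g : Mat 𝕜)) :=
  isSmooth_comp_emb embG_injective (g := fun x : Mat 𝕜 => ξ * x) (by fun_prop)

lemma IsSmooth.leftDeriv {u : G 𝕜 → ℂ} (hu : IsSmooth (embG 𝕜) u) {ξ : Mat 𝕜}
    (hξ : ξ.trace = 0) : IsSmooth (embG 𝕜) (leftDeriv ξ u) :=
  hu.vecDeriv embG_injective (isSmooth_mul_left ξ) fun g => mul_mem_tanSpan g hξ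

lemma IsSmooth.rightDeriv {u : G 𝕜 → ℂ} (hu : IsSmooth (embG 𝕜) u) {ξ : Mat 𝕜}
    (hξ : ξ.trace = 0) : IsSmooth (embG 𝕜) (rightDeriv ξ u) :=
  hu.vecDeriv embG_injective (isSmooth_mul_right ξ) fun g => mul_mem_tanSpan' g hξ

lemma leftDeriv_add {u v : G 𝕜 → ℂ} (hu : IsSmooth (embG 𝕜) u) (hv : IsSmooth (embG 𝕜) v)
    {ξ : Mat 𝕜} (hξ : ξ.trace = 0) :
    leftDeriv ξ (u + v) = leftDeriv ξ u + leftDeriv ξ v :=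
  funext fun g => dirDeriv_add embG_injective hu hv (mul_mem_tanSpan g hξ)

lemma rightDeriv_add {u v : G 𝕜 → ℂ} (hu : IsSmooth (embG 𝕜) u) (hv : IsSmooth (embG 𝕜) v)
    {ξ : Mat 𝕜} (hξ : ξ.trace = 0) :
    rightDeriv ξ (u + v) = rightDeriv ξ u + rightDeriv ξ v :=
  funext fun g => dirDeriv_add embG_injective hu hv (mul_mem_tanSpan' g hξ)

lemma leftDeriv_mul {u v : G 𝕜 → ℂ} (hu : IsSmooth (embG 𝕜) u) (hv : IsSmooth (embG 𝕜) v)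
    {ξ : Mat 𝕜} (hξ : ξ.trace = 0) :
    leftDeriv ξ (u * v) = u * leftDeriv ξ v + leftDeriv ξ u * v :=
  funext fun g => dirDeriv_mul embG_injective hu hv (mul_mem_tanSpan g hξ)

lemma rightDeriv_mul {u v : G 𝕜 → ℂ} (hu : IsSmooth (embG 𝕜) u) (hv : IsSmooth (embG 𝕜) v)
    {ξ : Mat 𝕜} (hξ : ξ.trace = 0) :
    rightDeriv ξ (u * v) = u * rightDeriv ξ v + rightDeriv ξ u * v :=
  funext fun g => dirDeriv_mul embG_injective hu hv (mul_mem_tanSpan' g hξ)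

/-- The iterated derivative along two linear vector fields `X` and `Y`, in terms of an ambient
extension `U` of the function. -/
lemma vecDeriv_vecDeriv {u : G 𝕜 → ℂ} {U : Mat 𝕜 → ℂ} (hU : ∀ g : G 𝕜, ContDiffAt ℝ ∞ U g)
    (h : ∀ g : G 𝕜, u g = U g) {X Y : Mat 𝕜 →L[ℝ] Mat 𝕜}
    (hX : ∀ g : G 𝕜, X g ∈ tanSpan (embG 𝕜) g) (hY : ∀ g : G 𝕜, Y g ∈ tanSpan (embG 𝕜) g)
    (g : G 𝕜) :
    vecDeriv (embG 𝕜) (fun g => Y g) (vecDeriv (embG 𝕜) (fun g => X g) u) g =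
      fderiv ℝ (fderiv ℝ U) g (Y g) (X g) + fderiv ℝ U g (X (Y g)) := by
  have h1 : ∀ g : G 𝕜, vecDeriv (embG 𝕜) (fun g => X g) u g = fderiv ℝ U g (X g) := by
    intro g
    refine dirDeriv_eq ?_ (hX g)
    have h2 := ((hU g).differentiableAt (by simp)).hasFDerivAt.hasFDerivWithinAt
      (s := Set.range (embG 𝕜))
    refine h2.congr ?_ ?_
    · rintro _ ⟨q, rfl⟩
      exact (extend_self embG_injective _ q).trans (h q)
    · exact (extend_self embG_injective _ g).trans (h g)
  refine dirDeriv_eq (A := ((fderiv ℝ (fderiv ℝ U) g).flip (X g)) + (fderiv ℝ U g).comp X) ?_ (hY g)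
  have h3 : HasFDerivAt (fun x => fderiv ℝ U x) (fderiv ℝ (fderiv ℝ U) g) (g : Mat 𝕜) := by
    have h4 : ContDiffAt ℝ 1 (fderiv ℝ U) (g : Mat 𝕜) :=
      (hU g).fderiv_right (m := 1) (by norm_cast)
    exact (h4.differentiableAt (by simp)).hasFDerivAt
  have h5 := (h3.clm_apply (X.hasFDerivAt (x := (g : Mat 𝕜)))).hasFDerivWithinAt
    (s := Set.range (embG 𝕜))
  refine (h5.congr ?_ ?_).congr_fderiv ?_
  · rintro _ ⟨q, rfl⟩
    exact (extend_self embG_injective _ q).trans (h1 q)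
  · exact (extend_self embG_injective _ g).trans (h1 g)
  · ext w
    simp [add_comm]

/-- Left- and right-invariant derivatives commute: for an ambient extension of the function this is
the symmetry of the second derivative together with `(ζ g) ξ = ζ (g ξ)`. -/
lemma leftDeriv_rightDeriv {u : G 𝕜 → ℂ} (hu : IsSmooth (embG 𝕜) u) {ξ ζ : Mat 𝕜}
    (hξ : ξ.trace = 0) (hζ : ζ.trace = 0) :
    leftDeriv ξ (rightDeriv ζ u) = rightDeriv ζ (leftDeriv ξ u) := by
  have hU : ∀ g : G 𝕜, ContDiffAt ℝ ∞ (fun x => Function.extend (embG 𝕜) u 0 (retr x)) g := by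
    intro g
    refine ContDiffOn.contDiffAt (s := {x : Mat 𝕜 | x.det ≠ 0}) ?_
      (isOpen_det_ne_zero.mem_nhds (by simp [g.2]))
    refine hu.comp contDiffOn_retr fun x hx => ?_
    rw [range_embG]
    exact det_retr hx
  have h : ∀ g : G 𝕜, u g = Function.extend (embG 𝕜) u 0 (retr g) := by
    intro g
    rw [retr_of_det g.2]
    exact (extend_self embG_injective u g).symm
  funext g
  have hL : ∀ g : G 𝕜, (ContinuousLinearMap.mul ℝ (Mat 𝕜)).flip ξ g ∈ tanSpan (embG 𝕜) g :=
    fun g => mul_mem_tanSpan g hξ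
  have hR : ∀ g : G 𝕜, (ContinuousLinearMap.mul ℝ (Mat 𝕜)) ζ g ∈ tanSpan (embG 𝕜) g :=
    fun g => mul_mem_tanSpan' g hζ
  have h1 := vecDeriv_vecDeriv hU h hL hR g
  have h2 := vecDeriv_vecDeriv hU h hR hL g
  refine h2.trans (Eq.trans ?_ h1.symm)
  have h3 := (hU g).isSymmSndFDerivAt
    (by rw [minSmoothness_of_isRCLikeNormedField]; exact WithTop.coe_le_coe.2 le_top)
  have h4 : ζ * ((g : Mat 𝕜) * ξ) = ζ * (g : Mat 𝕜) * ξ := (mul_assoc _ _ _).symm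
  exact congrArg₂ (· + ·) (h3 _ _) (congrArg _ h4)

/-! ### Conormal functions on the group -/

/-- `S` consists of smooth functions and is stable under the invariant derivatives. -/
def IsStable (S : Set (G 𝕜 → ℂ)) : Prop :=
  ∀ u ∈ S, IsSmooth (embG 𝕜) u ∧
    ∀ ξ : Mat 𝕜, ξ.trace = 0 → leftDeriv ξ u ∈ S ∧ rightDeriv ξ u ∈ S

/-- The largest set of smooth functions which is contained in `B` and stable under the invariant
derivatives. It consists of the functions all of whose iterated invariant derivatives lie in
`B`. -/
def Conormal (B : Set (G 𝕜 → ℂ)) : Set (G 𝕜 → ℂ) := {u | ∃ S ⊆ B, IsStable S ∧ u ∈ S}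

lemma conormal_subset (B : Set (G 𝕜 → ℂ)) : Conormal B ⊆ B := fun _ ⟨_, h1, _, h2⟩ => h1 h2

lemma isStable_conormal (B : Set (G 𝕜 → ℂ)) : IsStable (Conormal B) := by
  rintro u ⟨S, h1, h2, h3⟩
  exact ⟨(h2 u h3).1, fun ξ hξ => ⟨⟨S, h1, h2, ((h2 u h3).2 ξ hξ).1⟩,
    ⟨S, h1, h2, ((h2 u h3).2 ξ hξ).2⟩⟩⟩

/-- Products of conormal functions are conormal, with the sums that the Leibniz rule produces. -/
lemma conormal_mul {A B B' : Set (G 𝕜 → ℂ)} (hm : ∀ a ∈ A, ∀ u ∈ B, a * u ∈ B')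
    (ha : ∀ u ∈ B', ∀ v ∈ B', u + v ∈ B') {a u : G 𝕜 → ℂ} (h1 : a ∈ Conormal A)
    (h2 : u ∈ Conormal B) : a * u ∈ Conormal B' := by
  let S := AddSubsemigroup.closure {w : G 𝕜 → ℂ | ∃ a ∈ Conormal A, ∃ u ∈ Conormal B, w = a * u}
  refine ⟨S, ?_, ?_, AddSubsemigroup.subset_closure ⟨a, h1, u, h2, rfl⟩⟩
  · intro w hw
    induction hw using AddSubsemigroup.closure_induction with
    | mem w hw =>
      obtain ⟨a, ha, u, hu, rfl⟩ := hw
      exact hm a (conormal_subset _ ha) u (conormal_subset _ hu)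
    | add x y _ _ hx hy => exact ha x hx y hy
  · intro w hw
    induction hw using AddSubsemigroup.closure_induction with
    | mem w hw =>
      obtain ⟨a, ha, u, hu, rfl⟩ := hw
      have ha' := isStable_conormal _ a ha
      have hu' := isStable_conormal _ u hu
      refine ⟨ha'.1.mul embG_injective hu'.1, fun ξ hξ => ⟨?_, ?_⟩⟩
      · rw [leftDeriv_mul ha'.1 hu'.1 hξ]
        exact S.add_mem (AddSubsemigroup.subset_closure ⟨_, ha, _, (hu'.2 ξ hξ).1, rfl⟩)
          (AddSubsemigroup.subset_closure ⟨_, (ha'.2 ξ hξ).1, _, hu, rfl⟩)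
      · rw [rightDeriv_mul ha'.1 hu'.1 hξ]
        exact S.add_mem (AddSubsemigroup.subset_closure ⟨_, ha, _, (hu'.2 ξ hξ).2, rfl⟩)
          (AddSubsemigroup.subset_closure ⟨_, (ha'.2 ξ hξ).2, _, hu, rfl⟩)
    | add x y _ _ hx hy =>
      refine ⟨hx.1.add embG_injective hy.1, fun ξ hξ => ⟨?_, ?_⟩⟩
      · rw [leftDeriv_add hx.1 hy.1 hξ]
        exact S.add_mem (hx.2 ξ hξ).1 (hy.2 ξ hξ).1
      · rw [rightDeriv_add hx.1 hy.1 hξ]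
        exact S.add_mem (hx.2 ξ hξ).2 (hy.2 ξ hξ).2

lemma conormal_add {B : Set (G 𝕜 → ℂ)} (ha : ∀ u ∈ B, ∀ v ∈ B, u + v ∈ B) {u v : G 𝕜 → ℂ}
    (h1 : u ∈ Conormal B) (h2 : v ∈ Conormal B) : u + v ∈ Conormal B := by
  refine ⟨{w | ∃ u ∈ Conormal B, ∃ v ∈ Conormal B, w = u + v}, ?_, ?_, ⟨u, h1, v, h2, rfl⟩⟩
  · rintro _ ⟨u, hu, v, hv, rfl⟩
    exact ha _ (conormal_subset _ hu) _ (conormal_subset _ hv)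
  · rintro _ ⟨u, hu, v, hv, rfl⟩
    have hu' := isStable_conormal _ u hu
    have hv' := isStable_conormal _ v hv
    refine ⟨hu'.1.add embG_injective hv'.1, fun ξ hξ => ⟨?_, ?_⟩⟩
    · exact ⟨_, (hu'.2 ξ hξ).1, _, (hv'.2 ξ hξ).1, leftDeriv_add hu'.1 hv'.1 hξ⟩
    · exact ⟨_, (hu'.2 ξ hξ).2, _, (hv'.2 ξ hξ).2, rightDeriv_add hu'.1 hv'.1 hξ⟩

lemma IsLeftInvariantOp.isSmooth {D : (G 𝕜 → ℂ) → (G 𝕜 → ℂ)} (hD : IsLeftInvariantOp D) :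
    ∀ {u : G 𝕜 → ℂ}, IsSmooth (embG 𝕜) u → IsSmooth (embG 𝕜) (D u) := by
  induction hD with
  | mul a ha =>
    obtain ⟨c, rfl⟩ := ha
    exact fun hu => (isSmooth_const embG_injective c).mul embG_injective hu
  | vec V hV =>
    obtain ⟨ξ, hξ, rfl⟩ := hV
    exact fun hu => hu.leftDeriv hξ
  | add P Q _ _ hP hQ => exact fun hu => (hP hu).add embG_injective (hQ hu)
  | comp P Q _ _ hP hQ => exact fun hu => hP (hQ hu)

lemma IsRightInvariantOp.isSmooth {D : (G 𝕜 → ℂ) → (G 𝕜 → ℂ)} (hD : IsRightInvariantOp D) :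
    ∀ {u : G 𝕜 → ℂ}, IsSmooth (embG 𝕜) u → IsSmooth (embG 𝕜) (D u) := by
  induction hD with
  | mul a ha =>
    obtain ⟨c, rfl⟩ := ha
    exact fun hu => (isSmooth_const embG_injective c).mul embG_injective hu
  | vec V hV =>
    obtain ⟨ξ, hξ, rfl⟩ := hV
    exact fun hu => hu.rightDeriv hξ
  | add P Q _ _ hP hQ => exact fun hu => (hP hu).add embG_injective (hQ hu)
  | comp P Q _ _ hP hQ => exact fun hu => hP (hQ hu)

lemma rightDeriv_const_mul {u : G 𝕜 → ℂ} (hu : IsSmooth (embG 𝕜) u) (c : ℂ)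
    {ξ : Mat 𝕜} (hξ : ξ.trace = 0) :
    rightDeriv ξ ((fun _ => c) * u) = (fun _ => c) * rightDeriv ξ u := by
  have hc := isSmooth_const (ι := embG 𝕜) embG_injective c
  rw [rightDeriv_mul hc hu hξ]
  have h0 : rightDeriv ξ (fun _ : G 𝕜 => c) = 0 := by
    funext g
    refine dirDeriv_eq (A := 0) ?_ (mul_mem_tanSpan' g hξ)
    refine (hasFDerivWithinAt_const c _ _).congr ?_ (extend_self embG_injective _ _)
    rintro _ ⟨q, rfl⟩
    exact extend_self embG_injective _ _
  rw [h0, zero_mul, add_zero]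

/-- Left-invariant operators commute with right-invariant derivatives. -/
lemma IsLeftInvariantOp.rightDeriv_comm {D : (G 𝕜 → ℂ) → (G 𝕜 → ℂ)} (hD : IsLeftInvariantOp D)
    {ζ : Mat 𝕜} (hζ : ζ.trace = 0) :
    ∀ {u : G 𝕜 → ℂ}, IsSmooth (embG 𝕜) u → rightDeriv ζ (D u) = D (rightDeriv ζ u) := by
  induction hD with
  | mul a ha =>
    obtain ⟨c, rfl⟩ := ha
    exact fun hu => rightDeriv_const_mul hu c hζ
  | vec V hV =>
    obtain ⟨ξ, hξ, rfl⟩ := hV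
    exact fun hu => (leftDeriv_rightDeriv hu hξ hζ).symm
  | add P Q hP' hQ' hP hQ =>
    intro u hu
    have h := rightDeriv_add (IsLeftInvariantOp.isSmooth hP' hu)
      (IsLeftInvariantOp.isSmooth hQ' hu) hζ
    rw [hP hu, hQ hu] at h
    exact h
  | comp P Q hP' hQ' hP hQ =>
    intro u hu
    rw [hP (IsLeftInvariantOp.isSmooth hQ' hu), hQ hu]

/-- A smooth function whose derivatives `D₁ D₂ u` all lie in `B` is conormal. The functions
`D₁ D₂ u` form a stable set since right-invariant derivatives can be moved past `D₁`. -/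
lemma mem_conormal_of_ops {B : Set (G 𝕜 → ℂ)} {u : G 𝕜 → ℂ} (hu : IsSmooth (embG 𝕜) u)
    (h : ∀ D₁ D₂ : (G 𝕜 → ℂ) → (G 𝕜 → ℂ), IsLeftInvariantOp D₁ → IsRightInvariantOp D₂ →
      D₁ (D₂ u) ∈ B) : u ∈ Conormal B := by
  have hone : ∀ u : G 𝕜 → ℂ, (fun _ => (1 : ℂ)) * u = u := one_mul
  refine ⟨{w | ∃ D₁ D₂, IsLeftInvariantOp D₁ ∧ IsRightInvariantOp D₂ ∧ w = D₁ (D₂ u)}, ?_, ?_,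
    ⟨_, _, IsDiffOp.mul _ ⟨1, rfl⟩, IsDiffOp.mul _ ⟨1, rfl⟩, ?_⟩⟩
  · rintro _ ⟨D₁, D₂, h1, h2, rfl⟩
    exact h D₁ D₂ h1 h2
  · rintro _ ⟨D₁, D₂, h1, h2, rfl⟩
    refine ⟨h1.isSmooth (h2.isSmooth hu), fun ξ hξ => ⟨?_, ?_⟩⟩
    · exact ⟨_, D₂, IsDiffOp.comp _ _ (IsDiffOp.vec _ ⟨ξ, hξ, rfl⟩) h1, h2, rfl⟩
    · refine ⟨D₁, _, h1, IsDiffOp.comp _ _ (IsDiffOp.vec _ ⟨ξ, hξ, rfl⟩) h2, ?_⟩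
      exact h1.rightDeriv_comm hξ (h2.isSmooth hu)
  · rw [hone, hone]

end GroupCalculus

/-! ### Algebra of `2 × 2` matrices -/

section MatrixAlgebra

variable {𝕜 : Type*} [RCLike 𝕜]

lemma norm_sq_eq (x : Mat 𝕜) :
    ‖x‖ ^ 2 = ‖x 0 0‖ ^ 2 + ‖x 0 1‖ ^ 2 + (‖x 1 0‖ ^ 2 + ‖x 1 1‖ ^ 2) := by
  rw [Matrix.frobenius_norm_def, ← Real.sqrt_eq_rpow, Real.sq_sqrt (by positivity)]
  simp only [Fin.sum_univ_two, Real.rpow_two]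

lemma ofReal_norm_sq (x : Mat 𝕜) : ((‖x‖ ^ 2 : ℝ) : 𝕜) = (xᴴ * x).trace := by
  rw [norm_sq_eq]
  simp only [Matrix.trace_fin_two, Matrix.mul_apply, Matrix.conjTranspose_apply, Fin.sum_univ_two,
    RCLike.star_def, RCLike.conj_mul, map_add, map_pow]
  ring

lemma norm_sq_eq_trace (x : Mat 𝕜) : ‖x‖ ^ 2 = RCLike.re (xᴴ * x).trace := by
  rw [← ofReal_norm_sq, RCLike.ofReal_re]

lemma exists_eq_of_trace (x : Mat 𝕜) (t : 𝕜) (h : x.trace = t) :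
    ∃ a b c : 𝕜, x = !![a, b; c, t - a] := by
  refine ⟨x 0 0, x 0 1, x 1 0, ?_⟩
  rw [← h, Matrix.trace_fin_two]
  ext i j; fin_cases i <;> fin_cases j <;> simp

lemma mul_self_of_trace {b : Mat 𝕜} (hb : b.trace = 1) : b * b = b - b.det • 1 := by
  obtain ⟨p, q, r, rfl⟩ := exists_eq_of_trace b 1 hb
  ext i j; fin_cases i <;> fin_cases j <;> simp [Matrix.det_fin_two] <;> ring

lemma adjugate_of_trace {b : Mat 𝕜} (hb : b.trace = 1) : b.adjugate = 1 - b := by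
  rw [adjugate_eq, hb, one_smul]

/-- The real part of the determinant. On the ball of non-negative matrices of trace one it is a
boundary defining function. -/
def bdet (y : Mat 𝕜) : ℝ := RCLike.re y.det

lemma ofReal_bdet {y : Mat 𝕜} (hy : y.IsHermitian) : ((bdet y : ℝ) : 𝕜) = y.det := by
  refine RCLike.conj_eq_iff_re.1 ?_
  have h := Matrix.det_conjTranspose y
  rw [hy.eq] at h
  exact h.symm

lemma real_smul_eq (r : ℝ) (x : Mat 𝕜) : r • x = (r : 𝕜) • x := RCLike.real_smul_eq_coe_smul _ _

lemma ofReal_re_trace_mul {y w : Mat 𝕜} (hy : y.IsHermitian) (hw : w.IsHermitian) :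
    ((RCLike.re (y * w).trace : ℝ) : 𝕜) = (y * w).trace := by
  refine RCLike.conj_eq_iff_re.1 ?_
  have h := Matrix.trace_conjTranspose (y * w)
  rw [Matrix.conjTranspose_mul, hy.eq, hw.eq, Matrix.trace_mul_comm] at h
  exact h.symm

lemma eigenvalues_sum_prod {y : Mat 𝕜} (hy : y.IsHermitian) (ht : y.trace = 1) :
    hy.eigenvalues 0 + hy.eigenvalues 1 = 1 ∧ hy.eigenvalues 0 * hy.eigenvalues 1 = bdet y := by
  have h1 := hy.trace_eq_sum_eigenvalues
  have h2 := hy.det_eq_prod_eigenvalues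
  rw [ht, Fin.sum_univ_two] at h1
  rw [← ofReal_bdet hy, Fin.prod_univ_two] at h2
  exact ⟨by exact_mod_cast h1.symm, by exact_mod_cast h2.symm⟩

lemma posSemidef_iff_bdet {y : Mat 𝕜} (hy : y.IsHermitian) (ht : y.trace = 1) :
    y.PosSemidef ↔ 0 ≤ bdet y := by
  obtain ⟨h1, h2⟩ := eigenvalues_sum_prod hy ht
  rw [hy.posSemidef_iff_eigenvalues_nonneg, Pi.le_def, Fin.forall_fin_two]
  simp only [Pi.zero_apply]
  constructor
  · rintro ⟨h3, h4⟩
    rw [← h2]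
    positivity
  · intro h
    constructor <;> nlinarith

lemma posDef_iff_bdet {y : Mat 𝕜} (hy : y.IsHermitian) (ht : y.trace = 1) :
    y.PosDef ↔ 0 < bdet y := by
  obtain ⟨h1, h2⟩ := eigenvalues_sum_prod hy ht
  rw [hy.posDef_iff_eigenvalues_pos, Fin.forall_fin_two]
  constructor
  · rintro ⟨h3, h4⟩
    rw [← h2]
    positivity
  · intro h
    constructor <;> nlinarith

lemma bdet_le {y : Mat 𝕜} (hy : y.IsHermitian) (ht : y.trace = 1) : bdet y ≤ 1 / 4 := by
  obtain ⟨h1, h2⟩ := eigenvalues_sum_prod hy ht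
  nlinarith [sq_nonneg (hy.eigenvalues 0 - hy.eigenvalues 1)]

lemma norm_sq_of_herm {y : Mat 𝕜} (hy : y.IsHermitian) (ht : y.trace = 1) :
    ‖y‖ ^ 2 = 1 - 2 * bdet y := by
  rw [norm_sq_eq_trace, hy.eq, mul_self_of_trace ht, Matrix.trace_sub, Matrix.trace_smul, ht,
    ← ofReal_bdet hy]
  simp [mul_comm]

lemma adjugate_of_det {x : Mat 𝕜} (hx : xᴴ * x = 1) (hd : x.det = 1) : x.adjugate = xᴴ := by
  have h := Matrix.mul_adjugate x
  rw [hd, one_smul] at h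
  calc x.adjugate = xᴴ * x * x.adjugate := by rw [hx, one_mul]
    _ = xᴴ := by rw [mul_assoc, h, mul_one]

/-- A form of the Cayley-Hamilton theorem: `b η b = tr(b η) b + det(b) η` for `tr b = 1`, `tr η = 0`. -/
lemma mul_mul_of_trace {b η : Mat 𝕜} (hb : b.trace = 1) (hη : η.trace = 0) :
    b * η * b = (b * η).trace • b + b.det • η := by
  obtain ⟨p, q, r, rfl⟩ := exists_eq_of_trace b 1 hb
  obtain ⟨a, c, d, rfl⟩ := exists_eq_of_trace η 0 hη
  ext i j; fin_cases i <;> fin_cases j <;>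
    simp [Matrix.det_fin_two, Matrix.trace_fin_two] <;> ring

lemma mul_add_mul_of_trace {b η : Mat 𝕜} (hb : b.trace = 1) (hη : η.trace = 0) :
    b * η + η * b = η + (b * η).trace • 1 := by
  obtain ⟨p, q, r, rfl⟩ := exists_eq_of_trace b 1 hb
  obtain ⟨a, c, d, rfl⟩ := exists_eq_of_trace η 0 hη
  ext i j; fin_cases i <;> fin_cases j <;>
    simp [Matrix.trace_fin_two] <;> ring

end MatrixAlgebra

/-! ### The polar decomposition -/

section Polar

variable {𝕜 : Type*} [RCLike 𝕜]

lemma emb_injective : Function.Injective (emb 𝕜) := fun _ _ h =>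
  Prod.ext (Subtype.ext (congrArg Prod.fst h)) (Subtype.ext (congrArg Prod.snd h))

lemma embInterior_injective : Function.Injective (embInterior 𝕜) :=
  emb_injective.comp Subtype.coe_injective

lemma Cpt.isHermitian (p : Cpt 𝕜) : (p.2 : Mat 𝕜).IsHermitian := p.2.2.1.1

lemma Cpt.trace_eq (p : Cpt 𝕜) : (p.2 : Mat 𝕜).trace = 1 := p.2.2.2

lemma Cpt.bdet_nonneg (p : Cpt 𝕜) : 0 ≤ bdet (p.2 : Mat 𝕜) :=
  (posSemidef_iff_bdet p.isHermitian p.trace_eq).1 p.2.2.1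

lemma Cpt.isInterior_iff (p : Cpt 𝕜) : p.IsInterior ↔ 0 < bdet (p.2 : Mat 𝕜) :=
  posDef_iff_bdet p.isHermitian p.trace_eq

lemma Cpt.not_isInterior_iff (p : Cpt 𝕜) : ¬ p.IsInterior ↔ bdet (p.2 : Mat 𝕜) = 0 := by
  rw [p.isInterior_iff, not_lt]
  exact ⟨fun h => le_antisymm h p.bdet_nonneg, fun h => h.le⟩

lemma K.conjTranspose_mul_self (k : K 𝕜) : (k : Mat 𝕜)ᴴ * (k : Mat 𝕜) = 1 :=
  Matrix.mem_unitaryGroup_iff'.1 (Matrix.mem_specialUnitaryGroup_iff.1 k.2).1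

lemma K.mul_conjTranspose_self (k : K 𝕜) : (k : Mat 𝕜) * (k : Mat 𝕜)ᴴ = 1 :=
  Matrix.mem_unitaryGroup_iff.1 (Matrix.mem_specialUnitaryGroup_iff.1 k.2).1

lemma K.det_eq_one (k : K 𝕜) : (k : Mat 𝕜).det = 1 := (Matrix.mem_specialUnitaryGroup_iff.1 k.2).2

lemma mem_K_iff {x : Mat 𝕜} :
    x ∈ Matrix.specialUnitaryGroup (Fin 2) 𝕜 ↔ x * xᴴ = 1 ∧ x.det = 1 := by
  rw [Matrix.mem_specialUnitaryGroup_iff, Matrix.mem_unitaryGroup_iff]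
  rfl

/-- The smooth map `(x, y) ↦ (det y)^{-1/2} x y` which induces the identification of the interior
of `G[1]` with `G`. -/
def polarMul (z : Mat 𝕜 × Mat 𝕜) : Mat 𝕜 := (√(bdet z.2))⁻¹ • (z.1 * z.2)

lemma embG_toG (p : Interior 𝕜) : embG 𝕜 (toG p) = polarMul (embInterior 𝕜 p) := by
  show (p.1.1 : Mat 𝕜) * (((√(RCLike.re (p.1.2 : Mat 𝕜).det))⁻¹ : ℝ) • (p.1.2 : Mat 𝕜)) = _
  rw [mul_smul_comm]
  rfl

/-- The function `‖x‖² + 2`. For `x = k a` in `G` it is `(tr a)²`, because `tr a² = (tr a)² - 2` for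
a matrix `a` of determinant one. -/
def polarSq (x : Mat 𝕜) : ℝ := RCLike.re (xᴴ * x).trace + 2

lemma polarSq_eq (x : Mat 𝕜) : polarSq x = ‖x‖ ^ 2 + 2 := by rw [norm_sq_eq_trace, polarSq]

lemma polarSq_pos (x : Mat 𝕜) : 0 < polarSq x := by rw [polarSq_eq]; positivity

lemma ofReal_polarSq (x : Mat 𝕜) : ((polarSq x : ℝ) : 𝕜) = (xᴴ * x).trace + 2 := by
  rw [polarSq_eq, RCLike.ofReal_add, ofReal_norm_sq, RCLike.ofReal_ofNat]

/-- The smooth map which induces the polar decomposition `g = k a ↦ (k, a / tr a)`. By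
Cayley-Hamilton `a + a⁻¹ = tr a`, whence `g + (g*)⁻¹ = (tr a) k` and `g* g + 1 = (tr a) a`; the
adjugate stands for the inverse. -/
def polarDecomp (x : Mat 𝕜) : Mat 𝕜 × Mat 𝕜 :=
  ((√(polarSq x))⁻¹ • (x + x.adjugateᴴ), (polarSq x)⁻¹ • (xᴴ * x + 1))

lemma contDiff_polarDecomp : ContDiff ℝ ∞ (polarDecomp (𝕜 := 𝕜)) := by
  have h : ContDiff ℝ ∞ (polarSq (𝕜 := 𝕜)) := by
    unfold polarSq
    fun_prop
  refine ContDiff.prodMk (ContDiff.smul (ContDiff.inv (ContDiff.sqrt h ?_) ?_) ?_)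
    (ContDiff.smul (ContDiff.inv h ?_) ?_)
  · exact fun x => (polarSq_pos x).ne'
  · exact fun x => (Real.sqrt_pos.2 (polarSq_pos x)).ne'
  · fun_prop
  · exact fun x => (polarSq_pos x).ne'
  · fun_prop

lemma contDiffOn_polarMul : ContDiffOn ℝ ∞ (polarMul (𝕜 := 𝕜)) {z | 0 < bdet z.2} := by
  have h : ContDiff ℝ ∞ (fun z : Mat 𝕜 × Mat 𝕜 => bdet z.2) := by
    unfold bdet
    fun_prop
  refine ContDiffOn.smul (ContDiffOn.inv (h.contDiffOn.sqrt fun z hz => ?_) fun z hz => ?_)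
    (by fun_prop)
  · exact ne_of_gt hz
  · exact (Real.sqrt_pos.2 hz).ne'

lemma adjugate_mul_adjugate_conj (x : Mat 𝕜) :
    x.adjugateᴴ * x.adjugate + x * xᴴ = (xᴴ * x).trace • 1 := by
  have h1 : x.adjugateᴴ * x.adjugate = (x * xᴴ).adjugate := by
    rw [Matrix.adjugate_mul_distrib, Matrix.adjugate_conjTranspose]
  rw [h1, adjugate_eq, Matrix.trace_mul_comm, sub_add_cancel]

lemma det_one_add_of_det {h : Mat 𝕜} (hd : h.det = 1) : (h + 1).det = h.trace + 2 := by
  rw [Matrix.det_fin_two] at hd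
  simp only [Matrix.det_fin_two, Matrix.add_apply, Matrix.one_apply_eq, Matrix.trace_fin_two,
    Matrix.one_apply_ne (zero_ne_one (α := Fin 2)), Matrix.one_apply_ne (one_ne_zero (α := Fin 2))]
  linear_combination hd

lemma det_add_adjugate_conj {x : Mat 𝕜} (hd : x.det = 1) :
    (x + x.adjugateᴴ).det = (xᴴ * x).trace + 2 := by
  have h1 : x + x.adjugateᴴ = x * (1 + (xᴴ * x).adjugate) := by
    rw [mul_add, mul_one, Matrix.adjugate_mul_distrib, ← mul_assoc, Matrix.mul_adjugate, hd,
      one_smul, one_mul, Matrix.adjugate_conjTranspose]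
  have h2 : (xᴴ * x).det = 1 := by
    rw [Matrix.det_mul, Matrix.det_conjTranspose, hd, star_one, one_mul]
  have h3 : ((xᴴ * x).adjugate).trace = (xᴴ * x).trace := by
    rw [adjugate_eq, Matrix.trace_sub, Matrix.trace_smul, Matrix.trace_one]
    simp only [Fintype.card_fin, smul_eq_mul, Nat.cast_ofNat]
    ring
  rw [h1, Matrix.det_mul, hd, one_mul, add_comm, det_one_add_of_det, h3]
  rw [Matrix.det_adjugate, h2]
  simp

lemma polarDecomp_fst_mem (g : G 𝕜) :
    (polarDecomp (g : Mat 𝕜)).1 ∈ Matrix.specialUnitaryGroup (Fin 2) 𝕜 := by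
  set x : Mat 𝕜 := (g : Mat 𝕜) with hx
  have hd : x.det = 1 := g.2
  have hpos := polarSq_pos x
  have hs : (√(polarSq x))⁻¹ * (√(polarSq x))⁻¹ * polarSq x = 1 := by
    rw [← mul_inv, Real.mul_self_sqrt hpos.le, inv_mul_cancel₀ hpos.ne']
  have hxa : x * x.adjugate = 1 := by rw [Matrix.mul_adjugate, hd, one_smul]
  rw [mem_K_iff]
  constructor
  · have h1 : (x + x.adjugateᴴ) * (x + x.adjugateᴴ)ᴴ = polarSq x • 1 := by
      have h2 : x.adjugateᴴ * xᴴ = 1 := by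
        rw [← Matrix.conjTranspose_mul, hxa, Matrix.conjTranspose_one]
      rw [Matrix.conjTranspose_add, Matrix.conjTranspose_conjTranspose, mul_add, add_mul, add_mul,
        h2, hxa, real_smul_eq, ofReal_polarSq, add_smul, ← adjugate_mul_adjugate_conj, two_smul]
      abel
    show ((√(polarSq x))⁻¹ • (x + x.adjugateᴴ)) * ((√(polarSq x))⁻¹ • (x + x.adjugateᴴ))ᴴ = 1
    rw [Matrix.conjTranspose_smul, star_trivial, smul_mul_smul_comm, h1, smul_smul, hs, one_smul]
  · show ((√(polarSq x))⁻¹ • (x + x.adjugateᴴ)).det = 1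
    rw [Matrix.det_smul_of_tower, Fintype.card_fin, det_add_adjugate_conj hd, ← ofReal_polarSq,
      RCLike.real_smul_eq_coe_mul, ← RCLike.ofReal_mul, pow_two, hs, RCLike.ofReal_one]

lemma det_conj_mul (g : G 𝕜) : ((g : Mat 𝕜)ᴴ * (g : Mat 𝕜)).det = 1 := by
  rw [Matrix.det_mul, Matrix.det_conjTranspose, g.2, star_one, one_mul]

lemma isHermitian_polarDecomp (x : Mat 𝕜) : (polarDecomp x).2.IsHermitian := by
  show ((polarSq x)⁻¹ • (xᴴ * x + 1))ᴴ = (polarSq x)⁻¹ • (xᴴ * x + 1)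
  simp [Matrix.conjTranspose_smul]

lemma trace_polarDecomp (x : Mat 𝕜) : (polarDecomp x).2.trace = 1 := by
  show ((polarSq x)⁻¹ • (xᴴ * x + 1)).trace = 1
  rw [Matrix.trace_smul, Matrix.trace_add, Matrix.trace_one, Fintype.card_fin]
  have h := ofReal_polarSq x
  rw [show ((2 : ℕ) : 𝕜) = 2 by norm_num, ← h, RCLike.real_smul_eq_coe_mul, ← RCLike.ofReal_mul,
    inv_mul_cancel₀ (polarSq_pos x).ne', RCLike.ofReal_one]

lemma bdet_polarDecomp (g : G 𝕜) : bdet (polarDecomp (g : Mat 𝕜)).2 = (polarSq (g : Mat 𝕜))⁻¹ := by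
  have h : (polarDecomp (g : Mat 𝕜)).2.det = (((polarSq (g : Mat 𝕜))⁻¹ : ℝ) : 𝕜) := by
    show ((polarSq (g : Mat 𝕜))⁻¹ • ((g : Mat 𝕜)ᴴ * (g : Mat 𝕜) + 1)).det = _
    rw [Matrix.det_smul_of_tower, det_one_add_of_det (det_conj_mul g), ← ofReal_polarSq,
      RCLike.real_smul_eq_coe_mul, ← RCLike.ofReal_mul, Fintype.card_fin, pow_two, mul_assoc,
      inv_mul_cancel₀ (polarSq_pos _).ne', mul_one]
  rw [bdet, h, RCLike.ofReal_re]

/-- The polar decomposition of a group element, as a point of the interior of `G[1]`. -/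
def fromG (g : G 𝕜) : Interior 𝕜 :=
  have h : (polarDecomp (g : Mat 𝕜)).2.PosDef := by
    rw [posDef_iff_bdet (isHermitian_polarDecomp _) (trace_polarDecomp _), bdet_polarDecomp]
    exact inv_pos.2 (polarSq_pos _)
  ⟨(⟨_, polarDecomp_fst_mem g⟩, ⟨_, h.posSemidef, trace_polarDecomp _⟩), h⟩

lemma embInterior_fromG (g : G 𝕜) : embInterior 𝕜 (fromG g) = polarDecomp (embG 𝕜 g) := rfl

lemma toG_fromG (g : G 𝕜) : toG (fromG g) = g := by
  apply embG_injective
  rw [embG_toG, embInterior_fromG]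
  set x : Mat 𝕜 := embG 𝕜 g with hx
  have hd : x.det = 1 := g.2
  have hpos := polarSq_pos x
  have hax : x.adjugate * x = 1 := by rw [Matrix.adjugate_mul, hd, one_smul]
  have hax' : x.adjugateᴴ * xᴴ = 1 := by
    rw [← Matrix.conjTranspose_mul, Matrix.mul_adjugate, hd, one_smul, Matrix.conjTranspose_one]
  have h1 : (x + x.adjugateᴴ) * (xᴴ * x + 1) = polarSq x • x := by
    have h2 : x * (xᴴ * x) + x.adjugateᴴ = (xᴴ * x).trace • x := by
      have h3 := congrArg (· * x) (adjugate_mul_adjugate_conj x)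
      simp only [add_mul, smul_mul_assoc, one_mul] at h3
      rw [mul_assoc, hax, mul_one, mul_assoc, add_comm] at h3
      exact h3
    rw [real_smul_eq, ofReal_polarSq, add_smul, ← h2, mul_add, add_mul, mul_one, ← mul_assoc
      (x.adjugateᴴ), hax', one_mul, two_smul]
    abel
  have h4 : √(bdet (polarDecomp x).2) = (√(polarSq x))⁻¹ := by
    rw [hx]
    exact (congrArg Real.sqrt (bdet_polarDecomp g)).trans (Real.sqrt_inv _)
  have h5 : (polarDecomp x).1 * (polarDecomp x).2 = ((√(polarSq x))⁻¹ * (polarSq x)⁻¹) •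
      ((x + x.adjugateᴴ) * (xᴴ * x + 1)) := smul_mul_smul_comm _ _ _ _
  rw [polarMul, h4, h5, h1, smul_smul, smul_smul, inv_inv, ← mul_assoc,
    mul_inv_cancel₀ (Real.sqrt_pos.2 hpos).ne', one_mul, inv_mul_cancel₀ hpos.ne', one_smul]

/-- The weight `det b` of a point in the interior in terms of the group element. -/
lemma polarSq_toG (p : Interior 𝕜) : polarSq (embG 𝕜 (toG p)) = (bdet (p.1.2 : Mat 𝕜))⁻¹ := by
  have hpos := (p.1.isInterior_iff).1 p.2
  have hb := norm_sq_of_herm p.1.isHermitian p.1.trace_eq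
  rw [polarSq, embG_toG]
  have h1 : (polarMul (embInterior 𝕜 p))ᴴ * polarMul (embInterior 𝕜 p) =
      ((√(bdet (p.1.2 : Mat 𝕜)))⁻¹ * (√(bdet (p.1.2 : Mat 𝕜)))⁻¹) •
        ((p.1.2 : Mat 𝕜)ᴴ * (p.1.2 : Mat 𝕜)) := by
    show ((√(bdet (p.1.2 : Mat 𝕜)))⁻¹ • ((p.1.1 : Mat 𝕜) * (p.1.2 : Mat 𝕜)))ᴴ *
      ((√(bdet (p.1.2 : Mat 𝕜)))⁻¹ • ((p.1.1 : Mat 𝕜) * (p.1.2 : Mat 𝕜))) = _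
    rw [Matrix.conjTranspose_smul, star_trivial, smul_mul_smul_comm, Matrix.conjTranspose_mul,
      mul_assoc, ← mul_assoc (p.1.1 : Mat 𝕜)ᴴ, K.conjTranspose_mul_self, one_mul]
  rw [h1, Matrix.trace_smul, RCLike.smul_re, ← norm_sq_eq_trace, hb, ← mul_inv,
    Real.mul_self_sqrt hpos.le]
  field_simp
  ring

lemma fromG_toG (p : Interior 𝕜) : fromG (toG p) = p := by
  apply embInterior_injective
  have hpos := (p.1.isInterior_iff).1 p.2
  rw [embInterior_fromG, polarDecomp, polarSq_toG, embG_toG]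
  set k : Mat 𝕜 := (p.1.1 : Mat 𝕜) with hk
  set b : Mat 𝕜 := (p.1.2 : Mat 𝕜) with hb
  have hbh : bᴴ = b := p.1.isHermitian
  have hkk : kᴴ * k = 1 := K.conjTranspose_mul_self _
  have htr : b.trace = 1 := p.1.trace_eq
  have h0 : polarMul (embInterior 𝕜 p) = (√(bdet b))⁻¹ • (k * b) := rfl
  have hs : √(bdet b) ≠ 0 := (Real.sqrt_pos.2 hpos).ne'
  have hadj : (k * b).adjugateᴴ = k * (1 - b) := by
    rw [Matrix.adjugate_mul_distrib, Matrix.conjTranspose_mul, adjugate_of_trace htr,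
      adjugate_of_det hkk (K.det_eq_one _), Matrix.conjTranspose_conjTranspose,
      Matrix.conjTranspose_sub, hbh, Matrix.conjTranspose_one]
  have hadj2 : ((√(bdet b))⁻¹ • (k * b)).adjugate = (√(bdet b))⁻¹ • (k * b).adjugate := by
    rw [adjugate_eq, adjugate_eq, Matrix.trace_smul, smul_sub, smul_assoc]
  refine Prod.ext ?_ ?_
  · show (√((bdet b)⁻¹))⁻¹ • (polarMul (embInterior 𝕜 p) + (polarMul (embInterior 𝕜 p)).adjugateᴴ)
      = k
    rw [h0, hadj2, Matrix.conjTranspose_smul, star_trivial, ← smul_add, hadj, ← mul_add,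
      add_sub_cancel, mul_one, smul_smul, Real.sqrt_inv, inv_inv, mul_inv_cancel₀ hs, one_smul]
  · show ((bdet b)⁻¹)⁻¹ • ((polarMul (embInterior 𝕜 p))ᴴ * (polarMul (embInterior 𝕜 p)) + 1) = b
    rw [h0, Matrix.conjTranspose_smul, star_trivial, smul_mul_smul_comm, Matrix.conjTranspose_mul,
      mul_assoc, ← mul_assoc kᴴ, hkk, one_mul, hbh, mul_self_of_trace htr, ← mul_inv,
      Real.mul_self_sqrt hpos.le, inv_inv, smul_add, smul_smul, mul_inv_cancel₀ hpos.ne', one_smul,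
      ← ofReal_bdet p.1.isHermitian, ← real_smul_eq, sub_add_cancel]

end Polar

/-! ### Tangent vectors of the compactification -/

section Tangent

variable {𝕜 : Type*} [RCLike 𝕜]

lemma mul_self_of_skew {X : Mat 𝕜} (h2 : X.trace = 0) : X * X = -(X.det • 1) := by
  obtain ⟨a, b, c, rfl⟩ := exists_eq_of_trace X 0 h2
  ext i j; fin_cases i <;> fin_cases j <;> simp [Matrix.det_fin_two] <;> ring

lemma ofReal_bdet_of_skew {X : Mat 𝕜} (h1 : Xᴴ = -X) :
    ((bdet X : ℝ) : 𝕜) = X.det := by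
  refine RCLike.conj_eq_iff_re.1 ?_
  have h := Matrix.det_conjTranspose X
  rw [h1, Matrix.det_neg, Fintype.card_fin] at h
  simpa using h.symm

lemma bdet_nonneg_of_skew {X : Mat 𝕜} (h1 : Xᴴ = -X) (h2 : X.trace = 0) : 0 ≤ bdet X := by
  have h3 := norm_sq_eq_trace X
  rw [h1, neg_mul, mul_self_of_skew h2, neg_neg, Matrix.trace_smul, Matrix.trace_one,
    ← ofReal_bdet_of_skew h1, Fintype.card_fin] at h3
  have h4 : ‖X‖ ^ 2 = bdet X * 2 := by
    rw [h3]
    simp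
  nlinarith [sq_nonneg ‖X‖]

/-- The one-parameter family `k (1 + t X) / √(1 + t² det X)` in `K`, for `X` in the Lie algebra. -/
def kCurve (k : K 𝕜) {X : Mat 𝕜} (h1 : Xᴴ = -X) (h2 : X.trace = 0) (t : ℝ) : K 𝕜 :=
  ⟨(√(1 + t ^ 2 * bdet X))⁻¹ • ((k : Mat 𝕜) * (1 + t • X)), by
    have hp : 0 < 1 + t ^ 2 * bdet X := by
      have := bdet_nonneg_of_skew h1 h2
      positivity
    have hs : (√(1 + t ^ 2 * bdet X))⁻¹ * (√(1 + t ^ 2 * bdet X))⁻¹ * (1 + t ^ 2 * bdet X) = 1 := by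
      rw [← mul_inv, Real.mul_self_sqrt hp.le, inv_mul_cancel₀ hp.ne']
    have h3 : (1 + t • X) * (1 + t • X)ᴴ = (1 + t ^ 2 * bdet X) • (1 : Mat 𝕜) := by
      rw [Matrix.conjTranspose_add, Matrix.conjTranspose_one, Matrix.conjTranspose_smul,
        star_trivial, h1, smul_neg, mul_add, mul_one, mul_neg, add_mul, one_mul,
        smul_mul_smul_comm, mul_self_of_skew h2, ← ofReal_bdet_of_skew h1, ← real_smul_eq,
        add_smul, one_smul, mul_smul, pow_two, mul_smul]
      simp only [smul_neg, mul_smul]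
      abel
    have h4 : (1 + t • X).det = ((1 + t ^ 2 * bdet X : ℝ) : 𝕜) := by
      rw [RCLike.ofReal_add, RCLike.ofReal_mul, ofReal_bdet_of_skew h1, RCLike.ofReal_pow,
        RCLike.ofReal_one]
      obtain ⟨a, b, c, rfl⟩ := exists_eq_of_trace X 0 h2
      simp [Matrix.det_fin_two, RCLike.real_smul_eq_coe_mul]
      ring
    rw [mem_K_iff]
    constructor
    · rw [Matrix.conjTranspose_smul, star_trivial, smul_mul_smul_comm, Matrix.conjTranspose_mul,
        mul_assoc, ← mul_assoc (1 + t • X), h3, smul_mul_assoc, one_mul, mul_smul_comm,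
        K.mul_conjTranspose_self, smul_smul, hs, one_smul]
    · rw [Matrix.det_smul_of_tower, Fintype.card_fin, Matrix.det_mul, K.det_eq_one, one_mul, h4,
        RCLike.real_smul_eq_coe_mul, ← RCLike.ofReal_mul, pow_two, hs, RCLike.ofReal_one]⟩

lemma kCurve_zero (k : K 𝕜) {X : Mat 𝕜} (h1 : Xᴴ = -X) (h2 : X.trace = 0) :
    kCurve k h1 h2 0 = k := by
  apply Subtype.ext
  simp [kCurve]

lemma hasDerivAt_kCurve (k : K 𝕜) {X : Mat 𝕜} (h1 : Xᴴ = -X) (h2 : X.trace = 0) :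
    HasDerivAt (fun t => (kCurve k h1 h2 t : Mat 𝕜)) ((k : Mat 𝕜) * X) 0 := by
  have h3 : HasDerivAt (fun t : ℝ => (√(1 + t ^ 2 * bdet X))⁻¹) 0 0 := by
    have h4 : HasDerivAt (fun t : ℝ => 1 + t ^ 2 * bdet X) 0 0 := by
      have := (((hasDerivAt_id (0 : ℝ)).pow 2).mul_const (bdet X)).const_add 1
      simpa using this
    have h5 := (h4.sqrt (by simp)).fun_inv (by simp)
    simpa using h5
  have h6 : HasDerivAt (fun t : ℝ => (k : Mat 𝕜) * (1 + t • X)) ((k : Mat 𝕜) * X) 0 := by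
    have := (((hasDerivAt_id (0 : ℝ)).smul_const X).const_add 1).const_mul (k : Mat 𝕜)
    simpa using this
  exact (h3.smul h6).congr_deriv (by simp)

/-- The span of the tangent cone of a set containing all `(k', b)` and all segments from `(k, b)` to
`(k, c)`, `c` positive definite, contains the tangent space of `G[1]` at `(k, b)`. -/
lemma tangentSpace_subset_span {s : Set (Mat 𝕜 × Mat 𝕜)} {p : Cpt 𝕜}
    (hK : ∀ k' : K 𝕜, emb 𝕜 (k', p.2) ∈ s)
    (hB : ∀ c : Mat 𝕜, c.PosDef → c.trace = 1 → segment ℝ (emb 𝕜 p) ((p.1 : Mat 𝕜), c) ⊆ s)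
    {v : Mat 𝕜 × Mat 𝕜} (hv : v ∈ tangentSpace p) :
    v ∈ Submodule.span ℝ (tangentConeAt ℝ s (emb 𝕜 p)) := by
  obtain ⟨⟨X, h1, h2, h3⟩, h4, h5⟩ := hv
  have hfst : ((p.1 : Mat 𝕜) * X, (0 : Mat 𝕜)) ∈ tangentConeAt ℝ s (emb 𝕜 p) := by
    have h6 := ((hasDerivAt_kCurve p.1 h1 h2).prodMk
      (hasDerivAt_const (0 : ℝ) (p.2 : Mat 𝕜))).hasFDerivAt.hasFDerivWithinAt (s := Set.univ)
    have h7 := h6.mapsTo_tangent_cone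
      (show (1 : ℝ) ∈ tangentConeAt ℝ Set.univ 0 by rw [tangentConeAt_univ]; trivial)
    simp only [kCurve_zero, ContinuousLinearMap.toSpanSingleton_apply, one_smul] at h7
    refine tangentConeAt_mono ?_ h7
    rintro _ ⟨t, -, rfl⟩
    exact hK _
  -- The tangent cone contains the directions from `b` to the positive definite matrices `1 / 2` and
  -- `1 / 2 + (ε / 2) H`, and `H` is a multiple of their difference.
  have hseg : ∀ c : Mat 𝕜, c.PosDef → c.trace = 1 →
      ((0 : Mat 𝕜), c - (p.2 : Mat 𝕜)) ∈ tangentConeAt ℝ s (emb 𝕜 p) := by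
    intro c hc hc1
    have h6 := mem_tangentConeAt_of_segment_subset (hB c hc hc1)
    rwa [emb, Prod.mk_sub_mk, sub_self] at h6
  have htr : ∀ r : ℝ, ((1 / 2 : ℝ) • (1 : Mat 𝕜) + r • v.2).trace = 1 := by
    intro r
    rw [Matrix.trace_add, Matrix.trace_smul, Matrix.trace_smul, h5, Matrix.trace_one, smul_zero,
      RCLike.real_smul_eq_coe_mul, add_zero, Fintype.card_fin, ← RCLike.ofReal_natCast,
      ← RCLike.ofReal_mul]
    norm_num
  have hherm : ∀ r : ℝ, ((1 / 2 : ℝ) • (1 : Mat 𝕜) + r • v.2).IsHermitian := by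
    intro r
    show ((1 / 2 : ℝ) • (1 : Mat 𝕜) + r • v.2)ᴴ = _
    rw [Matrix.conjTranspose_add, Matrix.conjTranspose_smul, Matrix.conjTranspose_smul, h4.eq,
      Matrix.conjTranspose_one, star_trivial, star_trivial]
  have hc : ContinuousAt (fun r : ℝ => bdet ((1 / 2 : ℝ) • (1 : Mat 𝕜) + r • v.2)) 0 := by
    have : ContDiff ℝ 0 (fun r : ℝ => bdet ((1 / 2 : ℝ) • (1 : Mat 𝕜) + r • v.2)) := by
      unfold bdet
      fun_prop
    exact this.continuous.continuousAt
  have h0 : 0 < bdet ((1 / 2 : ℝ) • (1 : Mat 𝕜) + (0 : ℝ) • v.2) := by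
    have : ((1 / 2 : ℝ) • (1 : Mat 𝕜) + (0 : ℝ) • v.2).det = ((1 / 4 : ℝ) : 𝕜) := by
      rw [zero_smul, add_zero, Matrix.det_smul_of_tower, Matrix.det_one,
        RCLike.real_smul_eq_coe_mul, Fintype.card_fin]
      norm_num
    rw [bdet, this, RCLike.ofReal_re]
    norm_num
  obtain ⟨ε, hε, hε'⟩ := Metric.eventually_nhds_iff.1 (hc.eventually (lt_mem_nhds h0))
  have h6 := hseg _ ((posDef_iff_bdet (hherm 0) (htr 0)).2 h0) (htr 0)
  have h7 := hseg _ ((posDef_iff_bdet (hherm (ε / 2)) (htr (ε / 2))).2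
    (hε' (by rw [Real.dist_eq, sub_zero, abs_of_pos (by positivity)]; linarith))) (htr (ε / 2))
  have h8 : v = ((p.1 : Mat 𝕜) * X, (0 : Mat 𝕜)) + (ε / 2)⁻¹ •
      (((0 : Mat 𝕜), ((1 / 2 : ℝ) • (1 : Mat 𝕜) + (ε / 2) • v.2) - (p.2 : Mat 𝕜)) -
        ((0 : Mat 𝕜), ((1 / 2 : ℝ) • (1 : Mat 𝕜) + (0 : ℝ) • v.2) - (p.2 : Mat 𝕜))) := by
    refine Prod.ext ?_ ?_
    · simp [h3]
    · simp only [Prod.snd_add, Prod.smul_snd, Prod.snd_sub, sub_sub_sub_cancel_right, zero_smul,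
        add_zero, add_sub_cancel_left, zero_add]
      rw [smul_smul, inv_mul_cancel₀ (by positivity), one_smul]
  rw [h8]
  exact Submodule.add_mem _ (Submodule.subset_span hfst) (Submodule.smul_mem _ _
    (Submodule.sub_mem _ (Submodule.subset_span h7) (Submodule.subset_span h6)))

lemma segment_emb (p : Cpt 𝕜) {c : Mat 𝕜} (hc : c.PosDef) (hc1 : c.trace = 1)
    {z : Mat 𝕜 × Mat 𝕜} (hz : z ∈ segment ℝ (emb 𝕜 p) ((p.1 : Mat 𝕜), c)) :
    ∃ q : Cpt 𝕜, emb 𝕜 q = z ∧ (p.IsInterior → q.IsInterior) := by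
  obtain ⟨a, b, ha, hb, hab, rfl⟩ := hz
  have hsemi : (a • (p.2 : Mat 𝕜) + b • c).PosSemidef :=
    (p.2.2.1.smul ha).add (hc.posSemidef.smul hb)
  refine ⟨(p.1, ⟨a • (p.2 : Mat 𝕜) + b • c, hsemi, ?_⟩), ?_, ?_⟩
  · rw [Matrix.trace_add, Matrix.trace_smul, Matrix.trace_smul, p.trace_eq, hc1, ← add_smul, hab,
      one_smul]
  · refine Prod.ext ?_ rfl
    show (p.1 : Mat 𝕜) = a • (p.1 : Mat 𝕜) + b • (p.1 : Mat 𝕜)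
    rw [← add_smul, hab, one_smul]
  · intro hp
    show (a • (p.2 : Mat 𝕜) + b • c).PosDef
    rcases ha.eq_or_lt with h | h
    · have hb1 : b = 1 := by linarith
      rw [← h, zero_smul, zero_add, hb1, one_smul]
      exact hc
    · exact (Matrix.PosDef.smul hp h).add_posSemidef (hc.posSemidef.smul hb)

/-- Derivatives along tangent vectors of `G[1]` do not depend on the choice of a derivative within the
image of `G[1]`, also at boundary points. -/
lemma mem_tanSpan_emb {p : Cpt 𝕜} {v : Mat 𝕜 × Mat 𝕜} (hv : v ∈ tangentSpace p) :
    v ∈ tanSpan (emb 𝕜) p := by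
  refine tangentSpace_subset_span (s := Set.range (emb 𝕜)) (fun k' => ⟨_, rfl⟩) (fun c hc hc1 z hz => ?_) hv
  obtain ⟨q, hq, -⟩ := segment_emb p hc hc1 hz
  exact ⟨q, hq⟩

lemma mem_tanSpan_embInterior {p : Interior 𝕜} {v : Mat 𝕜 × Mat 𝕜} (hv : v ∈ tangentSpace p.1) :
    v ∈ tanSpan (embInterior 𝕜) p := by
  refine tangentSpace_subset_span (p := p.1) (s := Set.range (embInterior 𝕜))
    (fun k' => ⟨⟨(k', p.1.2), p.2⟩, rfl⟩) (fun c hc hc1 z hz => ?_) hv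
  obtain ⟨q, hq, h⟩ := segment_emb p.1 hc hc1 hz
  exact ⟨⟨q, h p.2⟩, hq⟩

lemma isSmooth_restrict {F : Type*} [NormedAddCommGroup F] [NormedSpace ℝ F] {f : Cpt 𝕜 → F}
    (hf : IsSmooth (emb 𝕜) f) : IsSmooth (embInterior 𝕜) (fun p => f p.1) :=
  IsSmooth.pullback (Φ := id) (φ := Subtype.val) embInterior_injective emb_injective contDiffOn_id
    (fun _ => rfl) hf

lemma dirDeriv_restrict {f : Cpt 𝕜 → ℂ} (hf : IsSmooth (emb 𝕜) f) (p : Interior 𝕜)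
    {v : Mat 𝕜 × Mat 𝕜} (hv : v ∈ tangentSpace p.1) :
    dirDeriv (embInterior 𝕜) (fun p => f p.1) p v = dirDeriv (emb 𝕜) f p.1 v :=
  dirDeriv_pullback (Φ := id) (φ := Subtype.val) embInterior_injective emb_injective
    (hasFDerivWithinAt_id _ _) (fun _ => rfl) hf (mem_tanSpan_embInterior hv)

end Tangent

/-! ### The differential of the polar decomposition -/

section PolarDifferential

variable {𝕜 : Type*} [RCLike 𝕜]

/-- The differential of `bdet`. -/
def bdetDeriv (y : Mat 𝕜) : Mat 𝕜 →L[ℝ] ℝ :=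
  (RCLike.reCLM (K := 𝕜)).comp (traceL.comp (ContinuousLinearMap.mul ℝ (Mat 𝕜) y.adjugate))

lemma bdetDeriv_apply (y w : Mat 𝕜) : bdetDeriv y w = RCLike.re (y.adjugate * w).trace := rfl

lemma hasFDerivAt_bdet (y : Mat 𝕜) : HasFDerivAt (bdet (𝕜 := 𝕜)) (bdetDeriv y) y :=
  (RCLike.reCLM (K := 𝕜)).hasFDerivAt.comp y (hasFDerivAt_det y)

/-- The differential of `polarMul`. -/
def polarMulDeriv (z : Mat 𝕜 × Mat 𝕜) : Mat 𝕜 × Mat 𝕜 →L[ℝ] Mat 𝕜 :=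
  (√(bdet z.2))⁻¹ • ((ContinuousLinearMap.mul ℝ (Mat 𝕜)).flip z.2 ∘L ContinuousLinearMap.fst ℝ _ _ +
    ContinuousLinearMap.mul ℝ (Mat 𝕜) z.1 ∘L ContinuousLinearMap.snd ℝ _ _) -
  (((√(bdet z.2))⁻¹ * (2 * bdet z.2)⁻¹) • (bdetDeriv z.2 ∘L ContinuousLinearMap.snd ℝ _ _)).smulRight
    (z.1 * z.2)

lemma polarMulDeriv_apply (z w : Mat 𝕜 × Mat 𝕜) :
    polarMulDeriv z w = (√(bdet z.2))⁻¹ • (w.1 * z.2 + z.1 * w.2) -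
      ((√(bdet z.2))⁻¹ * (2 * bdet z.2)⁻¹ * bdetDeriv z.2 w.2) • (z.1 * z.2) := rfl

lemma hasFDerivAt_polarMul {z : Mat 𝕜 × Mat 𝕜} (hz : 0 < bdet z.2) :
    HasFDerivAt (polarMul (𝕜 := 𝕜)) (polarMulDeriv z) z := by
  have h1 : HasFDerivAt (fun z : Mat 𝕜 × Mat 𝕜 => bdet z.2)
      (bdetDeriv z.2 ∘L ContinuousLinearMap.snd ℝ _ _) z :=
    (hasFDerivAt_bdet z.2).comp z hasFDerivAt_snd
  have hs := (Real.sqrt_pos.2 hz).ne'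
  have h2 := (((Real.hasDerivAt_sqrt hz.ne').fun_inv hs).comp_hasFDerivAt z h1)
  have hm : HasFDerivAt (fun z : Mat 𝕜 × Mat 𝕜 => z.1 * z.2) _ z :=
    ((ContinuousLinearMap.fst ℝ (Mat 𝕜) (Mat 𝕜)).hasFDerivAt (x := z)).mul'
      ((ContinuousLinearMap.snd ℝ (Mat 𝕜) (Mat 𝕜)).hasFDerivAt (x := z))
  have h3 := h2.smul hm
  refine h3.congr_fderiv (ContinuousLinearMap.ext fun w => ?_)
  rw [polarMulDeriv_apply]
  have h4 : -(1 / (2 * √(bdet z.2))) / √(bdet z.2) ^ 2 =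
      -((√(bdet z.2))⁻¹ * (2 * bdet z.2)⁻¹) := by
    rw [Real.sq_sqrt hz.le]
    field_simp
  rw [h4]
  simp only [Function.comp_apply, add_apply, smul_apply, ContinuousLinearMap.smulRight_apply,
    ContinuousLinearMap.comp_apply, ContinuousLinearMap.coe_fst', ContinuousLinearMap.coe_snd',
    smul_eq_mul, MulOpposite.smul_eq_mul_unop, MulOpposite.unop_op]
  rw [add_comm (z.1 * w.2), sub_eq_add_neg, ← neg_smul, neg_mul]

lemma isSmooth_comp_toG {F : Type*} [NormedAddCommGroup F] [NormedSpace ℝ F] {u : G 𝕜 → F}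
    (hu : IsSmooth (embG 𝕜) u) : IsSmooth (embInterior 𝕜) (fun p => u (toG p)) := by
  refine IsSmooth.pullback (ι := embInterior 𝕜) (ι' := embG 𝕜) (φ := toG) (Φ := polarMul)
    embInterior_injective embG_injective
    (contDiffOn_polarMul.mono ?_) embG_toG hu
  rintro _ ⟨p, rfl⟩
  exact p.1.isInterior_iff.1 p.2

lemma isSmooth_comp_fromG {F : Type*} [NormedAddCommGroup F] [NormedSpace ℝ F] {f : Interior 𝕜 → F}
    (hf : IsSmooth (embInterior 𝕜) f) : IsSmooth (embG 𝕜) (fun g => f (fromG g)) :=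
  IsSmooth.pullback (ι := embG 𝕜) (ι' := embInterior 𝕜) (φ := fromG) (Φ := polarDecomp)
    embG_injective embInterior_injective
    contDiff_polarDecomp.contDiffOn embInterior_fromG hf

/-- The chain rule for the identification of the interior with `G`. -/
lemma dirDeriv_comp_toG {u : G 𝕜 → ℂ} (hu : IsSmooth (embG 𝕜) u) (p : Interior 𝕜)
    {v : Mat 𝕜 × Mat 𝕜} (hv : v ∈ tangentSpace p.1) :
    dirDeriv (embInterior 𝕜) (fun p => u (toG p)) p v =
      dirDeriv (embG 𝕜) u (toG p) (polarMulDeriv (embInterior 𝕜 p) v) :=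
  dirDeriv_pullback (ι := embInterior 𝕜) (ι' := embG 𝕜) (φ := toG) (Φ := polarMul) embInterior_injective embG_injective
    (hasFDerivAt_polarMul (p.1.isInterior_iff.1 p.2)).hasFDerivWithinAt embG_toG hu
    (mem_tanSpan_embInterior hv)

end PolarDifferential

/-! ### Invariant vector fields on the compactification -/

section InvariantFields

variable {𝕜 : Type*} [RCLike 𝕜]

/-- The Hermitian part of a matrix. -/
def hermPart (ξ : Mat 𝕜) : Mat 𝕜 := (1 / 2 : ℝ) • (ξ + ξᴴ)

/-- The skew-Hermitian part of a matrix. -/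
def skewPart (ξ : Mat 𝕜) : Mat 𝕜 := (1 / 2 : ℝ) • (ξ - ξᴴ)

lemma conjTranspose_hermPart (ξ : Mat 𝕜) : (hermPart ξ)ᴴ = hermPart ξ := by
  simp [hermPart, Matrix.conjTranspose_smul, add_comm]

lemma conjTranspose_skewPart (ξ : Mat 𝕜) : (skewPart ξ)ᴴ = -skewPart ξ := by
  simp [skewPart, Matrix.conjTranspose_smul, ← smul_neg]

lemma herm_add_skew (ξ : Mat 𝕜) : hermPart ξ + skewPart ξ = ξ := by
  rw [hermPart, skewPart, ← smul_add, add_add_sub_cancel, ← two_smul ℝ ξ, smul_smul]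
  norm_num

lemma herm_sub_skew (ξ : Mat 𝕜) : hermPart ξ - skewPart ξ = ξᴴ := by
  rw [hermPart, skewPart, ← smul_sub, add_sub_sub_cancel, ← two_smul ℝ ξᴴ, smul_smul]
  norm_num

lemma trace_hermPart {ξ : Mat 𝕜} (h : ξ.trace = 0) : (hermPart ξ).trace = 0 := by
  simp [hermPart, Matrix.trace_add, Matrix.trace_conjTranspose, h]

lemma trace_skewPart {ξ : Mat 𝕜} (h : ξ.trace = 0) : (skewPart ξ).trace = 0 := by
  simp [skewPart, Matrix.trace_sub, Matrix.trace_conjTranspose, h]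

/-- The extension of the left-invariant vector field of `ξ` to `G[1]`. The second component is the
derivative of `b = (g* g + 1) / (tr (g* g) + 2)` in the direction `g ξ`. -/
def invL (ξ : Mat 𝕜) (z : Mat 𝕜 × Mat 𝕜) : Mat 𝕜 × Mat 𝕜 :=
  (z.1 * (z.2 * hermPart ξ - hermPart ξ * z.2 + skewPart ξ),
    ξᴴ * (z.2 * z.2) + z.2 * z.2 * ξ - (ξᴴ * (z.2 * z.2) + z.2 * z.2 * ξ).trace • z.2)

/-- The extension of the right-invariant vector field of `ζ` to `G[1]`; it is expressed by the
conjugate `k* ζ k`, since `ζ k b = k (k* ζ k) b`. The second component is again the derivative of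
`b = (g* g + 1) / (tr (g* g) + 2)`. -/
def invR (ζ : Mat 𝕜) (z : Mat 𝕜 × Mat 𝕜) : Mat 𝕜 × Mat 𝕜 :=
  (z.1 * (skewPart (z.1ᴴ * ζ * z.1) + (hermPart (z.1ᴴ * ζ * z.1) * z.2 -
      z.2 * hermPart (z.1ᴴ * ζ * z.1))),
    z.2 * (z.1ᴴ * ζ * z.1 + (z.1ᴴ * ζ * z.1)ᴴ) * z.2 -
      (z.2 * (z.1ᴴ * ζ * z.1 + (z.1ᴴ * ζ * z.1)ᴴ) * z.2).trace • z.2)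

lemma contDiff_invL (ξ : Mat 𝕜) : ContDiff ℝ ∞ (invL ξ) := by
  unfold invL
  fun_prop

lemma contDiff_invR (ζ : Mat 𝕜) : ContDiff ℝ ∞ (invR ζ) := by
  unfold invR hermPart skewPart
  fun_prop

lemma trace_sub_trace_smul {b : Mat 𝕜} (hb : b.trace = 1) (x : Mat 𝕜) :
    (x - x.trace • b).trace = 0 := by
  rw [Matrix.trace_sub, Matrix.trace_smul, hb, smul_eq_mul, mul_one, sub_self]

lemma isHermitian_sub_trace_smul {b x : Mat 𝕜} (hb : b.IsHermitian) (hx : x.IsHermitian) :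
    (x - x.trace • b).IsHermitian := by
  have h : star x.trace = x.trace := by rw [← Matrix.trace_conjTranspose, hx.eq]
  rw [Matrix.IsHermitian, Matrix.conjTranspose_sub, Matrix.conjTranspose_smul, h, hb.eq, hx.eq]

lemma invL_mem (ξ : Mat 𝕜) (hξ : ξ.trace = 0) (p : Cpt 𝕜) :
    invL ξ (emb 𝕜 p) ∈ tangentSpace p := by
  have hb : (p.2 : Mat 𝕜)ᴴ = p.2 := p.isHermitian
  refine ⟨⟨_, ?_, ?_, rfl⟩, isHermitian_sub_trace_smul hb ?_, trace_sub_trace_smul p.trace_eq _⟩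
  · rw [Matrix.conjTranspose_add, Matrix.conjTranspose_sub, Matrix.conjTranspose_mul,
      Matrix.conjTranspose_mul, conjTranspose_hermPart, conjTranspose_skewPart]
    simp only [emb, hb]
    abel
  · rw [Matrix.trace_add, Matrix.trace_sub, Matrix.trace_mul_comm, sub_self, zero_add,
      trace_skewPart hξ]
  · simp only [emb]
    simp only [Matrix.IsHermitian, Matrix.conjTranspose_add, Matrix.conjTranspose_mul, hb,
      Matrix.conjTranspose_conjTranspose]
    exact add_comm _ _

lemma trace_conj_K (k : K 𝕜) {ζ : Mat 𝕜} (hζ : ζ.trace = 0) :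
    ((k : Mat 𝕜)ᴴ * ζ * (k : Mat 𝕜)).trace = 0 := by
  rw [mul_assoc, Matrix.trace_mul_comm, mul_assoc, K.mul_conjTranspose_self, mul_one, hζ]

lemma invR_mem (ζ : Mat 𝕜) (hζ : ζ.trace = 0) (p : Cpt 𝕜) :
    invR ζ (emb 𝕜 p) ∈ tangentSpace p := by
  have hb : (p.2 : Mat 𝕜)ᴴ = p.2 := p.isHermitian
  refine ⟨⟨_, ?_, ?_, rfl⟩, isHermitian_sub_trace_smul hb ?_, trace_sub_trace_smul p.trace_eq _⟩
  · rw [Matrix.conjTranspose_add, Matrix.conjTranspose_sub, Matrix.conjTranspose_mul,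
      Matrix.conjTranspose_mul, conjTranspose_hermPart, conjTranspose_skewPart]
    simp only [emb, hb]
    abel
  · rw [Matrix.trace_add, Matrix.trace_sub, Matrix.trace_mul_comm, sub_self, add_zero]
    exact trace_skewPart (trace_conj_K p.1 hζ)
  · simp only [emb]
    rw [Matrix.IsHermitian, Matrix.conjTranspose_mul, Matrix.conjTranspose_mul,
      Matrix.conjTranspose_add, hb, Matrix.conjTranspose_conjTranspose, add_comm]
    exact (mul_assoc _ _ _).symm

/-- The derivative of `det b` along `invL` is divisible by `det b`; here `ξ = η + σ` with `η` Hermitian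
and `σ` skew-Hermitian, so that `ξᴴ = η - σ`. -/
lemma trace_mul_invL {b η σ : Mat 𝕜} (hb : b.trace = 1) (hη : η.trace = 0) (hσ : σ.trace = 0) :
    (b * ((η - σ) * (b * b) + b * b * (η + σ) -
      ((η - σ) * (b * b) + b * b * (η + σ)).trace • b)).trace =
      b.det * ((η - σ) * (b * b) + b * b * (η + σ)).trace := by
  obtain ⟨p, q, r, rfl⟩ := exists_eq_of_trace b 1 hb
  obtain ⟨a, c, d, rfl⟩ := exists_eq_of_trace η 0 hη
  obtain ⟨a', c', d', rfl⟩ := exists_eq_of_trace σ 0 hσ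
  simp [Matrix.det_fin_two, Matrix.trace_fin_two]
  ring

/-- The identity that makes `invL` correspond to the field `g ξ` under `polarMul`; here `ξ = η + σ` with
`η` Hermitian and `σ` skew-Hermitian, so that `ξᴴ = η - σ`. -/
lemma add_invL {b η σ : Mat 𝕜} (hb : b.trace = 1) (hη : η.trace = 0) (hσ : σ.trace = 0) :
    (b * η - η * b + σ) * b + ((η - σ) * (b * b) + b * b * (η + σ) -
      ((η - σ) * (b * b) + b * b * (η + σ)).trace • b) +
      (2⁻¹ * ((η - σ) * (b * b) + b * b * (η + σ)).trace) • b = b * (η + σ) := by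
  obtain ⟨p, q, r, rfl⟩ := exists_eq_of_trace b 1 hb
  obtain ⟨a, c, d, rfl⟩ := exists_eq_of_trace η 0 hη
  obtain ⟨a', c', d', rfl⟩ := exists_eq_of_trace σ 0 hσ
  ext i j; fin_cases i <;> fin_cases j <;>
    simp [Matrix.trace_fin_two] <;> ring

/-- The derivative of `det b` along `invR` is divisible by `det b`; here `η` is the Hermitian part of
`k* ζ k`. -/
lemma trace_mul_invR {b η : Mat 𝕜} (hb : b.trace = 1) (hη : η.trace = 0) :
    (b * (b * (η + η) * b - (b * (η + η) * b).trace • b)).trace =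
      b.det * (b * (η + η) * b).trace := by
  obtain ⟨p, q, r, rfl⟩ := exists_eq_of_trace b 1 hb
  obtain ⟨a, c, d, rfl⟩ := exists_eq_of_trace η 0 hη
  simp [Matrix.det_fin_two, Matrix.trace_fin_two]
  ring

/-- The identity that makes `invR` correspond to the field `ζ g` under `polarMul`; here `η` and `σ` are
the Hermitian and the skew-Hermitian part of `k* ζ k`. -/
lemma add_invR {b η σ : Mat 𝕜} (hb : b.trace = 1) (hη : η.trace = 0) (hσ : σ.trace = 0) :
    (σ + (η * b - b * η)) * b + (b * (η + η) * b - (b * (η + η) * b).trace • b) +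
      (2⁻¹ * (b * (η + η) * b).trace) • b = (η + σ) * b := by
  obtain ⟨p, q, r, rfl⟩ := exists_eq_of_trace b 1 hb
  obtain ⟨a, c, d, rfl⟩ := exists_eq_of_trace η 0 hη
  obtain ⟨a', c', d', rfl⟩ := exists_eq_of_trace σ 0 hσ
  ext i j; fin_cases i <;> fin_cases j <;>
    simp [Matrix.trace_fin_two] <;> ring

lemma trace_adjugate_mul {b H : Mat 𝕜} (hb : b.trace = 1) (hH : H.trace = 0) :
    (b.adjugate * H).trace = -(b * H).trace := by
  rw [adjugate_of_trace hb, sub_mul, one_mul, Matrix.trace_sub, hH, zero_sub]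

lemma add_conj_eq_herm (ξ : Mat 𝕜) : ξ + ξᴴ = hermPart ξ + hermPart ξ := by
  rw [← herm_sub_skew]
  nth_rewrite 1 [← herm_add_skew ξ]
  abel

lemma trace_adjugate_invL (ξ : Mat 𝕜) (hξ : ξ.trace = 0) (p : Cpt 𝕜) :
    ((p.2 : Mat 𝕜).adjugate * (invL ξ (emb 𝕜 p)).2).trace =
      -((p.2 : Mat 𝕜).det * (ξᴴ * ((p.2 : Mat 𝕜) * p.2) + (p.2 : Mat 𝕜) * p.2 * ξ).trace) := by
  rw [trace_adjugate_mul p.trace_eq (invL_mem ξ hξ p).2.2]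
  have h := trace_mul_invL p.trace_eq (trace_hermPart hξ) (trace_skewPart hξ)
  rw [herm_sub_skew, herm_add_skew] at h
  rw [← h]
  rfl

lemma trace_adjugate_invR (ζ : Mat 𝕜) (hζ : ζ.trace = 0) (p : Cpt 𝕜) :
    ((p.2 : Mat 𝕜).adjugate * (invR ζ (emb 𝕜 p)).2).trace =
      -((p.2 : Mat 𝕜).det * ((p.2 : Mat 𝕜) * (((p.1 : Mat 𝕜)ᴴ * ζ * (p.1 : Mat 𝕜)) +
        ((p.1 : Mat 𝕜)ᴴ * ζ * (p.1 : Mat 𝕜))ᴴ) * (p.2 : Mat 𝕜)).trace) := by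
  rw [trace_adjugate_mul p.trace_eq (invR_mem ζ hζ p).2.2]
  have h := trace_mul_invR p.trace_eq (trace_hermPart (trace_conj_K p.1 hζ))
  rw [← add_conj_eq_herm] at h
  rw [← h]
  rfl

lemma det_eq_zero_of_not_isInterior {p : Cpt 𝕜} (hp : ¬ p.IsInterior) : (p.2 : Mat 𝕜).det = 0 := by
  rw [← ofReal_bdet p.isHermitian, p.not_isInterior_iff.1 hp, RCLike.ofReal_zero]

lemma invL_mem_bVectorFields (ξ : Mat 𝕜) (hξ : ξ.trace = 0) :
    (fun p => invL ξ (emb 𝕜 p)) ∈ bVectorFields 𝕜 := by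
  refine ⟨⟨isSmooth_comp_emb emb_injective (contDiff_invL ξ), invL_mem ξ hξ⟩, fun p hp => ?_⟩
  rw [trace_adjugate_invL ξ hξ, det_eq_zero_of_not_isInterior hp, zero_mul, neg_zero]

lemma invR_mem_bVectorFields (ζ : Mat 𝕜) (hζ : ζ.trace = 0) :
    (fun p => invR ζ (emb 𝕜 p)) ∈ bVectorFields 𝕜 := by
  refine ⟨⟨isSmooth_comp_emb emb_injective (contDiff_invR ζ), invR_mem ζ hζ⟩, fun p hp => ?_⟩
  rw [trace_adjugate_invR ζ hζ, det_eq_zero_of_not_isInterior hp, zero_mul, neg_zero]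

/-- The differential of the polar decomposition in terms of the derivative of the determinant. -/
lemma polarMulDeriv_of_trace {p : Interior 𝕜} {v : Mat 𝕜 × Mat 𝕜} {t : 𝕜}
    (hv : v.2.IsHermitian)
    (h : ((p.1.2 : Mat 𝕜).adjugate * v.2).trace = -((p.1.2 : Mat 𝕜).det * t)) :
    polarMulDeriv (embInterior 𝕜 p) v = (√(bdet (p.1.2 : Mat 𝕜)))⁻¹ •
      (v.1 * (p.1.2 : Mat 𝕜) + (p.1.1 : Mat 𝕜) * (v.2 + (2⁻¹ * t) • (p.1.2 : Mat 𝕜))) := by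
  have hpos := p.1.isInterior_iff.1 p.2
  have hadj : (p.1.2 : Mat 𝕜).adjugate.IsHermitian := by
    rw [Matrix.IsHermitian, Matrix.adjugate_conjTranspose, p.1.isHermitian.eq]
  have h1 : ((bdetDeriv (p.1.2 : Mat 𝕜) v.2 : ℝ) : 𝕜) =
      -(((bdet (p.1.2 : Mat 𝕜) : ℝ) : 𝕜) * t) := by
    rw [bdetDeriv_apply, ofReal_re_trace_mul hadj hv, h, ofReal_bdet p.1.isHermitian]
  have h2 : (((2 * bdet (p.1.2 : Mat 𝕜))⁻¹ * bdetDeriv (p.1.2 : Mat 𝕜) v.2 : ℝ) : 𝕜) =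
      -(2⁻¹ * t) := by
    have h3 : ((bdet (p.1.2 : Mat 𝕜) : ℝ) : 𝕜) ≠ 0 := by exact_mod_cast hpos.ne'
    rw [RCLike.ofReal_mul, h1, RCLike.ofReal_inv, RCLike.ofReal_mul, RCLike.ofReal_ofNat]
    field_simp
  rw [polarMulDeriv_apply]
  show (√(bdet (p.1.2 : Mat 𝕜)))⁻¹ • (v.1 * (p.1.2 : Mat 𝕜) + (p.1.1 : Mat 𝕜) * v.2) -
    ((√(bdet (p.1.2 : Mat 𝕜)))⁻¹ * (2 * bdet (p.1.2 : Mat 𝕜))⁻¹ *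
      bdetDeriv (p.1.2 : Mat 𝕜) v.2) • ((p.1.1 : Mat 𝕜) * (p.1.2 : Mat 𝕜)) = _
  rw [mul_assoc, mul_smul, ← smul_sub, real_smul_eq ((2 * bdet (p.1.2 : Mat 𝕜))⁻¹ * _), h2,
    neg_smul, sub_neg_eq_add, mul_add, mul_smul_comm, add_assoc]

lemma polarMulDeriv_invL (ξ : Mat 𝕜) (hξ : ξ.trace = 0) (p : Interior 𝕜) :
    polarMulDeriv (embInterior 𝕜 p) (invL ξ (emb 𝕜 p.1)) = embG 𝕜 (toG p) * ξ := by
  rw [polarMulDeriv_of_trace (invL_mem ξ hξ p.1).2.1 (trace_adjugate_invL ξ hξ p.1), embG_toG]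
  have h := add_invL p.1.trace_eq (trace_hermPart hξ) (trace_skewPart hξ)
  rw [herm_sub_skew, herm_add_skew, add_assoc] at h
  show _ = ((√(bdet (p.1.2 : Mat 𝕜)))⁻¹ • ((p.1.1 : Mat 𝕜) * (p.1.2 : Mat 𝕜))) * ξ
  rw [smul_mul_assoc]
  refine congrArg _ ?_
  rw [mul_assoc (p.1.1 : Mat 𝕜) _ ξ, ← h]
  refine Eq.trans ?_ (mul_add _ _ _).symm
  exact congrArg₂ (· + ·) (mul_assoc _ _ _) rfl

lemma polarMulDeriv_invR (ζ : Mat 𝕜) (hζ : ζ.trace = 0) (p : Interior 𝕜) :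
    polarMulDeriv (embInterior 𝕜 p) (invR ζ (emb 𝕜 p.1)) = ζ * embG 𝕜 (toG p) := by
  rw [polarMulDeriv_of_trace (invR_mem ζ hζ p.1).2.1 (trace_adjugate_invR ζ hζ p.1), embG_toG]
  have h := add_invR p.1.trace_eq (trace_hermPart (trace_conj_K p.1.1 hζ))
    (trace_skewPart (trace_conj_K p.1.1 hζ))
  rw [herm_add_skew, ← add_conj_eq_herm, add_assoc] at h
  show _ = ζ * ((√(bdet (p.1.2 : Mat 𝕜)))⁻¹ • ((p.1.1 : Mat 𝕜) * (p.1.2 : Mat 𝕜)))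
  rw [mul_smul_comm]
  refine congrArg _ ?_
  have h2 : ζ * ((p.1.1 : Mat 𝕜) * (p.1.2 : Mat 𝕜)) =
      (p.1.1 : Mat 𝕜) * ((p.1.1 : Mat 𝕜)ᴴ * ζ * (p.1.1 : Mat 𝕜) * (p.1.2 : Mat 𝕜)) := by
    rw [← mul_assoc, ← mul_assoc, ← mul_assoc, ← mul_assoc, K.mul_conjTranspose_self, one_mul]
  rw [h2, ← h]
  refine Eq.trans ?_ (mul_add _ _ _).symm
  exact congrArg₂ (· + ·) (mul_assoc _ _ _) rfl

end InvariantFields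

/-! ### Vector fields tangent to the boundary in terms of invariant fields -/

section BFields

variable {𝕜 : Type*} [RCLike 𝕜]

lemma bField_algebra {b η : Mat 𝕜} (hb : b.trace = 1) (hη : η.trace = 0) :
    b * η - (b * η - η * b) * b = (1 - 2 * b.det) • η + (b * η).trace • (1 - b) := by
  obtain ⟨p, q, r, rfl⟩ := exists_eq_of_trace b 1 hb
  obtain ⟨a, c, d, rfl⟩ := exists_eq_of_trace η 0 hη
  ext i j; fin_cases i <;> fin_cases j <;>
    simp [Matrix.det_fin_two, Matrix.trace_fin_two] <;> ring

/-- The solution `η` of the linear equation expressing that the left-invariant field of the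
Hermitian matrix `η` moves `b` in the direction `H`. The coefficient `c` is singular at the
boundary. -/
lemma bField_solve {b H η : Mat 𝕜} {c : 𝕜} (hb : b.trace = 1) (hH : H.trace = 0)
    (hd : 1 - 2 * b.det ≠ 0) (hc : (b * H).trace = b.det * c)
    (hη : (1 - 2 * b.det) • η = H + c • (b - (1 / 2 : ℝ) • (1 : Mat 𝕜))) :
    b * η - (b * η - η * b) * b = H + (2⁻¹ * c) • b := by
  have hhalf : ((1 / 2 : ℝ) • (1 : Mat 𝕜)) = (2⁻¹ : 𝕜) • (1 : Mat 𝕜) := by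
    rw [real_smul_eq, one_div, RCLike.ofReal_inv, RCLike.ofReal_ofNat]
  rw [hhalf] at hη
  have h1 : (1 - 2 * b.det) * η.trace = 0 := by
    have := congrArg Matrix.trace hη
    rw [Matrix.trace_smul, Matrix.trace_add, Matrix.trace_smul, Matrix.trace_sub,
      Matrix.trace_smul, Matrix.trace_one, hb, hH, Fintype.card_fin] at this
    simpa using this
  have h2 : η.trace = 0 := (mul_eq_zero.1 h1).resolve_left hd
  have h3 : (1 - 2 * b.det) * (b * η).trace = (1 - 2 * b.det) * (2⁻¹ * c) := by
    have := congrArg (fun x => (b * x).trace) hη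
    simp only [mul_add, mul_smul_comm, mul_sub, Matrix.trace_smul, Matrix.trace_add,
      Matrix.trace_sub, mul_one, smul_eq_mul] at this
    rw [this, hc, mul_self_of_trace hb, Matrix.trace_sub, Matrix.trace_smul, Matrix.trace_one, hb,
      Fintype.card_fin, smul_eq_mul]
    push_cast
    ring
  rw [bField_algebra hb h2, mul_left_cancel₀ hd h3, hη, add_assoc]
  congr 1
  rw [smul_sub, smul_sub, smul_smul, mul_comm c]
  have : c • b = (2⁻¹ * c) • b + (2⁻¹ * c) • b := by
    rw [← add_smul]
    congr 1
    ring
  rw [this]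
  abel

/-- Every vector tangent to `G[1]` at an interior point is the sum of a right-invariant and a
left-invariant vector. Only `c = tr (b v₂) / det b` is singular at the boundary, and it occurs
only in `η`: the matrix `A` and the coefficient of the right-invariant vector are smooth in `(k, b)`
and `v`, because `b` commutes with the matrix that `c` multiplies and `1 - 2 det b ≥ 1 / 2`. -/
lemma polarMulDeriv_eq (p : Interior 𝕜) {v : Mat 𝕜 × Mat 𝕜} (hv : v ∈ tangentSpace p.1)
    {b k A η : Mat 𝕜} {c : ℝ} (hk : k = (p.1.1 : Mat 𝕜)) (hb : b = (p.1.2 : Mat 𝕜))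
    (hc : RCLike.re (b * v.2).trace = bdet b * c) (hA : A = (1 - 2 * bdet b)⁻¹ • v.2)
    (hη : η = A + c • ((1 - 2 * bdet b)⁻¹ • (b - (1 / 2 : ℝ) • (1 : Mat 𝕜)))) :
    polarMulDeriv (embInterior 𝕜 p) v =
      (v.1 * kᴴ - k * (b * A - A * b) * kᴴ) * embG 𝕜 (toG p) + embG 𝕜 (toG p) * η := by
  have hbh : b.IsHermitian := hb ▸ p.1.isHermitian
  have hbt : b.trace = 1 := hb ▸ p.1.trace_eq
  have hle := bdet_le hbh hbt
  have hd : 1 - 2 * bdet b ≠ 0 := by linarith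
  have hkk : kᴴ * k = 1 := by rw [hk]; exact K.conjTranspose_mul_self _
  have hc' : (b * v.2).trace = b.det * (c : 𝕜) := by
    rw [← ofReal_re_trace_mul hbh hv.2.1, hc, RCLike.ofReal_mul, ofReal_bdet hbh]
  have hcast : ((1 - 2 * bdet b : ℝ) : 𝕜) = 1 - 2 * b.det := by
    rw [RCLike.ofReal_sub, RCLike.ofReal_mul, ofReal_bdet hbh, RCLike.ofReal_one,
      RCLike.ofReal_ofNat]
  have hcomm : b * A - A * b = b * η - η * b := by
    rw [hη]
    simp only [mul_add, add_mul, mul_smul_comm, smul_mul_assoc, mul_sub, sub_mul, mul_one, one_mul]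
    abel
  have h1 : b * η - (b * η - η * b) * b = v.2 + (2⁻¹ * (c : 𝕜)) • b := by
    refine bField_solve hbt hv.2.2 ?_ hc' ?_
    · rw [← hcast]
      exact_mod_cast hd
    · rw [← hcast, ← real_smul_eq, hη, hA, ← real_smul_eq, smul_comm c, ← smul_add, smul_smul,
        mul_inv_cancel₀ hd, one_smul]
  rw [polarMulDeriv_of_trace (t := (c : 𝕜)) hv.2.1, ← hb, ← hk, ← h1, embG_toG]
  · have h2 : polarMul (embInterior 𝕜 p) = (√(bdet b))⁻¹ • (k * b) := by
      rw [hb, hk]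
      rfl
    rw [h2, mul_smul_comm, smul_mul_assoc, ← smul_add, hcomm]
    congr 1
    obtain ⟨C, hC⟩ : ∃ C, C = b * η - η * b := ⟨_, rfl⟩
    have e1 : v.1 * kᴴ * (k * b) = v.1 * b := by
      rw [mul_assoc, ← mul_assoc kᴴ, hkk, one_mul]
    have e2 : k * C * kᴴ * (k * b) = k * (C * b) := by
      rw [mul_assoc, ← mul_assoc kᴴ, hkk, one_mul, mul_assoc]
    rw [← hC, sub_mul, e1, e2, mul_sub, mul_assoc k b η]
    abel
  · rw [← hb, trace_adjugate_mul hbt hv.2.2, hc']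

end BFields

/-! ### Compactness, rays and boundary defining functions -/

section Compactness

variable {𝕜 : Type*} [RCLike 𝕜]

lemma range_emb : Set.range (emb 𝕜) = {z | z.1 * z.1ᴴ = 1 ∧ z.1.det = 1 ∧ z.2ᴴ = z.2 ∧
    z.2.trace = 1 ∧ 0 ≤ bdet z.2} := by
  ext z
  constructor
  · rintro ⟨p, rfl⟩
    exact ⟨K.mul_conjTranspose_self p.1, K.det_eq_one p.1, p.isHermitian, p.trace_eq,
      p.bdet_nonneg⟩
  · rintro ⟨h1, h2, h3, h4, h5⟩
    exact ⟨(⟨z.1, mem_K_iff.2 ⟨h1, h2⟩⟩, ⟨z.2, (posSemidef_iff_bdet h3 h4).2 h5, h4⟩), rfl⟩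

lemma norm_K (k : K 𝕜) : ‖(k : Mat 𝕜)‖ ^ 2 = 2 := by
  rw [norm_sq_eq_trace, K.conjTranspose_mul_self, Matrix.trace_one, Fintype.card_fin]
  simp

@[fun_prop] lemma contDiff_bdet {n : ℕ∞ω} : ContDiff ℝ n (bdet (𝕜 := 𝕜)) := by
  unfold bdet
  fun_prop

lemma isCompact_range_emb : IsCompact (Set.range (emb 𝕜)) := by
  have hfin : FiniteDimensional ℝ (Mat 𝕜) := Module.Finite.matrix
  have hprop' : ProperSpace (Mat 𝕜) := FiniteDimensional.proper ℝ _
  have hprop : ProperSpace (Mat 𝕜 × Mat 𝕜) := inferInstance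
  refine Metric.isCompact_of_isClosed_isBounded ?_ ?_
  · rw [range_emb]
    have h1 : Continuous (fun z : Mat 𝕜 × Mat 𝕜 => z.1 * z.1ᴴ) :=
      ContDiff.continuous (𝕜 := ℝ) (n := 0) (by fun_prop)
    have h2 : Continuous (fun z : Mat 𝕜 × Mat 𝕜 => z.1.det) :=
      ContDiff.continuous (𝕜 := ℝ) (n := 0) (by fun_prop)
    have h3 : Continuous (fun z : Mat 𝕜 × Mat 𝕜 => z.2ᴴ) :=
      ContDiff.continuous (𝕜 := ℝ) (n := 0) (by fun_prop)
    have h4 : Continuous (fun z : Mat 𝕜 × Mat 𝕜 => z.2.trace) :=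
      ContDiff.continuous (𝕜 := ℝ) (n := 0) (by fun_prop)
    have h5 : Continuous (fun z : Mat 𝕜 × Mat 𝕜 => bdet z.2) :=
      ContDiff.continuous (𝕜 := ℝ) (n := 0) (by fun_prop)
    exact (isClosed_eq h1 continuous_const).inter ((isClosed_eq h2 continuous_const).inter
      ((isClosed_eq h3 continuous_snd).inter ((isClosed_eq h4 continuous_const).inter
        (isClosed_le continuous_const h5))))
  · refine isBounded_iff_forall_norm_le.2 ⟨2, ?_⟩
    rintro _ ⟨p, rfl⟩
    refine max_le ?_ ?_
    · show ‖(p.1 : Mat 𝕜)‖ ≤ 2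
      nlinarith [norm_K p.1, norm_nonneg (p.1 : Mat 𝕜)]
    · show ‖(p.2 : Mat 𝕜)‖ ≤ 2
      nlinarith [norm_sq_of_herm p.isHermitian p.trace_eq, p.bdet_nonneg,
        norm_nonneg (p.2 : Mat 𝕜)]

/-- A smooth function on the compact manifold `G[1]` is bounded. -/
lemma IsSmooth.exists_bound {F : Type*} [NormedAddCommGroup F] [NormedSpace ℝ F] {f : Cpt 𝕜 → F}
    (hf : IsSmooth (emb 𝕜) f) : ∃ C, 0 ≤ C ∧ ∀ p, ‖f p‖ ≤ C := by
  obtain ⟨C, hC⟩ := isCompact_range_emb.exists_bound_of_continuousOn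
    (ContDiffOn.continuousOn (𝕜 := ℝ) hf)
  refine ⟨max C 0, le_max_right _ _, fun p => le_trans ?_ (le_max_left _ _)⟩
  have := hC _ ⟨p, rfl⟩
  rwa [extend_self emb_injective] at this

/-- The maximum of two smooth functions, if positive, is bounded below on `G[1]`. -/
lemma exists_pos_le_max {f g : Cpt 𝕜 → ℝ} (hf : IsSmooth (emb 𝕜) f) (hg : IsSmooth (emb 𝕜) g)
    (h : ∀ p, 0 < max (f p) (g p)) : ∃ m > 0, ∀ p, m ≤ max (f p) (g p) := by
  rcases (Set.range (emb 𝕜)).eq_empty_or_nonempty with h0 | h0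
  · exact ⟨1, one_pos, fun p => absurd (Set.mem_range_self p) (by rw [h0]; exact fun h => h)⟩
  obtain ⟨_, ⟨q, rfl⟩, hq⟩ := isCompact_range_emb.exists_isMinOn h0
    ((ContDiffOn.continuousOn (𝕜 := ℝ) hf).sup (ContDiffOn.continuousOn (𝕜 := ℝ) hg))
  refine ⟨_, h q, fun p => ?_⟩
  have := hq (Set.mem_range_self p)
  simpa only [Pi.sup_apply, Set.mem_ofPred_eq, extend_self emb_injective] using this

lemma isSmooth_bdet : IsSmooth (emb 𝕜) (fun p : Cpt 𝕜 => bdet (p.2 : Mat 𝕜)) :=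
  isSmooth_comp_emb emb_injective (g := fun z : Mat 𝕜 × Mat 𝕜 => bdet z.2) (by fun_prop)

lemma Cpt.bdet_le (p : Cpt 𝕜) : bdet (p.2 : Mat 𝕜) ≤ 1 / 4 :=
  SL2Cpt.bdet_le p.isHermitian p.trace_eq

/-- The radial vector field of the ball, centred at the matrix `1/2`. -/
def radial (z : Mat 𝕜 × Mat 𝕜) : Mat 𝕜 × Mat 𝕜 := (0, z.2 - (1 / 2 : ℝ) • (1 : Mat 𝕜))

lemma trace_half : ((1 / 2 : ℝ) • (1 : Mat 𝕜)).trace = 1 := by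
  rw [Matrix.trace_smul, Matrix.trace_one, RCLike.real_smul_eq_coe_mul, Fintype.card_fin,
    ← RCLike.ofReal_natCast, ← RCLike.ofReal_mul]
  norm_num

lemma isHermitian_half : ((1 / 2 : ℝ) • (1 : Mat 𝕜)).IsHermitian := by
  rw [Matrix.IsHermitian, Matrix.conjTranspose_smul, star_trivial, Matrix.conjTranspose_one]

lemma half_mem_tangentSpace (p : Cpt 𝕜) :
    ((0 : Mat 𝕜), (p.2 : Mat 𝕜) - (1 / 2 : ℝ) • (1 : Mat 𝕜)) ∈ tangentSpace p :=
  ⟨⟨0, by simp, by simp, by simp⟩, p.isHermitian.sub isHermitian_half, by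
    rw [Matrix.trace_sub, p.trace_eq, trace_half, sub_self]⟩

lemma radial_mem : (fun p => radial (emb 𝕜 p)) ∈ vectorFields 𝕜 := by
  refine ⟨isSmooth_comp_emb emb_injective ?_, half_mem_tangentSpace⟩
  unfold radial
  fun_prop

/-- The radial derivative. -/
def radialDeriv {F : Type*} [NormedAddCommGroup F] [NormedSpace ℝ F] (f : Cpt 𝕜 → F) : Cpt 𝕜 → F :=
  vecDeriv (emb 𝕜) (fun p => radial (emb 𝕜 p)) f

lemma IsSmooth.radialDeriv {F : Type*} [NormedAddCommGroup F] [NormedSpace ℝ F] {f : Cpt 𝕜 → F}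
    (hf : IsSmooth (emb 𝕜) f) : IsSmooth (emb 𝕜) (radialDeriv f) :=
  hf.vecDeriv emb_injective radial_mem.1 fun p => mem_tanSpan_emb (radial_mem.2 p)

lemma trace_ray (p : Cpt 𝕜) (t : ℝ) :
    ((1 / 2 : ℝ) • (1 : Mat 𝕜) + t • ((p.2 : Mat 𝕜) - (1 / 2 : ℝ) • (1 : Mat 𝕜))).trace = 1 := by
  rw [Matrix.trace_add, trace_half, Matrix.trace_smul, Matrix.trace_sub, p.trace_eq, trace_half,
    sub_self, smul_zero, add_zero]

lemma isHermitian_ray (p : Cpt 𝕜) (t : ℝ) : ((1 / 2 : ℝ) • (1 : Mat 𝕜) +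
    t • ((p.2 : Mat 𝕜) - (1 / 2 : ℝ) • (1 : Mat 𝕜))).IsHermitian := by
  refine isHermitian_half.add ?_
  rw [Matrix.IsHermitian, Matrix.conjTranspose_smul, star_trivial,
    (p.isHermitian.sub isHermitian_half).eq]

/-- `det` along the ray through `b`, from `1 - 4 det b(t) = t² (1 - 4 det b)`. -/
lemma bdet_ray (p : Cpt 𝕜) (t : ℝ) :
    bdet ((1 / 2 : ℝ) • (1 : Mat 𝕜) + t • ((p.2 : Mat 𝕜) - (1 / 2 : ℝ) • (1 : Mat 𝕜))) =
      (1 - t ^ 2 * (1 - 4 * bdet (p.2 : Mat 𝕜))) / 4 := by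
  have h1 : ((1 / 2 : ℝ) • (1 : Mat 𝕜) +
      t • ((p.2 : Mat 𝕜) - (1 / 2 : ℝ) • (1 : Mat 𝕜))).det =
      (((1 - t ^ 2 * (1 - 4 * bdet (p.2 : Mat 𝕜))) / 4 : ℝ) : 𝕜) := by
    have h2 := ofReal_bdet p.isHermitian
    have h3 : (p.2 : Mat 𝕜) 0 0 + (p.2 : Mat 𝕜) 1 1 = 1 := by
      rw [← Matrix.trace_fin_two, p.trace_eq]
    rw [Matrix.det_fin_two] at h2
    simp only [RCLike.ofReal_sub, RCLike.ofReal_mul, RCLike.ofReal_div, RCLike.ofReal_pow,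
      RCLike.ofReal_one, RCLike.ofReal_ofNat, h2]
    simp only [Matrix.det_fin_two, Matrix.add_apply, Matrix.smul_apply, Matrix.sub_apply,
      Matrix.one_apply_eq, Matrix.one_apply_ne (zero_ne_one (α := Fin 2)),
      Matrix.one_apply_ne (one_ne_zero (α := Fin 2)), RCLike.real_smul_eq_coe_mul,
      RCLike.ofReal_div, RCLike.ofReal_one, RCLike.ofReal_ofNat]
    have h4 : (p.2 : Mat 𝕜) 1 1 = 1 - (p.2 : Mat 𝕜) 0 0 := by linear_combination h3
    rw [h4]
    ring
  rw [bdet, h1, RCLike.ofReal_re]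

open Classical in
/-- The ray from the centre of the ball through a point of `G[1]`, parametrized so that the centre
is `t = 0` and the point itself is `t = 1`. Past the boundary it is continued in an arbitrary
way. -/
def ray (p : Cpt 𝕜) (t : ℝ) : Cpt 𝕜 :=
  if h : t ^ 2 * (1 - 4 * bdet (p.2 : Mat 𝕜)) ≤ 1 then
    (p.1, ⟨_, (posSemidef_iff_bdet (isHermitian_ray p t) (trace_ray p t)).2
      (by rw [bdet_ray]; linarith), trace_ray p t⟩)
  else p

lemma emb_ray {p : Cpt 𝕜} {t : ℝ} (h : t ^ 2 * (1 - 4 * bdet (p.2 : Mat 𝕜)) ≤ 1) :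
    emb 𝕜 (ray p t) = ((p.1 : Mat 𝕜),
      (1 / 2 : ℝ) • (1 : Mat 𝕜) + t • ((p.2 : Mat 𝕜) - (1 / 2 : ℝ) • (1 : Mat 𝕜))) := by
  rw [ray, dif_pos h]
  rfl

lemma bdet_ray_eq {p : Cpt 𝕜} {t : ℝ} (h : t ^ 2 * (1 - 4 * bdet (p.2 : Mat 𝕜)) ≤ 1) :
    bdet ((ray p t).2 : Mat 𝕜) = (1 - t ^ 2 * (1 - 4 * bdet (p.2 : Mat 𝕜))) / 4 := by
  rw [← bdet_ray]
  exact congrArg (fun z => bdet z.2) (emb_ray h)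

lemma ray_one (p : Cpt 𝕜) : ray p 1 = p := by
  apply emb_injective
  rw [emb_ray (by linarith [p.bdet_nonneg]), one_smul, add_sub_cancel]
  rfl

lemma hasDerivWithinAt_ray {F : Type*} [NormedAddCommGroup F] [NormedSpace ℝ F] {f : Cpt 𝕜 → F}
    (hf : IsSmooth (emb 𝕜) f) (p : Cpt 𝕜) {s : Set ℝ}
    (hs : ∀ t ∈ s, 0 < t ∧ t ^ 2 * (1 - 4 * bdet (p.2 : Mat 𝕜)) ≤ 1) {t : ℝ} (ht : t ∈ s) :
    HasDerivWithinAt (fun t => f (ray p t)) (t⁻¹ • radialDeriv f (ray p t)) s t := by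
  have h1 : HasDerivAt (fun t : ℝ => ((p.1 : Mat 𝕜),
      (1 / 2 : ℝ) • (1 : Mat 𝕜) + t • ((p.2 : Mat 𝕜) - (1 / 2 : ℝ) • (1 : Mat 𝕜))))
      ((0 : Mat 𝕜), (p.2 : Mat 𝕜) - (1 / 2 : ℝ) • (1 : Mat 𝕜)) t := by
    have h2 := ((hasDerivAt_id t).smul_const
      ((p.2 : Mat 𝕜) - (1 / 2 : ℝ) • (1 : Mat 𝕜))).const_add ((1 / 2 : ℝ) • (1 : Mat 𝕜))
    rw [one_smul] at h2
    exact (hasDerivAt_const t (p.1 : Mat 𝕜)).prodMk h2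
  have h3 : HasDerivWithinAt (fun t => emb 𝕜 (ray p t))
      ((0 : Mat 𝕜), (p.2 : Mat 𝕜) - (1 / 2 : ℝ) • (1 : Mat 𝕜)) s t :=
    h1.hasDerivWithinAt.congr (fun x hx => emb_ray (hs x hx).2) (emb_ray (hs t ht).2)
  refine (hasDerivWithinAt_curve emb_injective hf h3).congr_deriv ?_
  have h4 : radial (emb 𝕜 (ray p t)) =
      t • ((0 : Mat 𝕜), (p.2 : Mat 𝕜) - (1 / 2 : ℝ) • (1 : Mat 𝕜)) := by
    rw [emb_ray (hs t ht).2, radial, Prod.smul_mk, smul_zero, add_sub_cancel_left]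
  rw [radialDeriv, vecDeriv, h4, dirDeriv_smul_vec, smul_smul, inv_mul_cancel₀ (hs t ht).1.ne',
    one_smul]

/-- The parameter at which the ray through `p` hits the boundary. -/
def exitTime (p : Cpt 𝕜) : ℝ := (√(1 - 4 * bdet (p.2 : Mat 𝕜)))⁻¹

lemma exitTime_bounds {p : Cpt 𝕜} (hp : bdet (p.2 : Mat 𝕜) ≤ 3 / 16) :
    exitTime p ^ 2 * (1 - 4 * bdet (p.2 : Mat 𝕜)) = 1 ∧ 1 ≤ exitTime p ∧ exitTime p ≤ 2 ∧
      2 * bdet (p.2 : Mat 𝕜) ≤ exitTime p - 1 ∧ exitTime p - 1 ≤ 6 * bdet (p.2 : Mat 𝕜) := by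
  have h0 := p.bdet_nonneg
  have h1 : 0 < 1 - 4 * bdet (p.2 : Mat 𝕜) := by linarith
  have h2 : exitTime p ^ 2 * (1 - 4 * bdet (p.2 : Mat 𝕜)) = 1 := by
    rw [exitTime, inv_pow, Real.sq_sqrt h1.le, inv_mul_cancel₀ h1.ne']
  have h3 : 0 < exitTime p := inv_pos.2 (Real.sqrt_pos.2 h1)
  have h4 : 1 ≤ exitTime p := by nlinarith
  have h5 : exitTime p ≤ 2 := by nlinarith
  have h6 : (exitTime p - 1) * (exitTime p + 1) = 4 * bdet (p.2 : Mat 𝕜) * exitTime p ^ 2 := by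
    linarith
  refine ⟨h2, h4, h5, ?_, ?_⟩
  · have h7 : 2 * bdet (p.2 : Mat 𝕜) * (exitTime p + 1) ≤
        (exitTime p - 1) * (exitTime p + 1) := by
      rw [h6]
      nlinarith [mul_nonneg h0 (by nlinarith : 0 ≤ 2 * exitTime p ^ 2 - exitTime p - 1)]
    exact le_of_mul_le_mul_right h7 (by linarith)
  · have h7 : (exitTime p - 1) * (exitTime p + 1) ≤
        6 * bdet (p.2 : Mat 𝕜) * (exitTime p + 1) := by
      rw [h6]
      nlinarith [mul_nonneg h0 (by nlinarith : 0 ≤ 6 * (exitTime p + 1) - 4 * exitTime p ^ 2)]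
    exact le_of_mul_le_mul_right h7 (by linarith)

lemma ray_conditions {p : Cpt 𝕜} (hp : bdet (p.2 : Mat 𝕜) ≤ 3 / 16) {t : ℝ}
    (ht : t ∈ Set.Icc 1 (exitTime p)) : 0 < t ∧ t ^ 2 * (1 - 4 * bdet (p.2 : Mat 𝕜)) ≤ 1 := by
  obtain ⟨h2, -⟩ := exitTime_bounds hp
  refine ⟨by linarith [ht.1], ?_⟩
  have h1 : 0 ≤ 1 - 4 * bdet (p.2 : Mat 𝕜) := by linarith
  have h3 : t ^ 2 ≤ exitTime p ^ 2 := by nlinarith [ht.1, ht.2]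
  exact (mul_le_mul_of_nonneg_right h3 h1).trans h2.le

lemma bdet_ray_le {p : Cpt 𝕜} (hp : bdet (p.2 : Mat 𝕜) ≤ 3 / 16) {t : ℝ}
    (ht : t ∈ Set.Icc 1 (exitTime p)) : bdet ((ray p t).2 : Mat 𝕜) ≤ bdet (p.2 : Mat 𝕜) := by
  rw [bdet_ray_eq (ray_conditions hp ht).2]
  have h1 : 0 ≤ 1 - 4 * bdet (p.2 : Mat 𝕜) := by linarith
  nlinarith [mul_nonneg h1 (by nlinarith [ht.1] : 0 ≤ t ^ 2 - 1)]

lemma ray_exitTime_not_isInterior {p : Cpt 𝕜} (hp : bdet (p.2 : Mat 𝕜) ≤ 3 / 16) :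
    ¬ (ray p (exitTime p)).IsInterior := by
  obtain ⟨h2, h3, -⟩ := exitTime_bounds hp
  rw [Cpt.not_isInterior_iff, bdet_ray_eq h2.le, h2]
  norm_num

/-- A smooth function vanishing on the boundary is bounded by the distance to the boundary times a
bound of its radial derivative closer to the boundary. -/
lemma norm_le_of_radialDeriv {f : Cpt 𝕜 → ℂ} (hf : IsSmooth (emb 𝕜) f)
    (h0 : ∀ p : Cpt 𝕜, ¬ p.IsInterior → f p = 0) {p : Cpt 𝕜} (hp : bdet (p.2 : Mat 𝕜) ≤ 3 / 16)
    {M : ℝ} (hM : ∀ q : Cpt 𝕜, bdet (q.2 : Mat 𝕜) ≤ bdet (p.2 : Mat 𝕜) → ‖radialDeriv f q‖ ≤ M) :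
    ‖f p‖ ≤ M * (6 * bdet (p.2 : Mat 𝕜)) := by
  obtain ⟨h2, h3, h4, -, h5⟩ := exitTime_bounds hp
  have hM0 : 0 ≤ M := (norm_nonneg _).trans (hM p le_rfl)
  have h6 := norm_image_sub_le_of_norm_deriv_le_segment' (C := M)
    (fun t ht => hasDerivWithinAt_ray hf p (fun t ht => ray_conditions hp ht) ht) ?_
    (exitTime p) ⟨h3, le_rfl⟩
  · rw [h0 _ (ray_exitTime_not_isInterior hp), ray_one, zero_sub, norm_neg] at h6
    exact h6.trans (mul_le_mul_of_nonneg_left h5 hM0)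
  · intro t ht
    have ht' : t ∈ Set.Icc 1 (exitTime p) := ⟨ht.1, ht.2.le⟩
    rw [norm_smul, norm_inv, Real.norm_of_nonneg (ray_conditions hp ht').1.le]
    have h7 : t⁻¹ ≤ 1 := inv_le_one_of_one_le₀ ht.1
    have h8 := hM _ (bdet_ray_le hp ht')
    calc t⁻¹ * ‖radialDeriv f (ray p t)‖ ≤ 1 * M :=
          mul_le_mul h7 h8 (norm_nonneg _) zero_le_one
      _ = M := one_mul M

/-- A smooth function vanishing on the boundary is bounded by a multiple of `det b`. -/
lemma exists_norm_le_bdet {f : Cpt 𝕜 → ℂ} (hf : IsSmooth (emb 𝕜) f)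
    (h0 : ∀ p : Cpt 𝕜, ¬ p.IsInterior → f p = 0) :
    ∃ C, 0 ≤ C ∧ ∀ p, ‖f p‖ ≤ C * bdet (p.2 : Mat 𝕜) := by
  obtain ⟨C₁, hC₁, h1⟩ := hf.exists_bound
  obtain ⟨C₂, hC₂, h2⟩ := hf.radialDeriv.exists_bound
  refine ⟨C₁ * 6 + C₂ * 6, by positivity, fun p => ?_⟩
  have h3 := p.bdet_nonneg
  rcases le_total (bdet (p.2 : Mat 𝕜)) (3 / 16) with hp | hp
  · have := norm_le_of_radialDeriv hf h0 hp fun q _ => h2 q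
    nlinarith [mul_nonneg hC₁ h3]
  · have := h1 p
    nlinarith [mul_nonneg hC₂ h3, mul_nonneg hC₁ (sub_nonneg.2 hp)]

/-- Conjugation by a one-parameter family in `K`, as a curve in the ball. -/
def conjCurve (b : PosBall 𝕜) {Y : Mat 𝕜} (h1 : Yᴴ = -Y) (h2 : Y.trace = 0) (t : ℝ) : PosBall 𝕜 :=
  ⟨(kCurve 1 h1 h2 t : Mat 𝕜) * (b : Mat 𝕜) * (kCurve 1 h1 h2 t : Mat 𝕜)ᴴ,
    b.2.1.mul_mul_conjTranspose_same _, by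
    rw [Matrix.trace_mul_comm, ← mul_assoc, K.conjTranspose_mul_self, one_mul, b.2.2]⟩

lemma det_conjCurve (b : PosBall 𝕜) {Y : Mat 𝕜} (h1 : Yᴴ = -Y) (h2 : Y.trace = 0) (t : ℝ) :
    (conjCurve b h1 h2 t : Mat 𝕜).det = (b : Mat 𝕜).det := by
  show ((kCurve 1 h1 h2 t : Mat 𝕜) * (b : Mat 𝕜) * (kCurve 1 h1 h2 t : Mat 𝕜)ᴴ).det = _
  rw [Matrix.det_mul, Matrix.det_mul, Matrix.det_conjTranspose, K.det_eq_one, star_one, one_mul,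
    mul_one]

/-- A smooth function vanishing on the boundary has vanishing derivatives along the boundary, since
every vector tangent to the boundary is the velocity of a curve in the boundary. -/
lemma dirDeriv_eq_zero_of_boundary {F : Type*} [NormedAddCommGroup F] [NormedSpace ℝ F]
    {f : Cpt 𝕜 → F} (hf : IsSmooth (emb 𝕜) f) (h0 : ∀ p : Cpt 𝕜, ¬ p.IsInterior → f p = 0)
    {p : Cpt 𝕜} (hp : ¬ p.IsInterior) {v : Mat 𝕜 × Mat 𝕜} (hv : v ∈ tangentSpace p)
    (hv' : ((p.2 : Mat 𝕜).adjugate * v.2).trace = 0) : dirDeriv (emb 𝕜) f p v = 0 := by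
  obtain ⟨⟨X, hX1, hX2, hX3⟩, hH, hHt⟩ := hv
  set b : Mat 𝕜 := (p.2 : Mat 𝕜) with hb
  have hbt : b.trace = 1 := p.trace_eq
  have hbh : b.IsHermitian := p.isHermitian
  have hdet : b.det = 0 := det_eq_zero_of_not_isInterior hp
  have htr : (b * v.2).trace = 0 := by
    rwa [trace_adjugate_mul hbt hHt, neg_eq_zero] at hv'
  -- At the boundary `b` is a projection, and conjugation by a curve in `K` with velocity
  -- `[H, b]` moves it in the direction `[[H, b], b] = H` if `tr (b H) = 0`.
  have hY1 : (v.2 * b - b * v.2)ᴴ = -(v.2 * b - b * v.2) := by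
    rw [Matrix.conjTranspose_sub, Matrix.conjTranspose_mul, Matrix.conjTranspose_mul, hbh.eq,
      hH.eq, neg_sub]
  have hY2 : (v.2 * b - b * v.2).trace = 0 := by
    rw [Matrix.trace_sub, Matrix.trace_mul_comm, sub_self]
  have hYb : (v.2 * b - b * v.2) * b - b * (v.2 * b - b * v.2) = v.2 := by
    have e1 : b * b = b := by rw [mul_self_of_trace hbt, hdet, zero_smul, sub_zero]
    have e2 : b * v.2 * b = 0 := by
      rw [mul_mul_of_trace hbt hHt, htr, hdet, zero_smul, zero_smul, add_zero]
    have e3 : b * v.2 + v.2 * b = v.2 := by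
      rw [mul_add_mul_of_trace hbt hHt, htr, zero_smul, add_zero]
    rw [sub_mul, mul_sub, mul_assoc v.2, e1, ← mul_assoc, ← mul_assoc, e1, e2, sub_zero, zero_sub,
      sub_neg_eq_add, add_comm, e3]
  let γ : ℝ → Cpt 𝕜 := fun t => (kCurve p.1 hX1 hX2 t, conjCurve p.2 hY1 hY2 t)
  have hγ0 : γ 0 = p := by
    refine Prod.ext (kCurve_zero p.1 hX1 hX2) (Subtype.ext ?_)
    show (kCurve 1 hY1 hY2 0 : Mat 𝕜) * (p.2 : Mat 𝕜) * (kCurve 1 hY1 hY2 0 : Mat 𝕜)ᴴ = _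
    rw [kCurve_zero]
    show (1 : Mat 𝕜) * (p.2 : Mat 𝕜) * (1 : Mat 𝕜)ᴴ = _
    rw [Matrix.conjTranspose_one, one_mul, mul_one]
  have hU : HasDerivAt (fun t => (kCurve 1 hY1 hY2 t : Mat 𝕜)) (v.2 * b - b * v.2) 0 :=
    (hasDerivAt_kCurve 1 hY1 hY2).congr_deriv (one_mul (v.2 * b - b * v.2))
  have hUs : HasDerivAt (fun t => (kCurve 1 hY1 hY2 t : Mat 𝕜)ᴴ) (-(v.2 * b - b * v.2)) 0 := by
    rw [← hY1]
    exact (starL (𝕜 := 𝕜)).hasFDerivAt.comp_hasDerivAt (0 : ℝ) hU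
  have hd2 : HasDerivAt (fun t => (conjCurve p.2 hY1 hY2 t : Mat 𝕜)) v.2 0 := by
    refine ((hU.mul_const b).mul hUs).congr_deriv ?_
    rw [kCurve_zero]
    show (v.2 * b - b * v.2) * b * (1 : Mat 𝕜)ᴴ + (1 : Mat 𝕜) * b * -(v.2 * b - b * v.2) = _
    rw [Matrix.conjTranspose_one, mul_one, one_mul, mul_neg, ← sub_eq_add_neg, hYb]
  have hd1 : HasDerivAt (fun t => (kCurve p.1 hX1 hX2 t : Mat 𝕜)) v.1 0 := by
    rw [hX3]
    exact hasDerivAt_kCurve p.1 hX1 hX2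
  have hd : HasDerivWithinAt (fun t => emb 𝕜 (γ t)) v Set.univ 0 :=
    (hd1.prodMk hd2).hasDerivWithinAt
  have h1 := hasDerivWithinAt_curve emb_injective hf hd
  have h2 : (fun t => f (γ t)) = fun _ => 0 := by
    funext t
    refine h0 _ ?_
    rw [Cpt.not_isInterior_iff]
    show bdet (conjCurve p.2 hY1 hY2 t : Mat 𝕜) = 0
    rw [bdet, det_conjCurve, ← hb, hdet, map_zero]
  rw [h2, hγ0] at h1
  exact (h1.hasDerivAt Filter.univ_mem).unique (hasDerivAt_const (0 : ℝ) (0 : F))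

/-- A boundary defining function increases strictly in the inward direction at the boundary: its
derivatives along the boundary vanish, so the radial one does not. -/
lemma IsBoundaryDefining.radialDeriv_neg {ρ : Cpt 𝕜 → ℝ} (hρ : IsBoundaryDefining ρ) {p : Cpt 𝕜}
    (hp : ¬ p.IsInterior) : radialDeriv ρ p < 0 := by
  obtain ⟨hs, hnn, hz, hd⟩ := hρ
  have hb0 := p.not_isInterior_iff.1 hp
  have h1 : radialDeriv ρ p ≤ 0 := by
    have hset : ∀ t ∈ Set.Ioc (0 : ℝ) 1, 0 < t ∧ t ^ 2 * (1 - 4 * bdet (p.2 : Mat 𝕜)) ≤ 1 := by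
      intro t ht
      refine ⟨ht.1, ?_⟩
      rw [hb0]
      nlinarith [ht.1, ht.2]
    have h2 := hasDerivWithinAt_ray hs p hset ⟨one_pos, le_rfl⟩
    rw [inv_one, one_smul, ray_one, hasDerivWithinAt_iff_tendsto_slope] at h2
    have hne : (𝓝[Set.Ioc (0 : ℝ) 1 \ {1}] (1 : ℝ)).NeBot := by
      have : Set.Ioc (0 : ℝ) 1 \ {1} = Set.Ioo 0 1 := by
        ext t
        simp only [Set.mem_sdiff, Set.mem_Ioc, Set.mem_singleton_iff, Set.mem_Ioo]
        exact ⟨fun h => ⟨h.1.1, lt_of_le_of_ne h.1.2 h.2⟩, fun h => ⟨⟨h.1, h.2.le⟩, h.2.ne⟩⟩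
      rw [this]
      exact right_nhdsWithin_Ioo_neBot one_pos
    refine le_of_tendsto h2 ?_
    filter_upwards [self_mem_nhdsWithin] with t ht
    rw [slope_def_field, ray_one, (hz p).2 hp, sub_zero]
    exact div_nonpos_of_nonneg_of_nonpos (hnn _) (by linarith [ht.1.2])
  refine lt_of_le_of_ne h1 fun h2 => ?_
  obtain ⟨v, hv, hv0⟩ := hd p hp
  apply hv0
  -- With this multiple of the radial vector subtracted, `v` is tangent to the boundary.
  set c : ℝ := 2 * RCLike.re ((p.2 : Mat 𝕜) * v.2).trace with hc
  have h3 : v = (v.1, v.2 - c • ((p.2 : Mat 𝕜) - (1 / 2 : ℝ) • (1 : Mat 𝕜))) +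
      c • radial (emb 𝕜 p) := by
    refine Prod.ext ?_ ?_
    · show v.1 = v.1 + c • (0 : Mat 𝕜)
      simp
    · show v.2 = v.2 - c • ((p.2 : Mat 𝕜) - (1 / 2 : ℝ) • (1 : Mat 𝕜)) +
        c • ((p.2 : Mat 𝕜) - (1 / 2 : ℝ) • (1 : Mat 𝕜))
      rw [sub_add_cancel]
  have h5 : dirDeriv (emb 𝕜) ρ p (radial (emb 𝕜 p)) = 0 := h2
  have hm := half_mem_tangentSpace p
  have hsm : (c • ((p.2 : Mat 𝕜) - (1 / 2 : ℝ) • (1 : Mat 𝕜))).IsHermitian := by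
    rw [Matrix.IsHermitian, Matrix.conjTranspose_smul, star_trivial, hm.2.1.eq]
  have hv1 : (v.1, v.2 - c • ((p.2 : Mat 𝕜) - (1 / 2 : ℝ) • (1 : Mat 𝕜))) ∈ tangentSpace p := by
    refine ⟨hv.1, hv.2.1.sub hsm, ?_⟩
    show (v.2 - c • ((p.2 : Mat 𝕜) - (1 / 2 : ℝ) • (1 : Mat 𝕜))).trace = 0
    rw [Matrix.trace_sub, hv.2.2, Matrix.trace_smul, hm.2.2, smul_zero, sub_zero]
  rw [h3, dirDeriv_add_vec, dirDeriv_smul_vec, h5, smul_zero, add_zero]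
  refine dirDeriv_eq_zero_of_boundary hs (fun q hq => (hz q).2 hq) hp hv1 ?_
  rw [trace_adjugate_mul p.trace_eq hv1.2.2]
  have h6 : ((p.2 : Mat 𝕜) * ((p.2 : Mat 𝕜) - (1 / 2 : ℝ) • (1 : Mat 𝕜))).trace =
      ((1 / 2 : ℝ) : 𝕜) := by
    rw [mul_sub, mul_self_of_trace p.trace_eq, det_eq_zero_of_not_isInterior hp, zero_smul,
      sub_zero, mul_smul_comm, mul_one, Matrix.trace_sub, Matrix.trace_smul, p.trace_eq,
      RCLike.real_smul_eq_coe_mul, mul_one, ← RCLike.ofReal_one, ← RCLike.ofReal_sub]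
    norm_num
  show -((p.2 : Mat 𝕜) * (v.2 - c • ((p.2 : Mat 𝕜) - (1 / 2 : ℝ) • (1 : Mat 𝕜)))).trace = 0
  rw [mul_sub, mul_smul_comm, Matrix.trace_sub, Matrix.trace_smul, h6,
    ← ofReal_re_trace_mul p.isHermitian hv.2.1, RCLike.real_smul_eq_coe_mul, ← RCLike.ofReal_mul,
    ← RCLike.ofReal_sub, hc]
  ring_nf
  simp

/-- Every boundary defining function is comparable to `det b`. -/
lemma IsBoundaryDefining.comparable {ρ : Cpt 𝕜 → ℝ} (hρ : IsBoundaryDefining ρ) :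
    ∃ c > 0, ∃ C > 0, ∀ p : Cpt 𝕜, c * bdet (p.2 : Mat 𝕜) ≤ ρ p ∧
      ρ p ≤ C * bdet (p.2 : Mat 𝕜) := by
  have hneg := fun p => hρ.radialDeriv_neg (p := p)
  obtain ⟨hs, hnn, hz, -⟩ := hρ
  have hRs := hs.radialDeriv
  -- The inward derivative of `ρ` is at least `m` where `det b < m`, and `ρ ≥ m₂` elsewhere.
  obtain ⟨m, hm, hm'⟩ := exists_pos_le_max isSmooth_bdet
    (hRs.comp_contDiff emb_injective (g := fun x : ℝ => -x) (by fun_prop)) (fun p => by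
      by_cases hp : p.IsInterior
      · exact lt_max_of_lt_left (p.isInterior_iff.1 hp)
      · exact lt_max_of_lt_right (neg_pos.2 (hneg p hp)))
  obtain ⟨m₂, hm₂, hm₂'⟩ := exists_pos_le_max hs
    (isSmooth_bdet.comp_contDiff emb_injective (g := fun x : ℝ => min m (3 / 16) - x)
      (by fun_prop)) (fun p => by
      by_cases hp : p.IsInterior
      · exact lt_max_of_lt_left (lt_of_le_of_ne (hnn p) fun h => (hz p).1 h.symm hp)
      · refine lt_max_of_lt_right ?_
        rw [p.not_isInterior_iff.1 hp, sub_zero]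
        exact lt_min hm (by norm_num))
  obtain ⟨C, hC, hC'⟩ := exists_norm_le_bdet (f := fun p => ((ρ p : ℝ) : ℂ))
    (hs.comp_contDiff emb_injective (g := fun x : ℝ => (x : ℂ)) Complex.ofRealCLM.contDiff)
    (fun p hp => by rw [(hz p).2 hp, Complex.ofReal_zero])
  refine ⟨min m m₂, lt_min hm hm₂, C + 1, by positivity, fun p => ⟨?_, ?_⟩⟩
  · have h0 := p.bdet_nonneg
    have h4 := p.bdet_le
    rcases lt_or_ge (bdet (p.2 : Mat 𝕜)) (min m (3 / 16)) with hp | hp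
    · have hp1 : bdet (p.2 : Mat 𝕜) ≤ 3 / 16 := (hp.trans_le (min_le_right _ _)).le
      obtain ⟨e1, e2, e3, e4, -⟩ := exitTime_bounds hp1
      have hle : min m m₂ * bdet (p.2 : Mat 𝕜) ≤ m * bdet (p.2 : Mat 𝕜) :=
        mul_le_mul_of_nonneg_right (min_le_left _ _) h0
      refine hle.trans ?_
      rcases h0.eq_or_lt with h0' | h0'
      · rw [← h0', mul_zero]
        exact hnn p
      have e5 : 1 < exitTime p := by linarith
      have hder := fun t (ht : t ∈ Set.Icc 1 (exitTime p)) =>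
        hasDerivWithinAt_ray hs p (fun t ht => ray_conditions hp1 ht) ht
      obtain ⟨t, ht, hslope⟩ := exists_hasDerivAt_eq_slope (fun t => ρ (ray p t))
        (fun t => t⁻¹ • radialDeriv ρ (ray p t)) e5
        (fun t ht => (hder t ht).continuousWithinAt)
        (fun t ht => (hder t ⟨ht.1.le, ht.2.le⟩).hasDerivAt (Icc_mem_nhds ht.1 ht.2))
      have ht' : t ∈ Set.Icc 1 (exitTime p) := ⟨ht.1.le, ht.2.le⟩
      rw [(hz _).2 (ray_exitTime_not_isInterior hp1), ray_one, zero_sub, smul_eq_mul,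
        eq_div_iff (by linarith)] at hslope
      have h6 : m ≤ -radialDeriv ρ (ray p t) := by
        have h7 := hm' (ray p t)
        rcases le_max_iff.1 h7 with h | h
        · have := bdet_ray_le hp1 ht'
          have := hp.trans_le (min_le_left m (3 / 16))
          linarith
        · exact h
      have h8 : 2⁻¹ ≤ t⁻¹ := inv_anti₀ (by linarith [ht.1]) (by linarith [ht.2])
      have h9 : 2⁻¹ * m ≤ t⁻¹ * -radialDeriv ρ (ray p t) :=
        mul_le_mul h8 h6 hm.le (by linarith)
      have h10 : 2⁻¹ * m * (2 * bdet (p.2 : Mat 𝕜)) ≤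
          t⁻¹ * -radialDeriv ρ (ray p t) * (exitTime p - 1) :=
        mul_le_mul h9 e4 (by linarith) (by nlinarith)
      nlinarith
    · have h5 : m₂ ≤ ρ p := by
        rcases le_max_iff.1 (hm₂' p) with h | h
        · exact h
        · linarith
      have : min m m₂ * bdet (p.2 : Mat 𝕜) ≤ m₂ * 1 :=
        mul_le_mul (min_le_right _ _) (by linarith) h0 hm₂.le
      linarith
  · have h1 := hC' p
    rw [Complex.norm_real, Real.norm_of_nonneg (hnn p)] at h1
    nlinarith [p.bdet_nonneg]

end Compactness

/-! ### Invariant operators as b-differential operators -/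

section BOperators

variable {𝕜 : Type*} [RCLike 𝕜]

lemma vecDeriv_invL_comp_toG {u : G 𝕜 → ℂ} (hu : IsSmooth (embG 𝕜) u) {ξ : Mat 𝕜}
    (hξ : ξ.trace = 0) :
    vecDeriv (embInterior 𝕜) (fun p : Interior 𝕜 => invL ξ (emb 𝕜 p.1)) (fun p => u (toG p)) =
      fun p => leftDeriv ξ u (toG p) := by
  funext p
  refine (dirDeriv_comp_toG hu p (invL_mem ξ hξ p.1)).trans ?_
  rw [polarMulDeriv_invL ξ hξ]
  rfl

lemma vecDeriv_invR_comp_toG {u : G 𝕜 → ℂ} (hu : IsSmooth (embG 𝕜) u) {ζ : Mat 𝕜}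
    (hζ : ζ.trace = 0) :
    vecDeriv (embInterior 𝕜) (fun p : Interior 𝕜 => invR ζ (emb 𝕜 p.1)) (fun p => u (toG p)) =
      fun p => rightDeriv ζ u (toG p) := by
  funext p
  refine (dirDeriv_comp_toG hu p (invR_mem ζ hζ p.1)).trans ?_
  rw [polarMulDeriv_invR ζ hζ]
  rfl

/-- A function on `G[1]`, restricted to the interior and transported to `G`. -/
def onG (f : Cpt 𝕜 → ℂ) : G 𝕜 → ℂ := fun g => f (fromG g).1

lemma IsSmooth.onG {f : Cpt 𝕜 → ℂ} (hf : IsSmooth (emb 𝕜) f) : IsSmooth (embG 𝕜) (onG f) :=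
  isSmooth_comp_fromG (isSmooth_restrict hf)

lemma onG_comp_toG (f : Cpt 𝕜 → ℂ) : (fun p => onG f (toG p)) = fun p : Interior 𝕜 => f p.1 := by
  funext p
  rw [onG, fromG_toG]

lemma leftDeriv_onG {f : Cpt 𝕜 → ℂ} (hf : IsSmooth (emb 𝕜) f) {ξ : Mat 𝕜} (hξ : ξ.trace = 0) :
    leftDeriv ξ (onG f) = onG (vecDeriv (emb 𝕜) (fun p => invL ξ (emb 𝕜 p)) f) := by
  funext g
  have h := congrFun (vecDeriv_invL_comp_toG hf.onG hξ) (fromG g)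
  rw [onG_comp_toG, toG_fromG] at h
  rw [← h]
  exact dirDeriv_restrict hf _ (invL_mem ξ hξ _)

lemma rightDeriv_onG {f : Cpt 𝕜 → ℂ} (hf : IsSmooth (emb 𝕜) f) {ζ : Mat 𝕜} (hζ : ζ.trace = 0) :
    rightDeriv ζ (onG f) = onG (vecDeriv (emb 𝕜) (fun p => invR ζ (emb 𝕜 p)) f) := by
  funext g
  have h := congrFun (vecDeriv_invR_comp_toG hf.onG hζ) (fromG g)
  rw [onG_comp_toG, toG_fromG] at h
  rw [← h]
  exact dirDeriv_restrict hf _ (invR_mem ζ hζ _)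

lemma IsSmooth.vecDeriv_emb {F : Type*} [NormedAddCommGroup F] [NormedSpace ℝ F] {f : Cpt 𝕜 → F}
    (hf : IsSmooth (emb 𝕜) f) {V : Cpt 𝕜 → Mat 𝕜 × Mat 𝕜} (hV : V ∈ vectorFields 𝕜) :
    IsSmooth (emb 𝕜) (SL2Cpt.vecDeriv (emb 𝕜) V f) :=
  hf.vecDeriv emb_injective hV.1 fun p => mem_tanSpan_emb (hV.2 p)

/-- Every left-invariant operator on `G` is a b-differential operator on the interior. -/
lemma IsLeftInvariantOp.exists_bDiffOp {D : (G 𝕜 → ℂ) → (G 𝕜 → ℂ)} (hD : IsLeftInvariantOp D) :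
    ∃ P, IsBDiffOp P ∧ ∀ u : G 𝕜 → ℂ, IsSmooth (embG 𝕜) u →
      (fun p => D u (toG p)) = P (fun p => u (toG p)) := by
  induction hD with
  | mul a ha =>
    obtain ⟨c, rfl⟩ := ha
    exact ⟨_, IsDiffOp.mul _ ⟨fun _ => c, isSmooth_const emb_injective c, rfl⟩, fun u _ => rfl⟩
  | vec V hV =>
    obtain ⟨ξ, hξ, rfl⟩ := hV
    exact ⟨_, IsDiffOp.vec _ ⟨_, invL_mem_bVectorFields ξ hξ, rfl⟩,
      fun u hu => (vecDeriv_invL_comp_toG hu hξ).symm⟩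
  | add D D' hD hD' ih ih' =>
    obtain ⟨P, hP, h⟩ := ih
    obtain ⟨P', hP', h'⟩ := ih'
    exact ⟨_, IsDiffOp.add _ _ hP hP', fun u hu => congrArg₂ (· + ·) (h u hu) (h' u hu)⟩
  | comp D D' hD hD' ih ih' =>
    obtain ⟨P, hP, h⟩ := ih
    obtain ⟨P', hP', h'⟩ := ih'
    refine ⟨_, IsDiffOp.comp _ _ hP hP', fun u hu => ?_⟩
    rw [h _ (IsLeftInvariantOp.isSmooth hD' hu), h' u hu]

/-- Every right-invariant operator on `G` is a b-differential operator on the interior. -/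
lemma IsRightInvariantOp.exists_bDiffOp {D : (G 𝕜 → ℂ) → (G 𝕜 → ℂ)}
    (hD : IsRightInvariantOp D) :
    ∃ P, IsBDiffOp P ∧ ∀ u : G 𝕜 → ℂ, IsSmooth (embG 𝕜) u →
      (fun p => D u (toG p)) = P (fun p => u (toG p)) := by
  induction hD with
  | mul a ha =>
    obtain ⟨c, rfl⟩ := ha
    exact ⟨_, IsDiffOp.mul _ ⟨fun _ => c, isSmooth_const emb_injective c, rfl⟩, fun u _ => rfl⟩
  | vec V hV =>
    obtain ⟨ξ, hξ, rfl⟩ := hV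
    exact ⟨_, IsDiffOp.vec _ ⟨_, invR_mem_bVectorFields ξ hξ, rfl⟩,
      fun u hu => (vecDeriv_invR_comp_toG hu hξ).symm⟩
  | add D D' hD hD' ih ih' =>
    obtain ⟨P, hP, h⟩ := ih
    obtain ⟨P', hP', h'⟩ := ih'
    exact ⟨_, IsDiffOp.add _ _ hP hP', fun u hu => congrArg₂ (· + ·) (h u hu) (h' u hu)⟩
  | comp D D' hD hD' ih ih' =>
    obtain ⟨P, hP, h⟩ := ih
    obtain ⟨P', hP', h'⟩ := ih'
    refine ⟨_, IsDiffOp.comp _ _ hP hP', fun u hu => ?_⟩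
    rw [h _ (IsRightInvariantOp.isSmooth hD' hu), h' u hu]

lemma IsSmoothOp.isSmooth {P : (Cpt 𝕜 → ℂ) → (Cpt 𝕜 → ℂ)} (hP : IsSmoothOp P) :
    ∀ {f : Cpt 𝕜 → ℂ}, IsSmooth (emb 𝕜) f → IsSmooth (emb 𝕜) (P f) := by
  induction hP with
  | mul a ha => exact fun hf => IsSmooth.mul emb_injective ha hf
  | vec V hV => exact fun hf => hf.vecDeriv_emb hV
  | add P Q _ _ hP hQ => exact fun hf => (hP hf).add emb_injective (hQ hf)
  | comp P Q _ _ hP hQ => exact fun hf => hP (hQ hf)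

/-- Every left-invariant operator on `G` extends smoothly to `G[1]`. -/
lemma IsLeftInvariantOp.exists_smoothOp {D : (G 𝕜 → ℂ) → (G 𝕜 → ℂ)} (hD : IsLeftInvariantOp D) :
    ∃ P, IsSmoothOp P ∧ ∀ f : Cpt 𝕜 → ℂ, IsSmooth (emb 𝕜) f → D (onG f) = onG (P f) := by
  induction hD with
  | mul a ha =>
    obtain ⟨c, rfl⟩ := ha
    exact ⟨_, IsDiffOp.mul _ (isSmooth_const emb_injective c), fun u _ => rfl⟩
  | vec V hV =>
    obtain ⟨ξ, hξ, rfl⟩ := hV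
    exact ⟨_, IsDiffOp.vec _ (invL_mem_bVectorFields ξ hξ).1, fun u hu => leftDeriv_onG hu hξ⟩
  | add D D' hD hD' ih ih' =>
    obtain ⟨P, hP, h⟩ := ih
    obtain ⟨P', hP', h'⟩ := ih'
    exact ⟨_, IsDiffOp.add _ _ hP hP', fun u hu => congrArg₂ (· + ·) (h u hu) (h' u hu)⟩
  | comp D D' hD hD' ih ih' =>
    obtain ⟨P, hP, h⟩ := ih
    obtain ⟨P', hP', h'⟩ := ih'
    refine ⟨_, IsDiffOp.comp _ _ hP hP', fun u hu => ?_⟩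
    exact (congrArg D (h' u hu)).trans (h _ (IsSmoothOp.isSmooth hP' hu))

/-- Every right-invariant operator on `G` extends smoothly to `G[1]`. -/
lemma IsRightInvariantOp.exists_smoothOp {D : (G 𝕜 → ℂ) → (G 𝕜 → ℂ)}
    (hD : IsRightInvariantOp D) :
    ∃ P, IsSmoothOp P ∧ ∀ f : Cpt 𝕜 → ℂ, IsSmooth (emb 𝕜) f → D (onG f) = onG (P f) := by
  induction hD with
  | mul a ha =>
    obtain ⟨c, rfl⟩ := ha
    exact ⟨_, IsDiffOp.mul _ (isSmooth_const emb_injective c), fun u _ => rfl⟩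
  | vec V hV =>
    obtain ⟨ξ, hξ, rfl⟩ := hV
    exact ⟨_, IsDiffOp.vec _ (invR_mem_bVectorFields ξ hξ).1, fun u hu => rightDeriv_onG hu hξ⟩
  | add D D' hD hD' ih ih' =>
    obtain ⟨P, hP, h⟩ := ih
    obtain ⟨P', hP', h'⟩ := ih'
    exact ⟨_, IsDiffOp.add _ _ hP hP', fun u hu => congrArg₂ (· + ·) (h u hu) (h' u hu)⟩
  | comp D D' hD hD' ih ih' =>
    obtain ⟨P, hP, h⟩ := ih
    obtain ⟨P', hP', h'⟩ := ih'
    refine ⟨_, IsDiffOp.comp _ _ hP hP', fun u hu => ?_⟩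
    exact (congrArg D (h' u hu)).trans (h _ (IsSmoothOp.isSmooth hP' hu))

end BOperators

/-! ### Bounded conormal functions -/

section BoundedConormal

variable {𝕜 : Type*} [RCLike 𝕜]

variable (𝕜) in
/-- The bounded functions on `G`. -/
def bddFunctions : Set (G 𝕜 → ℂ) := {a | ∃ C : ℝ, ∀ g, ‖a g‖ ≤ C}

lemma add_mem_bddFunctions {a b : G 𝕜 → ℂ} (ha : a ∈ bddFunctions 𝕜) (hb : b ∈ bddFunctions 𝕜) :
    a + b ∈ bddFunctions 𝕜 := by
  obtain ⟨C, hC⟩ := ha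
  obtain ⟨C', hC'⟩ := hb
  exact ⟨C + C', fun g => norm_add_le_of_le (hC g) (hC' g)⟩

lemma mul_mem_bddFunctions {a b : G 𝕜 → ℂ} (ha : a ∈ bddFunctions 𝕜) (hb : b ∈ bddFunctions 𝕜) :
    a * b ∈ bddFunctions 𝕜 := by
  obtain ⟨C, hC⟩ := ha
  obtain ⟨C', hC'⟩ := hb
  exact ⟨C * C', fun g => norm_mul_le_of_le (hC g) (hC' g)⟩

lemma onG_mem_bddFunctions {f : Cpt 𝕜 → ℂ} (hf : IsSmooth (emb 𝕜) f) :
    onG f ∈ bddFunctions 𝕜 := by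
  obtain ⟨C, -, hC⟩ := hf.exists_bound
  exact ⟨C, fun g => hC _⟩

/-- Smooth functions on `G[1]` are bounded conormal. -/
lemma onG_mem_conormal {f : Cpt 𝕜 → ℂ} (hf : IsSmooth (emb 𝕜) f) :
    onG f ∈ Conormal (bddFunctions 𝕜) := by
  refine ⟨{u | ∃ f, IsSmooth (emb 𝕜) f ∧ u = onG f}, ?_, ?_, f, hf, rfl⟩
  · rintro _ ⟨f, hf, rfl⟩
    exact onG_mem_bddFunctions hf
  · rintro _ ⟨f, hf, rfl⟩
    exact ⟨hf.onG, fun ξ hξ =>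
      ⟨⟨_, hf.vecDeriv_emb (invL_mem_bVectorFields ξ hξ).1, leftDeriv_onG hf hξ⟩,
        ⟨_, hf.vecDeriv_emb (invR_mem_bVectorFields ξ hξ).1, rightDeriv_onG hf hξ⟩⟩⟩

variable (𝕜) in
/-- The function `det b` on `G[1]`, with complex values. -/
def bdetC : Cpt 𝕜 → ℂ := fun p => ((bdet (p.2 : Mat 𝕜) : ℝ) : ℂ)

lemma isSmooth_ofReal {f : Cpt 𝕜 → ℝ} (hf : IsSmooth (emb 𝕜) f) :
    IsSmooth (emb 𝕜) (fun p => ((f p : ℝ) : ℂ)) :=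
  hf.comp_contDiff emb_injective (g := fun x : ℝ => (x : ℂ)) Complex.ofRealCLM.contDiff

lemma isSmooth_bdetC : IsSmooth (emb 𝕜) (bdetC 𝕜) := isSmooth_ofReal isSmooth_bdet

lemma bdet_fromG_pos (g : G 𝕜) : 0 < bdet ((fromG g).1.2 : Mat 𝕜) :=
  (Cpt.isInterior_iff _).1 (fromG g).2

lemma bdetC_fromG_ne (g : G 𝕜) : onG (bdetC 𝕜) g ≠ 0 :=
  Complex.ofReal_ne_zero.2 (bdet_fromG_pos g).ne'

lemma vecDeriv_bdetC {V : Cpt 𝕜 → Mat 𝕜 × Mat 𝕜} (hV : V ∈ vectorFields 𝕜) (p : Cpt 𝕜) :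
    vecDeriv (emb 𝕜) V (bdetC 𝕜) p =
      ((RCLike.re ((p.2 : Mat 𝕜).adjugate * (V p).2).trace : ℝ) : ℂ) := by
  have h1 : HasFDerivAt (fun z : Mat 𝕜 × Mat 𝕜 => ((bdet z.2 : ℝ) : ℂ))
      (Complex.ofRealCLM.comp ((bdetDeriv (p.2 : Mat 𝕜)).comp
        (ContinuousLinearMap.snd ℝ (Mat 𝕜) (Mat 𝕜)))) (emb 𝕜 p) :=
    HasFDerivAt.comp (g := fun x : ℝ => (x : ℂ)) (f := fun z : Mat 𝕜 × Mat 𝕜 => bdet z.2) (emb 𝕜 p)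
      Complex.ofRealCLM.hasFDerivAt
      (HasFDerivAt.comp (g := bdet) (f := Prod.snd) (emb 𝕜 p) (hasFDerivAt_bdet (p.2 : Mat 𝕜))
        hasFDerivAt_snd)
  refine dirDeriv_eq (h1.hasFDerivWithinAt.congr ?_ ?_) (mem_tanSpan_emb (hV.2 p))
  · rintro _ ⟨q, rfl⟩
    exact extend_self emb_injective _ _
  · exact extend_self emb_injective _ _

/-- The functions on `G` of the form `f / det b` with `f` in a set of functions on `G[1]`. -/
def quotientFunctions (𝓕 : Set (Cpt 𝕜 → ℂ)) : Set (G 𝕜 → ℂ) :=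
  {u | IsSmooth (embG 𝕜) u ∧ ∃ f ∈ 𝓕, u * onG (bdetC 𝕜) = onG f}

lemma div_mem_quotientFunctions {𝓕 : Set (Cpt 𝕜 → ℂ)} {f : Cpt 𝕜 → ℂ} (hf : IsSmooth (emb 𝕜) f)
    (hf' : f ∈ 𝓕) : (fun g => onG f g / onG (bdetC 𝕜) g) ∈ quotientFunctions 𝓕 := by
  refine ⟨?_, f, hf', ?_⟩
  · have h1 : IsSmooth (embG 𝕜) (fun g => (onG (bdetC 𝕜) g)⁻¹) :=
      isSmooth_bdetC.onG.comp_contDiffOn embG_injective (g := fun x : ℂ => x⁻¹) (s := {0}ᶜ)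
        (contDiffOn_inv ℝ) bdetC_fromG_ne
    simpa only [div_eq_mul_inv] using hf.onG.mul embG_injective h1
  · funext g
    exact div_mul_cancel₀ _ (bdetC_fromG_ne g)

/-- The sets of smooth functions on `G[1]` that are preserved by the zeroth and first order
b-differential operators which arise when a quotient by `det b` is differentiated. -/
def IsBInvariant (𝓕 : Set (Cpt 𝕜 → ℂ)) : Prop :=
  ∀ f ∈ 𝓕, IsSmooth (emb 𝕜) f ∧ ∀ V ∈ bVectorFields 𝕜, ∀ e, IsSmooth (emb 𝕜) e →
    (fun p => vecDeriv (emb 𝕜) V f p + -1 * (f p * e p)) ∈ 𝓕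

lemma isSmooth_quotient_deriv {f : Cpt 𝕜 → ℂ} (hf : IsSmooth (emb 𝕜) f)
    {V : Cpt 𝕜 → Mat 𝕜 × Mat 𝕜} (hV : V ∈ bVectorFields 𝕜) {e : Cpt 𝕜 → ℂ}
    (he : IsSmooth (emb 𝕜) e) :
    IsSmooth (emb 𝕜) (fun p => vecDeriv (emb 𝕜) V f p + -1 * (f p * e p)) :=
  (hf.vecDeriv_emb hV.1).add emb_injective ((isSmooth_const emb_injective _).mul emb_injective
    (hf.mul emb_injective he))

lemma isBInvariant_smoothFunctions : IsBInvariant (smoothFunctions 𝕜) :=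
  fun _ hf => ⟨hf, fun _ hV _ he => isSmooth_quotient_deriv hf hV he⟩

variable (𝕜) in
/-- The smooth functions on `G[1]` which vanish on the boundary. -/
def vanishingFunctions : Set (Cpt 𝕜 → ℂ) :=
  {f | IsSmooth (emb 𝕜) f ∧ ∀ p : Cpt 𝕜, ¬ p.IsInterior → f p = 0}

lemma isBInvariant_vanishingFunctions : IsBInvariant (vanishingFunctions 𝕜) := by
  rintro f ⟨hf, hf0⟩
  refine ⟨hf, fun V hV e he => ⟨isSmooth_quotient_deriv hf hV he, fun p hp => ?_⟩⟩
  have h1 : vecDeriv (emb 𝕜) V f p = 0 :=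
    dirDeriv_eq_zero_of_boundary hf hf0 hp (hV.1.2 p) (hV.2 p hp)
  show vecDeriv (emb 𝕜) V f p + -1 * (f p * e p) = 0
  rw [h1, hf0 p hp, zero_mul, mul_zero, add_zero]

/-- A derivation of functions on `G` that is given on `G[1]` by a b-vector field preserves the
quotients `f / det b`: since `V (det b) = e det b`, the quotient rule gives
`(V f - f e) / det b`. -/
lemma derivation_mem_quotientFunctions {𝓕 : Set (Cpt 𝕜 → ℂ)} (h𝓕 : IsBInvariant 𝓕)
    {V : Cpt 𝕜 → Mat 𝕜 × Mat 𝕜} (hV : V ∈ bVectorFields 𝕜)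
    {e : Cpt 𝕜 → ℂ} (he : IsSmooth (emb 𝕜) e)
    (hVe : ∀ p, vecDeriv (emb 𝕜) V (bdetC 𝕜) p = bdetC 𝕜 p * e p)
    {E : (G 𝕜 → ℂ) → (G 𝕜 → ℂ)}
    (hE : ∀ {f : Cpt 𝕜 → ℂ}, IsSmooth (emb 𝕜) f → E (onG f) = onG (vecDeriv (emb 𝕜) V f))
    (hEs : ∀ {u : G 𝕜 → ℂ}, IsSmooth (embG 𝕜) u → IsSmooth (embG 𝕜) (E u))
    (hEm : ∀ {u v : G 𝕜 → ℂ}, IsSmooth (embG 𝕜) u → IsSmooth (embG 𝕜) v →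
      E (u * v) = u * E v + E u * v) {u : G 𝕜 → ℂ} (hu : u ∈ quotientFunctions 𝓕) :
    E u ∈ quotientFunctions 𝓕 := by
  obtain ⟨hus, f, hf, huf⟩ := hu
  refine ⟨hEs hus, _, (h𝓕 f hf).2 V hV e he, ?_⟩
  have h1 := hEm hus isSmooth_bdetC.onG
  rw [huf, hE (h𝓕 f hf).1, hE isSmooth_bdetC] at h1
  funext g
  have h2 := congrFun h1 g
  have h3 := congrFun huf g
  simp only [Pi.add_apply, Pi.mul_apply, onG, hVe] at h2 h3 ⊢
  rw [h2, ← h3]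
  ring

lemma isStable_quotientFunctions {𝓕 : Set (Cpt 𝕜 → ℂ)} (h𝓕 : IsBInvariant 𝓕) :
    IsStable (quotientFunctions 𝓕) := by
  refine fun u hu => ⟨hu.1, fun ξ hξ => ⟨?_, ?_⟩⟩
  · refine derivation_mem_quotientFunctions h𝓕 (invL_mem_bVectorFields ξ hξ)
      (e := fun p => ((RCLike.re (-(ξᴴ * ((p.2 : Mat 𝕜) * p.2) +
        (p.2 : Mat 𝕜) * p.2 * ξ).trace) : ℝ) : ℂ))
      (isSmooth_ofReal (isSmooth_comp_emb emb_injective (g := fun z : Mat 𝕜 × Mat 𝕜 =>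
        RCLike.re (-(ξᴴ * (z.2 * z.2) + z.2 * z.2 * ξ).trace)) (by fun_prop))) (fun p => ?_)
      (fun hf => leftDeriv_onG hf hξ) (fun h => h.leftDeriv hξ)
      (fun hu hv => leftDeriv_mul hu hv hξ) hu
    rw [vecDeriv_bdetC (invL_mem_bVectorFields ξ hξ).1, trace_adjugate_invL ξ hξ, ← mul_neg,
      ← ofReal_bdet p.isHermitian, RCLike.re_ofReal_mul, Complex.ofReal_mul]
    rfl
  · refine derivation_mem_quotientFunctions h𝓕 (invR_mem_bVectorFields ξ hξ)
      (e := fun p => ((RCLike.re (-((p.2 : Mat 𝕜) * (((p.1 : Mat 𝕜)ᴴ * ξ * (p.1 : Mat 𝕜)) +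
        ((p.1 : Mat 𝕜)ᴴ * ξ * (p.1 : Mat 𝕜))ᴴ) * (p.2 : Mat 𝕜)).trace) : ℝ) : ℂ))
      (isSmooth_ofReal (isSmooth_comp_emb emb_injective (g := fun z : Mat 𝕜 × Mat 𝕜 =>
        RCLike.re (-(z.2 * ((z.1ᴴ * ξ * z.1) + (z.1ᴴ * ξ * z.1)ᴴ) * z.2).trace))
          (by fun_prop))) (fun p => ?_)
      (fun hf => rightDeriv_onG hf hξ) (fun h => h.rightDeriv hξ)
      (fun hu hv => rightDeriv_mul hu hv hξ) hu
    rw [vecDeriv_bdetC (invR_mem_bVectorFields ξ hξ).1, trace_adjugate_invR ξ hξ, ← mul_neg,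
      ← ofReal_bdet p.isHermitian, RCLike.re_ofReal_mul, Complex.ofReal_mul]
    rfl

lemma norm_mul_bdet {u : G 𝕜 → ℂ} {f : Cpt 𝕜 → ℂ} (h : u * onG (bdetC 𝕜) = onG f) (g : G 𝕜) :
    ‖u g‖ * bdet ((fromG g).1.2 : Mat 𝕜) = ‖f (fromG g).1‖ := by
  have h2 := congrArg norm (congrFun h g)
  rwa [Pi.mul_apply, norm_mul, onG, bdetC, Complex.norm_real,
    Real.norm_of_nonneg (bdet_fromG_pos g).le] at h2

/-- The quotient by `det b` of a smooth function on `G[1]` vanishing on the boundary is bounded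
conormal. -/
lemma div_bdetC_mem_conormal {f : Cpt 𝕜 → ℂ} (hf : f ∈ vanishingFunctions 𝕜) :
    (fun g => onG f g / onG (bdetC 𝕜) g) ∈ Conormal (bddFunctions 𝕜) := by
  refine ⟨quotientFunctions (vanishingFunctions 𝕜), ?_,
    isStable_quotientFunctions isBInvariant_vanishingFunctions,
    div_mem_quotientFunctions hf.1 hf⟩
  rintro u ⟨hus, f, ⟨hf, hf0⟩, huf⟩
  obtain ⟨C, -, hC⟩ := exists_norm_le_bdet hf hf0
  exact ⟨C, fun g => le_of_mul_le_mul_right ((norm_mul_bdet huf g).le.trans (hC _))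
    (bdet_fromG_pos g)⟩

lemma conormal_sum {B : Set (G 𝕜 → ℂ)} (h0 : (0 : G 𝕜 → ℂ) ∈ Conormal B)
    (ha : ∀ u ∈ B, ∀ v ∈ B, u + v ∈ B) {J : Type*} (s : Finset J) {u : J → G 𝕜 → ℂ}
    (h : ∀ j ∈ s, u j ∈ Conormal B) : ∑ j ∈ s, u j ∈ Conormal B :=
  Finset.sum_induction _ (· ∈ Conormal B) (fun _ _ h1 h2 => conormal_add ha h1 h2) h0 h

/-- A vector field tangent to the boundary acts on functions pulled back from `G` as a combination
of invariant derivatives, with bounded conormal coefficients. -/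
lemma exists_vecDeriv_comp_toG {V : Cpt 𝕜 → Mat 𝕜 × Mat 𝕜} (hV : V ∈ bVectorFields 𝕜) :
    ∃ a b : SlIdx 𝕜 → G 𝕜 → ℂ, (∀ j, a j ∈ Conormal (bddFunctions 𝕜)) ∧
      (∀ j, b j ∈ Conormal (bddFunctions 𝕜)) ∧ ∀ u : G 𝕜 → ℂ, IsSmooth (embG 𝕜) u →
        vecDeriv (embInterior 𝕜) (fun p : Interior 𝕜 => V p.1) (fun p => u (toG p)) =
          fun p => (∑ j, (a j * rightDeriv (slBasis j) u + b j * leftDeriv (slBasis j) u))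
            (toG p) := by
  have hb : IsSmooth (emb 𝕜) (fun p : Cpt 𝕜 => (p.2 : Mat 𝕜)) :=
    isSmooth_comp_emb emb_injective (g := fun z : Mat 𝕜 × Mat 𝕜 => z.2) (by fun_prop)
  have hd : IsSmooth (emb 𝕜) (fun p : Cpt 𝕜 => (1 - 2 * bdet (p.2 : Mat 𝕜))⁻¹) :=
    isSmooth_bdet.comp_contDiffOn emb_injective (g := fun x : ℝ => (1 - 2 * x)⁻¹)
      (s := {x | 1 - 2 * x ≠ 0}) (ContDiffOn.inv (by fun_prop) fun x hx => hx)
      fun p => by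
        have := p.bdet_le
        show 1 - 2 * bdet (p.2 : Mat 𝕜) ≠ 0
        linarith
  have hVs := hV.1.1
  have hV2 : IsSmooth (emb 𝕜) (fun p => (V p).2) :=
    hVs.comp_contDiff emb_injective (g := fun z : Mat 𝕜 × Mat 𝕜 => z.2) (by fun_prop)
  -- The ingredients of the decomposition `polarMulDeriv_eq`, as smooth functions on `G[1]`; the
  -- coefficient that is singular at the boundary is `c / det b`.
  let A : Cpt 𝕜 → Mat 𝕜 := fun p => (1 - 2 * bdet (p.2 : Mat 𝕜))⁻¹ • (V p).2
  let A' : Cpt 𝕜 → Mat 𝕜 := fun p =>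
    (1 - 2 * bdet (p.2 : Mat 𝕜))⁻¹ • ((p.2 : Mat 𝕜) - (1 / 2 : ℝ) • (1 : Mat 𝕜))
  let R : Cpt 𝕜 → Mat 𝕜 := fun p => (V p).1 * (p.1 : Mat 𝕜)ᴴ -
    (p.1 : Mat 𝕜) * ((p.2 : Mat 𝕜) * A p - A p * (p.2 : Mat 𝕜)) * (p.1 : Mat 𝕜)ᴴ
  let c : Cpt 𝕜 → ℂ := fun p => ((RCLike.re ((p.2 : Mat 𝕜) * (V p).2).trace : ℝ) : ℂ)
  have hA : IsSmooth (emb 𝕜) A := hd.smul emb_injective hV2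
  have hA' : IsSmooth (emb 𝕜) A' := hd.smul emb_injective
    (hb.comp_contDiff emb_injective (g := fun x : Mat 𝕜 => x - (1 / 2 : ℝ) • (1 : Mat 𝕜))
      (by fun_prop))
  have hR : IsSmooth (emb 𝕜) R :=
    ((isSmooth_comp_emb emb_injective contDiff_id).prodMk emb_injective
      (hVs.prodMk emb_injective hA)).comp_contDiff emb_injective
      (g := fun w : (Mat 𝕜 × Mat 𝕜) × (Mat 𝕜 × Mat 𝕜) × Mat 𝕜 =>
        w.2.1.1 * w.1.1ᴴ - w.1.1 * (w.1.2 * w.2.2 - w.2.2 * w.1.2) * w.1.1ᴴ) (by fun_prop)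
  have hc : IsSmooth (emb 𝕜) c := isSmooth_ofReal ((hb.mul emb_injective hV2).comp_contDiff
    emb_injective (g := fun x : Mat 𝕜 => RCLike.re x.trace) (by fun_prop))
  have hc0 : ∀ p : Cpt 𝕜, ¬ p.IsInterior → c p = 0 := fun p hp => by
    have h := hV.2 p hp
    rw [trace_adjugate_mul p.trace_eq (hV.1.2 p).2.2, neg_eq_zero] at h
    show ((RCLike.re ((p.2 : Mat 𝕜) * (V p).2).trace : ℝ) : ℂ) = 0
    rw [h, map_zero, Complex.ofReal_zero]
  have hco : ∀ (j : SlIdx 𝕜) {f : Cpt 𝕜 → Mat 𝕜}, IsSmooth (emb 𝕜) f →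
      IsSmooth (emb 𝕜) (fun p => ((slCoord j (f p) : ℝ) : ℂ)) := fun j f hf =>
    isSmooth_ofReal (hf.comp_contDiff emb_injective (slCoord j).contDiff)
  refine ⟨fun j => onG fun p => ((slCoord j (R p) : ℝ) : ℂ),
    fun j => onG (fun p => ((slCoord j (A p) : ℝ) : ℂ)) +
      (fun g => onG c g / onG (bdetC 𝕜) g) * onG (fun p => ((slCoord j (A' p) : ℝ) : ℂ)),
    fun j => onG_mem_conormal (hco j hR), fun j => conormal_add
      (fun _ h _ h' => add_mem_bddFunctions h h') (onG_mem_conormal (hco j hA))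
      (conormal_mul (fun _ h _ h' => mul_mem_bddFunctions h h')
        (fun _ h _ h' => add_mem_bddFunctions h h') (div_bdetC_mem_conormal ⟨hc, hc0⟩)
        (onG_mem_conormal (hco j hA'))), fun u hu => ?_⟩
  funext p
  have hδ : 0 < bdet (p.1.2 : Mat 𝕜) := p.1.isInterior_iff.1 p.2
  set γ : ℝ := RCLike.re ((p.1.2 : Mat 𝕜) * (V p.1).2).trace / bdet (p.1.2 : Mat 𝕜) with hγ
  have hm := half_mem_tangentSpace p.1
  have hAt : (A p.1).trace = 0 := by
    show ((1 - 2 * bdet (p.1.2 : Mat 𝕜))⁻¹ • (V p.1).2).trace = 0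
    rw [Matrix.trace_smul, (hV.1.2 p.1).2.2, smul_zero]
  have hA't : (A' p.1).trace = 0 := by
    show ((1 - 2 * bdet (p.1.2 : Mat 𝕜))⁻¹ •
      ((p.1.2 : Mat 𝕜) - (1 / 2 : ℝ) • (1 : Mat 𝕜))).trace = 0
    rw [Matrix.trace_smul, hm.2.2, smul_zero]
  have hRt : (R p.1).trace = 0 := by
    obtain ⟨X, hX1, hX2, hX3⟩ := (hV.1.2 p.1).1
    show ((V p.1).1 * (p.1.1 : Mat 𝕜)ᴴ - (p.1.1 : Mat 𝕜) *
      ((p.1.2 : Mat 𝕜) * A p.1 - A p.1 * (p.1.2 : Mat 𝕜)) * (p.1.1 : Mat 𝕜)ᴴ).trace = 0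
    rw [hX3, Matrix.trace_sub, Matrix.trace_mul_comm, ← mul_assoc, K.conjTranspose_mul_self,
      one_mul, hX2, Matrix.trace_mul_comm, ← mul_assoc, K.conjTranspose_mul_self, one_mul,
      Matrix.trace_sub, Matrix.trace_mul_comm, sub_self, sub_zero]
  have hηt : (A p.1 + γ • A' p.1).trace = 0 := by
    refine (Matrix.trace_add _ _).trans ?_
    rw [hAt, Matrix.trace_smul, hA't, smul_zero, add_zero]
  refine (dirDeriv_comp_toG hu p (hV.1.2 p.1)).trans ?_
  rw [polarMulDeriv_eq p (hV.1.2 p.1) (k := p.1.1) (b := p.1.2) (A := A p.1)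
    (η := A p.1 + γ • A' p.1) (c := γ) rfl rfl (mul_div_cancel₀ _ hδ.ne').symm rfl rfl,
    dirDeriv_add_vec]
  have e1 : dirDeriv (embG 𝕜) u (toG p) (R p.1 * embG 𝕜 (toG p)) =
      ∑ j, ((slCoord j (R p.1) : ℝ) : ℂ) * rightDeriv (slBasis j) u (toG p) := by
    conv_lhs => rw [eq_sum_slBasis hRt, Finset.sum_mul, dirDeriv_sum_vec]
    refine Finset.sum_congr rfl fun j _ => ?_
    rw [smul_mul_assoc, dirDeriv_smul_vec, Complex.real_smul]
    rfl
  have e2 : dirDeriv (embG 𝕜) u (toG p) (embG 𝕜 (toG p) * (A p.1 + γ • A' p.1)) =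
      ∑ j, ((slCoord j (A p.1 + γ • A' p.1) : ℝ) : ℂ) * leftDeriv (slBasis j) u (toG p) := by
    conv_lhs => rw [eq_sum_slBasis hηt, Finset.mul_sum, dirDeriv_sum_vec]
    refine Finset.sum_congr rfl fun j _ => ?_
    rw [mul_smul_comm, dirDeriv_smul_vec, Complex.real_smul]
    rfl
  refine (congrArg₂ (· + ·) e1 e2).trans ?_
  rw [Finset.sum_apply, ← Finset.sum_add_distrib]
  refine Finset.sum_congr rfl fun j _ => ?_
  simp only [Pi.add_apply, Pi.mul_apply, onG, fromG_toG]
  have e3 : slCoord j (A p.1 + γ • A' p.1) = slCoord j (A p.1) + γ * slCoord j (A' p.1) :=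
    ((slCoord j).map_add _ _).trans (congrArg _ ((slCoord j).map_smul _ _))
  rw [e3, Complex.ofReal_add, Complex.ofReal_mul, hγ, Complex.ofReal_div]
  rfl

/-- The b-differential operators preserve the conormal spaces whose weight is invariant under
multiplication by bounded functions. -/
lemma IsBDiffOp.map_conormal {P : (Interior 𝕜 → ℂ) → (Interior 𝕜 → ℂ)} (hP : IsBDiffOp P)
    {B : Set (G 𝕜 → ℂ)} (ha : ∀ u ∈ B, ∀ v ∈ B, u + v ∈ B)
    (hm : ∀ a ∈ bddFunctions 𝕜, ∀ u ∈ B, a * u ∈ B) :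
    ∀ u ∈ Conormal B, ∃ w ∈ Conormal B, P (fun p => u (toG p)) = fun p => w (toG p) := by
  induction hP with
  | mul a ha' =>
    obtain ⟨f, hf, rfl⟩ := ha'
    intro u hu
    refine ⟨onG f * u, conormal_mul hm ha (onG_mem_conormal hf) hu, ?_⟩
    funext p
    simp only [Pi.mul_apply, onG, fromG_toG]
  | vec V hV =>
    obtain ⟨V, hV, rfl⟩ := hV
    intro u hu
    obtain ⟨a, b, h1, h2, h3⟩ := exists_vecDeriv_comp_toG hV
    have hs := isStable_conormal B u hu
    have h0 : (0 : G 𝕜 → ℂ) ∈ Conormal B := by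
      have := conormal_mul hm ha (onG_mem_conormal (isSmooth_const emb_injective (0 : ℂ))) hu
      have h4 : onG (fun _ : Cpt 𝕜 => (0 : ℂ)) * u = 0 := zero_mul u
      rwa [h4] at this
    refine ⟨_, conormal_sum h0 ha _ fun j _ => conormal_add ha
      (conormal_mul hm ha (h1 j) (hs.2 _ (trace_slBasis j)).2)
      (conormal_mul hm ha (h2 j) (hs.2 _ (trace_slBasis j)).1), h3 u hs.1⟩
  | add P Q _ _ ih ih' =>
    intro u hu
    obtain ⟨w, hw, h⟩ := ih u hu
    obtain ⟨w', hw', h'⟩ := ih' u hu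
    refine ⟨w + w', conormal_add ha hw hw', ?_⟩
    exact congrArg₂ (· + ·) h h'
  | comp P Q _ _ ih ih' =>
    intro u hu
    obtain ⟨w, hw, h⟩ := ih' u hu
    obtain ⟨w', hw', h'⟩ := ih w hw
    exact ⟨w', hw', (congrArg P h).trans h'⟩

end BoundedConormal

end SL2Cpt

-- The topology and the Haar measure of `K` refer to the product topology of matrices, so
-- `matTopologicalSpace` is not an instance in the following part.
namespace SL2Cpt

attribute [local instance] Matrix.frobeniusNormedAddCommGroup Matrix.frobeniusNormedSpace
attribute [local instance] Matrix.frobeniusNormedRing Matrix.frobeniusNormedAlgebra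

/-! ### Bounds for the spherical function -/

section Spherical

open MeasureTheory

variable {𝕜 : Type*} [RCLike 𝕜]

lemma inv_toG (k : K 𝕜) : (((K.toG k)⁻¹ : G 𝕜) : Mat 𝕜) = (k : Mat 𝕜)ᴴ := by
  rw [Matrix.SpecialLinearGroup.coe_inv]
  exact adjugate_of_det k.conjTranspose_mul_self k.det_eq_one

lemma norm_mul_inv_toG (g : G 𝕜) (k : K 𝕜) :
    ‖embG 𝕜 (g * (K.toG k)⁻¹)‖ = ‖embG 𝕜 g‖ := by
  have h : embG 𝕜 (g * (K.toG k)⁻¹) = embG 𝕜 g * (k : Mat 𝕜)ᴴ := by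
    rw [← inv_toG]
    rfl
  rw [← sq_eq_sq₀ (norm_nonneg _) (norm_nonneg _), norm_sq_eq_trace, norm_sq_eq_trace, h,
    Matrix.conjTranspose_mul, Matrix.conjTranspose_conjTranspose, Matrix.trace_mul_comm,
    mul_assoc, ← mul_assoc _ (k : Mat 𝕜) _, K.conjTranspose_mul_self, one_mul,
    Matrix.trace_mul_comm]

lemma iwasawaEntry_sq (g : G 𝕜) : iwasawaEntry g ^ 2 = ‖g.1 0 0‖ ^ 2 + ‖g.1 1 0‖ ^ 2 :=
  Real.sq_sqrt (by positivity)

lemma iwasawaEntry_nonneg (g : G 𝕜) : 0 ≤ iwasawaEntry g := Real.sqrt_nonneg _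

lemma iwasawaEntry_le (g : G 𝕜) : iwasawaEntry g ≤ ‖embG 𝕜 g‖ := by
  rw [← sq_le_sq₀ (iwasawaEntry_nonneg g) (norm_nonneg _), iwasawaEntry_sq, norm_sq_eq]
  have : (embG 𝕜 g) = g.1 := rfl
  rw [this]
  nlinarith [sq_nonneg ‖g.1 0 1‖, sq_nonneg ‖g.1 1 1‖]

lemma one_le_iwasawaEntry_mul (g : G 𝕜) : 1 ≤ iwasawaEntry g * ‖embG 𝕜 g‖ := by
  have h1 : (1 : ℝ) ≤ ‖g.1 0 0‖ * ‖g.1 1 1‖ + ‖g.1 0 1‖ * ‖g.1 1 0‖ := by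
    have h2 := g.2
    rw [Matrix.det_fin_two] at h2
    have h3 := norm_sub_le (g.1 0 0 * g.1 1 1) (g.1 0 1 * g.1 1 0)
    rwa [h2, norm_one, norm_mul, norm_mul] at h3
  have h4 := norm_sq_eq (embG 𝕜 g)
  have h5 : (embG 𝕜 g) = g.1 := rfl
  rw [← one_le_sq_iff₀ (mul_nonneg (iwasawaEntry_nonneg g) (norm_nonneg _)), mul_pow,
    iwasawaEntry_sq, h4, h5]
  nlinarith [sq_nonneg (‖g.1 0 0‖ * ‖g.1 0 1‖ - ‖g.1 1 0‖ * ‖g.1 1 1‖), sq_nonneg ‖g.1 0 0‖,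
    mul_self_nonneg (‖g.1 0 0‖ ^ 2 + ‖g.1 1 0‖ ^ 2)]

lemma iwasawaEntry_pos (g : G 𝕜) : 0 < iwasawaEntry g := by
  refine (iwasawaEntry_nonneg g).lt_of_ne fun h => ?_
  have := one_le_iwasawaEntry_mul g
  rw [← h, zero_mul] at this
  linarith

lemma one_le_norm (g : G 𝕜) : 1 ≤ ‖embG 𝕜 g‖ := by
  have h1 := one_le_iwasawaEntry_mul g
  have h2 := iwasawaEntry_le g
  nlinarith [norm_nonneg (embG 𝕜 g)]

lemma continuous_entry_mul_inv (g : G 𝕜) (i j : Fin 2) :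
    Continuous fun k : K 𝕜 => (g * (K.toG k)⁻¹).1 i j := by
  have h : ∀ k : K 𝕜, (g * (K.toG k)⁻¹).1 i j =
      g.1 i 0 * star ((k : Mat 𝕜) j 0) + g.1 i 1 * star ((k : Mat 𝕜) j 1) := by
    intro k
    have h1 : (g * (K.toG k)⁻¹).1 = g.1 * (k : Mat 𝕜)ᴴ := by
      rw [← inv_toG]
      rfl
    rw [h1, Matrix.mul_apply, Fin.sum_univ_two]
    rfl
  simp only [h]
  have h2 : ∀ i j, Continuous fun k : K 𝕜 => (k : Mat 𝕜) i j := fun i j =>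
    Continuous.matrix_elem continuous_subtype_val i j
  exact (continuous_const.mul (h2 _ _).star).add (continuous_const.mul (h2 _ _).star)

lemma continuous_iwasawaEntry (g : G 𝕜) :
    Continuous fun k : K 𝕜 => iwasawaEntry (g * (K.toG k)⁻¹) :=
  (((continuous_entry_mul_inv g 0 0).norm.pow 2).add
    ((continuous_entry_mul_inv g 1 0).norm.pow 2)).sqrt

/-- In a pair of vectors of total length `n`, the coefficients `z` for which `x + z y` is short form
a set of small diameter. -/
lemma exists_subset_closedBall {E : Type*} [SeminormedAddCommGroup E] [NormedSpace 𝕜 E] {x y : E}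
    {n s : ℝ} (hn : 0 < n) (hs : s < 1 / 5) (h : ‖x‖ ^ 2 + ‖y‖ ^ 2 = n ^ 2) :
    ∃ z₀ : 𝕜, Metric.ball 0 1 ∩ {z | ‖x + z • y‖ ≤ 3 / 2 * s * n} ⊆
      Metric.closedBall z₀ (6 * s) := by
  rcases Set.eq_empty_or_nonempty
    (Metric.ball (0 : 𝕜) 1 ∩ {z | ‖x + z • y‖ ≤ 3 / 2 * s * n}) with h0 | ⟨z₀, hz₀, hz₀'⟩
  · exact ⟨0, by rw [h0]; exact Set.empty_subset _⟩
  have hy0 := norm_nonneg y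
  have hx0 := norm_nonneg x
  have hy : n / 2 ≤ ‖y‖ := by
    by_contra! hlt
    have h1 : 4 / 5 * n ≤ ‖x‖ := by
      by_contra! h2
      nlinarith
    have h3 : ‖x‖ ≤ ‖x + z₀ • y‖ + ‖z₀ • y‖ := by
      have := norm_sub_le (x + z₀ • y) (z₀ • y)
      rwa [add_sub_cancel_right] at this
    have h4 : ‖z₀ • y‖ ≤ 1 * ‖y‖ := by
      rw [norm_smul]
      exact mul_le_mul_of_nonneg_right (mem_ball_zero_iff.1 hz₀).le hy0
    have h5 : ‖x + z₀ • y‖ ≤ 3 / 2 * s * n := hz₀'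
    nlinarith
  refine ⟨z₀, fun z hz => ?_⟩
  rw [Metric.mem_closedBall, dist_eq_norm]
  have h1 : ‖x + z • y‖ ≤ 3 / 2 * s * n := hz.2
  have h2 : ‖x + z₀ • y‖ ≤ 3 / 2 * s * n := hz₀'
  have h3 : ‖z - z₀‖ * ‖y‖ ≤ ‖x + z • y‖ + ‖x + z₀ • y‖ := by
    rw [← norm_smul, sub_smul, ← add_sub_add_left_eq_sub (z • y) (z₀ • y) x]
    exact norm_sub_le _ _
  have h4 : ‖z - z₀‖ * (n / 2) ≤ ‖z - z₀‖ * ‖y‖ := mul_le_mul_of_nonneg_left hy (norm_nonneg _)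
  have h5 : ‖z - z₀‖ * n ≤ 6 * s * n := by linarith
  exact le_of_mul_le_mul_right h5 hn

/-- An element of `K` whose inverse maps the first basis vector to the direction of `(1, z)`. -/
def rotation (z : 𝕜) : K 𝕜 :=
  ⟨((√(1 + ‖z‖ ^ 2))⁻¹ : ℝ) • !![1, star z; -z, 1], by
    have h0 : (0 : ℝ) < 1 + ‖z‖ ^ 2 := by positivity
    have h1 : (√(1 + ‖z‖ ^ 2))⁻¹ * (√(1 + ‖z‖ ^ 2))⁻¹ * (1 + ‖z‖ ^ 2) = 1 := by
      rw [← mul_inv, Real.mul_self_sqrt h0.le, inv_mul_cancel₀ h0.ne']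
    have h2 : z * star z = ((‖z‖ ^ 2 : ℝ) : 𝕜) := by
      rw [RCLike.star_def, RCLike.mul_conj, RCLike.ofReal_pow]
    have h3 : ((1 + ‖z‖ ^ 2 : ℝ) : 𝕜) = 1 + z * star z := by
      rw [h2, RCLike.ofReal_add, RCLike.ofReal_one]
    have h4 : !![1, star z; -z, 1] * (!![1, star z; -z, 1])ᴴ =
        (1 + z * star z) • (1 : Mat 𝕜) := by
      ext i j
      fin_cases i <;> fin_cases j <;>
        simp [Matrix.mul_apply, Fin.sum_univ_two, Matrix.conjTranspose_apply] <;> ring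
    rw [mem_K_iff]
    constructor
    · rw [Matrix.conjTranspose_smul, star_trivial ((√(1 + ‖z‖ ^ 2))⁻¹), smul_mul_smul_comm, h4, ← h3,
        ← RCLike.real_smul_eq_coe_smul (K := 𝕜), smul_smul, h1, one_smul]
    · rw [real_smul_eq, Matrix.det_smul, Fintype.card_fin, Matrix.det_fin_two_of, mul_neg, mul_one,
        sub_neg_eq_add, mul_comm (star z), ← h3, pow_two, ← RCLike.ofReal_mul,
        ← RCLike.ofReal_mul, h1, RCLike.ofReal_one]⟩

/-- The squared length of the combination of the two columns of `h` with coefficients `1` and `z`. -/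
def columnSq (h : Mat 𝕜) (z : 𝕜) : ℝ := ‖h 0 0 + z * h 0 1‖ ^ 2 + ‖h 1 0 + z * h 1 1‖ ^ 2

lemma columnSq_le_of_rotation (g : G 𝕜) (k : K 𝕜) {z : 𝕜} (hz : ‖z‖ ≤ 1) :
    columnSq (g * (K.toG k)⁻¹).1 z ≤ 2 * iwasawaEntry (g * (K.toG (rotation z * k))⁻¹) ^ 2 := by
  set c : ℝ := (√(1 + ‖z‖ ^ 2))⁻¹ with hc
  have h0 : (0 : ℝ) < 1 + ‖z‖ ^ 2 := by positivity
  have h1 : ∀ i, (g * (K.toG (rotation z * k))⁻¹).1 i 0 =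
      (c : 𝕜) * ((g * (K.toG k)⁻¹).1 i 0 + z * (g * (K.toG k)⁻¹).1 i 1) := by
    intro i
    have h2 : (K.toG (rotation z * k)) = K.toG (rotation z) * K.toG k := rfl
    have h3 : (g * (K.toG (rotation z * k))⁻¹).1 =
        (g * (K.toG k)⁻¹).1 * ((rotation z : K 𝕜) : Mat 𝕜)ᴴ := by
      rw [h2, mul_inv_rev, ← mul_assoc, ← inv_toG]
      rfl
    rw [h3, Matrix.mul_apply, Fin.sum_univ_two, Matrix.conjTranspose_apply,
      Matrix.conjTranspose_apply]
    show _ * star ((c • !![1, star z; -z, 1] : Mat 𝕜) 0 0) +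
      _ * star ((c • !![1, star z; -z, 1] : Mat 𝕜) 0 1) = _
    simp [RCLike.real_smul_eq_coe_mul]
    ring
  have h2 : c ^ 2 * (1 + ‖z‖ ^ 2) = 1 := by
    rw [hc, inv_pow, Real.sq_sqrt h0.le, inv_mul_cancel₀ h0.ne']
  have h3 : 1 ≤ 2 * c ^ 2 := by nlinarith [norm_nonneg z, sq_nonneg c]
  rw [iwasawaEntry_sq, h1, h1, norm_mul, norm_mul, RCLike.norm_ofReal, mul_pow, mul_pow, sq_abs,
    ← mul_add, ← mul_assoc]
  exact le_mul_of_one_le_left (add_nonneg (sq_nonneg _) (sq_nonneg _)) h3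

/-- The set of `k` for which the first column of `g k⁻¹` is short has small measure: by invariance,
the first basis vector may be replaced by any other unit vector, hence by an average. -/
lemma haar_iwasawaEntry_le (g : G 𝕜) {s : ℝ} (hs : 0 < s) :
    (Measure.haar : Measure (K 𝕜)).real {k | iwasawaEntry (g * (K.toG k)⁻¹) ≤ s * ‖embG 𝕜 g‖} ≤
      (6 * s) ^ Module.finrank ℝ 𝕜 * (Measure.haar : Measure (K 𝕜)).real Set.univ := by
  set μ : Measure (K 𝕜) := Measure.haar with hμ
  set n : ℝ := ‖embG 𝕜 g‖ with hn
  have hn0 : 0 < n := one_pos.trans_le (one_le_norm g)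
  set A : Set (K 𝕜) := {k | iwasawaEntry (g * (K.toG k)⁻¹) ≤ s * n} with hA
  -- For `s ≥ 1 / 5` the bound is trivial; for smaller `s` the set of admissible `z` is small by
  -- `exists_subset_closedBall`.
  rcases le_or_gt (1 / 5) s with hs5 | hs5
  · calc μ.real A ≤ 1 * μ.real Set.univ := by
          rw [one_mul]
          exact measureReal_mono (Set.subset_univ _)
      _ ≤ _ := mul_le_mul_of_nonneg_right (one_le_pow₀ (by linarith)) measureReal_nonneg
  let _ : MeasurableSpace 𝕜 := borel 𝕜
  have : BorelSpace 𝕜 := ⟨rfl⟩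
  have : ProperSpace 𝕜 := FiniteDimensional.proper ℝ 𝕜
  let ν : Measure 𝕜 := Measure.addHaar
  let T : Set (K 𝕜 × 𝕜) := {x | columnSq (g * (K.toG x.1)⁻¹).1 x.2 ≤ (3 / 2 * s * n) ^ 2}
  have hTm : MeasurableSet T := by
    have hc : ∀ i j, Continuous fun x : K 𝕜 × 𝕜 => (g * (K.toG x.1)⁻¹).1 i j := fun i j =>
      (continuous_entry_mul_inv g i j).comp continuous_fst
    refine IsClosed.measurableSet (isClosed_le ?_ continuous_const)
    exact (((hc 0 0).add (continuous_snd.mul (hc 0 1))).norm.pow 2).add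
      (((hc 1 0).add (continuous_snd.mul (hc 1 1))).norm.pow 2)
  have h1 : ∀ z ∈ Metric.ball (0 : 𝕜) 1, μ A ≤ μ ((fun k => (k, z)) ⁻¹' T) := by
    intro z hz
    rw [← measure_preimage_mul μ (rotation z) A]
    refine measure_mono fun k hk => ?_
    have h2 : iwasawaEntry (g * (K.toG (rotation z * k))⁻¹) ≤ s * n := hk
    have h3 := columnSq_le_of_rotation g k (mem_ball_zero_iff.1 hz).le
    have h4 : iwasawaEntry (g * (K.toG (rotation z * k))⁻¹) ^ 2 ≤ (s * n) ^ 2 :=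
      pow_le_pow_left₀ (iwasawaEntry_nonneg _) h2 2
    show columnSq (g * (K.toG k)⁻¹).1 z ≤ (3 / 2 * s * n) ^ 2
    nlinarith [sq_nonneg (s * n)]
  have h2 : ∀ k : K 𝕜, ν.restrict (Metric.ball 0 1) (Prod.mk k ⁻¹' T) ≤
      ENNReal.ofReal ((6 * s) ^ Module.finrank ℝ 𝕜) * ν (Metric.ball 0 1) := by
    intro k
    set h : Mat 𝕜 := (g * (K.toG k)⁻¹).1 with hh
    let x : EuclideanSpace 𝕜 (Fin 2) := !₂[h 0 0, h 1 0]
    let y : EuclideanSpace 𝕜 (Fin 2) := !₂[h 0 1, h 1 1]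
    have hxy : ‖x‖ ^ 2 + ‖y‖ ^ 2 = n ^ 2 := by
      rw [EuclideanSpace.norm_sq_eq, EuclideanSpace.norm_sq_eq, Fin.sum_univ_two, Fin.sum_univ_two,
        hn, ← norm_mul_inv_toG g k, norm_sq_eq]
      show ‖h 0 0‖ ^ 2 + ‖h 1 0‖ ^ 2 + (‖h 0 1‖ ^ 2 + ‖h 1 1‖ ^ 2) =
        ‖h 0 0‖ ^ 2 + ‖h 0 1‖ ^ 2 + (‖h 1 0‖ ^ 2 + ‖h 1 1‖ ^ 2)
      ring
    obtain ⟨z₀, hz₀⟩ := exists_subset_closedBall (𝕜 := 𝕜) hn0 hs5 hxy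
    rw [← Measure.addHaar_closedBall ν z₀ (by positivity),
      Measure.restrict_apply (measurable_prodMk_left hTm)]
    refine measure_mono fun z hz => hz₀ ⟨hz.2, ?_⟩
    have h3 : columnSq h z ≤ (3 / 2 * s * n) ^ 2 := hz.1
    show ‖x + z • y‖ ≤ 3 / 2 * s * n
    rw [← sq_le_sq₀ (norm_nonneg _) (by positivity), EuclideanSpace.norm_sq_eq, Fin.sum_univ_two]
    exact h3
  -- Integrate over `z` and exchange the order of integration.
  have h3 : ν (Metric.ball 0 1) * μ A ≤
      ν (Metric.ball 0 1) * (ENNReal.ofReal ((6 * s) ^ Module.finrank ℝ 𝕜) * μ Set.univ) := by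
    calc ν (Metric.ball 0 1) * μ A = ∫⁻ _ in Metric.ball (0 : 𝕜) 1, μ A ∂ν := by
          rw [setLIntegral_const, mul_comm]
      _ ≤ ∫⁻ z in Metric.ball (0 : 𝕜) 1, μ ((fun k => (k, z)) ⁻¹' T) ∂ν :=
          setLIntegral_mono' measurableSet_ball h1
      _ = (μ.prod (ν.restrict (Metric.ball 0 1))) T := (Measure.prod_apply_symm hTm).symm
      _ = ∫⁻ k, ν.restrict (Metric.ball 0 1) (Prod.mk k ⁻¹' T) ∂μ := Measure.prod_apply hTm
      _ ≤ ∫⁻ _, ENNReal.ofReal ((6 * s) ^ Module.finrank ℝ 𝕜) * ν (Metric.ball 0 1) ∂μ :=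
          lintegral_mono h2
      _ = _ := by
          rw [lintegral_const]
          ring
  have h4 : μ A ≤ ENNReal.ofReal ((6 * s) ^ Module.finrank ℝ 𝕜) * μ Set.univ :=
    (ENNReal.mul_le_mul_iff_right (Metric.measure_ball_pos ν 0 one_pos).ne'
      measure_ball_lt_top.ne).1 h3
  have h5 := ENNReal.toReal_mono (ENNReal.mul_ne_top ENNReal.ofReal_ne_top (measure_ne_top μ _)) h4
  rwa [ENNReal.toReal_mul, ENNReal.toReal_ofReal (by positivity)] at h5

lemma sphericalFunction_eq (g : G 𝕜) : sphericalFunction g =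
    ((Measure.haar : Measure (K 𝕜)).real Set.univ)⁻¹ *
      ∫ k : K 𝕜, (iwasawaEntry (g * (K.toG k)⁻¹) ^ Module.finrank ℝ 𝕜)⁻¹ ∂Measure.haar := by
  rw [sphericalFunction, average_eq, smul_eq_mul]
  congr 1
  refine integral_congr_ae (Filter.Eventually.of_forall fun k => ?_)
  exact (Real.rpow_neg (iwasawaEntry_nonneg _) _).trans (by rw [Real.rpow_natCast])

lemma haar_real_pos : 0 < (Measure.haar : Measure (K 𝕜)).real Set.univ :=
  ENNReal.toReal_pos (Measure.measure_univ_pos.2 (NeZero.ne _)).ne' (measure_ne_top _ _)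

lemma integrable_iwasawaEntry (g : G 𝕜) :
    Integrable (fun k : K 𝕜 => (iwasawaEntry (g * (K.toG k)⁻¹) ^ Module.finrank ℝ 𝕜)⁻¹)
      Measure.haar := by
  refine Continuous.integrable_of_hasCompactSupport ?_ (HasCompactSupport.of_compactSpace _)
  exact ((continuous_iwasawaEntry g).pow _).inv₀ fun k => (pow_pos (iwasawaEntry_pos _) _).ne'

/-- The lower bound for the spherical function. -/
lemma le_sphericalFunction (g : G 𝕜) :
    (‖embG 𝕜 g‖ ^ Module.finrank ℝ 𝕜)⁻¹ ≤ sphericalFunction g := by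
  rw [sphericalFunction_eq, inv_mul_eq_div, le_div_iff₀ haar_real_pos, mul_comm]
  rw [← smul_eq_mul, ← integral_const]
  refine integral_mono (integrable_const _) (integrable_iwasawaEntry g) fun k => ?_
  refine inv_anti₀ (pow_pos (iwasawaEntry_pos _) _) (pow_le_pow_left₀ (iwasawaEntry_nonneg _) ?_ _)
  exact (iwasawaEntry_le _).trans (norm_mul_inv_toG g k).le

lemma sphericalFunction_pos (g : G 𝕜) : 0 < sphericalFunction g :=
  (inv_pos.2 (pow_pos (one_pos.trans_le (one_le_norm g)) _)).trans_le (le_sphericalFunction g)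

/-- The upper bound for the spherical function: the sets where the first column of `g k⁻¹` has length
comparable to `2⁻ʲ ‖g‖` contribute equally, and there are about `log ‖g‖` of them. -/
lemma sphericalFunction_le (g : G 𝕜) : sphericalFunction g ≤
    4 * 12 ^ Module.finrank ℝ 𝕜 *
      ((‖embG 𝕜 g‖ ^ Module.finrank ℝ 𝕜)⁻¹ * (1 + Real.log ‖embG 𝕜 g‖)) := by
  set d := Module.finrank ℝ 𝕜 with hd
  set n : ℝ := ‖embG 𝕜 g‖ with hn
  set μ : Measure (K 𝕜) := Measure.haar with hμ
  have hn1 : 1 ≤ n := one_le_norm g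
  have hn0 : 0 < n := one_pos.trans_le hn1
  -- Since `1 / n ≤ r ≤ n`, the quotient `n / r` lies between `1` and `n²`, which bounds the number of
  -- dyadic shells.
  obtain ⟨J, hJ1, hJ2⟩ := exists_nat_pow_near (one_le_pow₀ hn1 : 1 ≤ n ^ 2) (one_lt_two : (1 : ℝ) < 2)
  have hJ : (J : ℝ) + 1 ≤ 4 * (1 + Real.log n) := by
    have h1 := Real.log_le_log (by positivity) hJ1
    rw [Real.log_pow, Real.log_pow] at h1
    have h2 := Real.log_two_gt_d9
    have h3 : (J : ℝ) * (1 / 2) ≤ J * Real.log 2 :=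
      mul_le_mul_of_nonneg_left (by linarith) (Nat.cast_nonneg J)
    push_cast at h1
    linarith
  let A : ℕ → Set (K 𝕜) := fun j => {k | iwasawaEntry (g * (K.toG k)⁻¹) ≤ (2 ^ j)⁻¹ * n}
  have hAm : ∀ j, MeasurableSet (A j) := fun j =>
    (isClosed_le (continuous_iwasawaEntry g) continuous_const).measurableSet
  have hpt : ∀ k : K 𝕜, (iwasawaEntry (g * (K.toG k)⁻¹) ^ d)⁻¹ ≤
      ∑ j ∈ Finset.range (J + 1), (A j).indicator (fun _ => (2 ^ (j + 1) / n) ^ d) k := by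
    intro k
    set r := iwasawaEntry (g * (K.toG k)⁻¹) with hr
    have hr0 : 0 < r := iwasawaEntry_pos _
    have hrn : r ≤ n := (iwasawaEntry_le _).trans (norm_mul_inv_toG g k).le
    have hr1 : 1 ≤ r * n := by
      have := one_le_iwasawaEntry_mul (g * (K.toG k)⁻¹)
      rwa [norm_mul_inv_toG] at this
    obtain ⟨j, hj1, hj2⟩ := exists_nat_pow_near ((one_le_div hr0).2 hrn) (one_lt_two : (1 : ℝ) < 2)
    have hjJ : j < J + 1 := by
      rw [← pow_lt_pow_iff_right₀ (one_lt_two : (1 : ℝ) < 2)]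
      refine hj1.trans_lt (lt_of_le_of_lt ?_ hJ2)
      rw [div_le_iff₀ hr0]
      nlinarith
    have hkA : k ∈ A j := by
      show r ≤ (2 ^ j)⁻¹ * n
      rw [le_div_iff₀ hr0] at hj1
      rw [inv_mul_eq_div, le_div_iff₀ (by positivity)]
      linarith
    refine le_trans ?_ (Finset.single_le_sum (f := fun j =>
      (A j).indicator (fun _ => ((2 : ℝ) ^ (j + 1) / n) ^ d) k) (fun i _ =>
        Set.indicator_nonneg (fun _ _ => by positivity) _) (Finset.mem_range.2 hjJ))
    rw [Set.indicator_of_mem hkA, ← inv_pow]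
    refine pow_le_pow_left₀ (by positivity) ?_ _
    rw [div_lt_iff₀ hr0] at hj2
    rw [inv_le_iff_one_le_mul₀ hr0, div_mul_eq_mul_div, one_le_div hn0]
    linarith
  have hi : ∀ j, Integrable ((A j).indicator (fun _ => ((2 : ℝ) ^ (j + 1) / n) ^ d)) μ := fun j =>
    (integrable_const _).indicator (hAm j)
  have hint : ∫ k : K 𝕜, (iwasawaEntry (g * (K.toG k)⁻¹) ^ d)⁻¹ ∂μ ≤
      (J + 1) * (12 ^ d * (n ^ d)⁻¹ * μ.real Set.univ) := by
    refine (integral_mono (integrable_iwasawaEntry g)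
      (integrable_finsetSum _ fun j _ => hi j) hpt).trans ?_
    rw [integral_finsetSum _ fun j _ => hi j]
    have h1 : ∀ j ∈ Finset.range (J + 1), ∫ k, (A j).indicator
        (fun _ => ((2 : ℝ) ^ (j + 1) / n) ^ d) k ∂μ ≤ 12 ^ d * (n ^ d)⁻¹ * μ.real Set.univ := by
      intro j _
      rw [integral_indicator_const _ (hAm j), smul_eq_mul, mul_comm]
      have h2 := haar_iwasawaEntry_le g (s := (2 ^ j)⁻¹) (by positivity)
      refine (mul_le_mul_of_nonneg_left h2 (by positivity)).trans (le_of_eq ?_)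
      have h3 : (2 : ℝ) ^ (j + 1) / n * (6 * (2 ^ j)⁻¹) = 12 * n⁻¹ := by
        field_simp
        ring
      rw [← mul_assoc, ← mul_pow, ← inv_pow n, ← mul_pow, h3]
    refine (Finset.sum_le_card_nsmul _ _ _ h1).trans (le_of_eq ?_)
    rw [Finset.card_range, nsmul_eq_mul, Nat.cast_add, Nat.cast_one]
  rw [sphericalFunction_eq, inv_mul_eq_div, div_le_iff₀ haar_real_pos]
  refine hint.trans ?_
  have h5 : 0 ≤ 12 ^ d * (n ^ d)⁻¹ * μ.real Set.univ := by positivity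
  calc (J + 1) * (12 ^ d * (n ^ d)⁻¹ * μ.real Set.univ) ≤
        4 * (1 + Real.log n) * (12 ^ d * (n ^ d)⁻¹ * μ.real Set.univ) :=
      mul_le_mul_of_nonneg_right hJ h5
    _ = _ := by ring

end Spherical

attribute [local instance] matTopologicalSpace

/-! ### Flat functions are rapidly decreasing -/

section Flat

variable {𝕜 : Type*} [RCLike 𝕜]

lemma IsSmoothOp.map_flat {P : (Cpt 𝕜 → ℂ) → (Cpt 𝕜 → ℂ)} (hP : IsSmoothOp P) {f : Cpt 𝕜 → ℂ}
    (hf : f ∈ flatFunctions 𝕜) : P f ∈ flatFunctions 𝕜 :=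
  ⟨hP.isSmooth hf.1, fun _ hQ => hf.2 _ (IsDiffOp.comp _ _ hQ hP)⟩

lemma flat_eq_zero {f : Cpt 𝕜 → ℂ} (hf : f ∈ flatFunctions 𝕜) {p : Cpt 𝕜} (hp : ¬ p.IsInterior) :
    f p = 0 := by
  have h := hf.2 _ (IsDiffOp.mul _ (isSmooth_const emb_injective (1 : ℂ))) p hp
  rwa [Pi.mul_apply, one_mul] at h

/-- A function vanishing to infinite order at the boundary is bounded by all powers of `det b`: its
radial derivative is again such a function, and integrating along rays gains one power. -/
lemma flat_norm_le (n : ℕ) : ∀ {f : Cpt 𝕜 → ℂ}, f ∈ flatFunctions 𝕜 →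
    ∃ C, 0 ≤ C ∧ ∀ p, ‖f p‖ ≤ C * bdet (p.2 : Mat 𝕜) ^ n := by
  induction n with
  | zero =>
    intro f hf
    obtain ⟨C, hC, h⟩ := hf.1.exists_bound
    exact ⟨C, hC, fun p => by rw [pow_zero, mul_one]; exact h p⟩
  | succ n ih =>
    intro f hf
    obtain ⟨C₁, hC₁, h1⟩ := hf.1.exists_bound
    obtain ⟨C₂, hC₂, h2⟩ := ih (IsSmoothOp.map_flat (IsDiffOp.vec _ radial_mem) hf)
    refine ⟨6 * C₂ + C₁ * (16 / 3) ^ (n + 1), by positivity, fun p => ?_⟩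
    have h0 := p.bdet_nonneg
    have e1 : 0 ≤ 6 * C₂ * bdet (p.2 : Mat 𝕜) ^ (n + 1) := by positivity
    have e2 : 0 ≤ C₁ * (16 / 3) ^ (n + 1) * bdet (p.2 : Mat 𝕜) ^ (n + 1) := by positivity
    rw [add_mul]
    rcases le_total (bdet (p.2 : Mat 𝕜)) (3 / 16) with hp | hp
    · have h3 := norm_le_of_radialDeriv hf.1 (fun q hq => flat_eq_zero hf hq) hp
        (M := C₂ * bdet (p.2 : Mat 𝕜) ^ n) fun q hq => (h2 q).trans
          (mul_le_mul_of_nonneg_left (pow_le_pow_left₀ q.bdet_nonneg hq n) hC₂)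
      have e3 : C₂ * bdet (p.2 : Mat 𝕜) ^ n * (6 * bdet (p.2 : Mat 𝕜)) =
          6 * C₂ * bdet (p.2 : Mat 𝕜) ^ (n + 1) := by ring
      linarith
    · have h3 : 1 ≤ (16 / 3 * bdet (p.2 : Mat 𝕜)) ^ (n + 1) := one_le_pow₀ (by linarith)
      have h4 : C₁ * 1 ≤ C₁ * (16 / 3 * bdet (p.2 : Mat 𝕜)) ^ (n + 1) :=
        mul_le_mul_of_nonneg_left h3 hC₁
      rw [mul_pow, ← mul_assoc] at h4
      linarith [h1 p]

lemma bdet_fromG (g : G 𝕜) : bdet ((fromG g).1.2 : Mat 𝕜) = (polarSq (embG 𝕜 g))⁻¹ :=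
  bdet_polarDecomp g

lemma onG_mem_schwartzSpace {f : Cpt 𝕜 → ℂ} (hf : f ∈ flatFunctions 𝕜) :
    onG f ∈ schwartzSpace 𝕜 := by
  refine ⟨hf.1.onG, fun N D₁ D₂ hD₁ hD₂ => ?_⟩
  obtain ⟨P₁, hP₁, h1⟩ := hD₁.exists_smoothOp
  obtain ⟨P₂, hP₂, h2⟩ := hD₂.exists_smoothOp
  have hP := hP₁.map_flat (hP₂.map_flat hf)
  rw [h2 f hf.1, h1 _ (hP₂.isSmooth hf.1)]
  obtain ⟨n, hn⟩ := exists_nat_ge N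
  obtain ⟨C, hC, h⟩ := flat_norm_le n hP
  refine ⟨C, fun g => ?_⟩
  have hg := one_le_norm g
  have hq := polarSq_pos (embG 𝕜 g)
  have e1 : ‖embG 𝕜 g‖ ^ N ≤ polarSq (embG 𝕜 g) ^ n := by
    calc ‖embG 𝕜 g‖ ^ N ≤ ‖embG 𝕜 g‖ ^ (n : ℝ) := Real.rpow_le_rpow_of_exponent_le hg hn
      _ = ‖embG 𝕜 g‖ ^ n := Real.rpow_natCast _ _
      _ ≤ _ := pow_le_pow_left₀ (norm_nonneg _) (by rw [polarSq_eq]; nlinarith) n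
  have e2 := h (fromG g).1
  rw [bdet_fromG, inv_pow] at e2
  calc ‖embG 𝕜 g‖ ^ N * ‖onG (P₁ (P₂ f)) g‖
      ≤ polarSq (embG 𝕜 g) ^ n * (C * (polarSq (embG 𝕜 g) ^ n)⁻¹) :=
        mul_le_mul e1 e2 (norm_nonneg _) (by positivity)
    _ = C := by
        rw [mul_comm, mul_assoc, inv_mul_cancel₀ (pow_pos hq n).ne', mul_one]

end Flat

/-! ### Rapidly decreasing functions extend smoothly by zero -/

section Extension

variable {𝕜 : Type*} [RCLike 𝕜]

variable (𝕜) in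
/-- The functions on `G` which decrease faster than all powers of the norm. -/
def rapidFunctions : Set (G 𝕜 → ℂ) :=
  {v | ∀ n : ℕ, ∃ C : ℝ, ∀ g, polarSq (embG 𝕜 g) ^ n * ‖v g‖ ≤ C}

lemma add_mem_rapidFunctions {u v : G 𝕜 → ℂ} (hu : u ∈ rapidFunctions 𝕜)
    (hv : v ∈ rapidFunctions 𝕜) : u + v ∈ rapidFunctions 𝕜 := by
  intro n
  obtain ⟨C, hC⟩ := hu n
  obtain ⟨C', hC'⟩ := hv n
  refine ⟨C + C', fun g => ?_⟩
  have h0 := polarSq_pos (embG 𝕜 g)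
  calc polarSq (embG 𝕜 g) ^ n * ‖u g + v g‖ ≤ polarSq (embG 𝕜 g) ^ n * (‖u g‖ + ‖v g‖) :=
        mul_le_mul_of_nonneg_left (norm_add_le _ _) (by positivity)
    _ ≤ _ := by rw [mul_add]; exact add_le_add (hC g) (hC' g)

lemma schwartz_mem_conormal {u : G 𝕜 → ℂ} (hu : u ∈ schwartzSpace 𝕜) :
    u ∈ Conormal (rapidFunctions 𝕜) := by
  refine mem_conormal_of_ops hu.1 fun D₁ D₂ hD₁ hD₂ n => ?_
  obtain ⟨C, hC⟩ := hu.2 (2 * n : ℕ) D₁ D₂ hD₁ hD₂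
  refine ⟨3 ^ n * C, fun g => ?_⟩
  have hg := one_le_norm g
  -- `‖g‖ ≥ 1` gives `‖g‖² + 2 ≤ 3 ‖g‖²`.
  have h1 : polarSq (embG 𝕜 g) ^ n ≤ 3 ^ n * ‖embG 𝕜 g‖ ^ ((2 * n : ℕ) : ℝ) := by
    rw [Real.rpow_natCast, pow_mul, ← mul_pow]
    exact pow_le_pow_left₀ (polarSq_pos _).le (by rw [polarSq_eq]; nlinarith) n
  calc polarSq (embG 𝕜 g) ^ n * ‖D₁ (D₂ u) g‖
      ≤ 3 ^ n * ‖embG 𝕜 g‖ ^ ((2 * n : ℕ) : ℝ) * ‖D₁ (D₂ u) g‖ :=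
        mul_le_mul_of_nonneg_right h1 (norm_nonneg _)
    _ ≤ _ := by
        rw [mul_assoc]
        exact mul_le_mul_of_nonneg_left (hC g) (by positivity)

variable (𝕜) in
/-- The function `(det b)⁻¹ = ‖g‖² + 2` on `G`, with complex values. -/
def polarSqC : G 𝕜 → ℂ := fun g => ((polarSq (embG 𝕜 g) : ℝ) : ℂ)

/-- Multiplication by `(det b)⁻¹` preserves the conormal rapidly decreasing functions. -/
lemma polarSqC_mul_mem_conormal {v : G 𝕜 → ℂ} (hv : v ∈ Conormal (rapidFunctions 𝕜)) :
    polarSqC 𝕜 * v ∈ Conormal (rapidFunctions 𝕜) := by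
  have h1 : polarSqC 𝕜 = fun g => onG (fun _ : Cpt 𝕜 => (1 : ℂ)) g / onG (bdetC 𝕜) g := by
    funext g
    rw [polarSqC, onG, onG, bdetC, bdet_fromG, Complex.ofReal_inv, one_div, inv_inv]
  have h2 : polarSqC 𝕜 ∈ Conormal {a | ∃ C, 0 ≤ C ∧ ∀ g, ‖a g‖ ≤ C * polarSq (embG 𝕜 g)} := by
    have hc : IsSmooth (emb 𝕜) (fun _ : Cpt 𝕜 => (1 : ℂ)) := isSmooth_const emb_injective _
    refine ⟨quotientFunctions (smoothFunctions 𝕜), ?_,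
      isStable_quotientFunctions isBInvariant_smoothFunctions, ?_⟩
    · rintro u ⟨hus, f, hf, huf⟩
      obtain ⟨C, hC, h⟩ := IsSmooth.exists_bound hf
      refine ⟨C, hC, fun g => ?_⟩
      have h3 := norm_mul_bdet huf g
      rw [bdet_fromG, ← div_eq_mul_inv, div_eq_iff (polarSq_pos _).ne'] at h3
      rw [h3]
      exact mul_le_mul_of_nonneg_right (h _) (polarSq_pos _).le
    · rw [h1]
      exact div_mem_quotientFunctions hc hc
  refine conormal_mul ?_ (fun _ h _ h' => add_mem_rapidFunctions h h') h2 hv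
  rintro a ⟨C, hC, ha⟩ u hu n
  obtain ⟨C', hC'⟩ := hu (n + 1)
  refine ⟨C * C', fun g => ?_⟩
  have h0 := polarSq_pos (embG 𝕜 g)
  calc polarSq (embG 𝕜 g) ^ n * ‖a g * u g‖
      ≤ polarSq (embG 𝕜 g) ^ n * (C * polarSq (embG 𝕜 g) * ‖u g‖) := by
        rw [norm_mul]
        exact mul_le_mul_of_nonneg_left (mul_le_mul_of_nonneg_right (ha g) (norm_nonneg _))
          (by positivity)
    _ = C * (polarSq (embG 𝕜 g) ^ (n + 1) * ‖u g‖) := by ring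
    _ ≤ C * C' := mul_le_mul_of_nonneg_left (hC' g) hC

open Classical in
/-- The extension by zero to `G[1]` of a function on `G`. -/
def hat (v : G 𝕜 → ℂ) : Cpt 𝕜 → ℂ := fun p => if h : p.IsInterior then v (toG ⟨p, h⟩) else 0

lemma hat_interior (v : G 𝕜 → ℂ) (p : Interior 𝕜) : hat v p.1 = v (toG p) := dif_pos p.2

lemma hat_boundary (v : G 𝕜 → ℂ) {p : Cpt 𝕜} (hp : ¬ p.IsInterior) : hat v p = 0 := dif_neg hp

lemma norm_hat_le {v : G 𝕜 → ℂ} (hv : v ∈ rapidFunctions 𝕜) :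
    ∃ C : ℝ, ∀ p : Cpt 𝕜, ‖hat v p‖ ≤ C * bdet (p.2 : Mat 𝕜) ^ 2 := by
  obtain ⟨C, hC⟩ := hv 2
  refine ⟨C, fun p => ?_⟩
  by_cases hp : p.IsInterior
  · have h1 := hC (toG ⟨p, hp⟩)
    have h0 : 0 < bdet (p.2 : Mat 𝕜) := p.isInterior_iff.1 hp
    rw [polarSq_toG, inv_pow, inv_mul_eq_div, div_le_iff₀ (pow_pos h0 2)] at h1
    rw [hat_interior v ⟨p, hp⟩]
    exact h1
  · rw [hat_boundary v hp, norm_zero, p.not_isInterior_iff.1 hp]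
    norm_num

/-- The form `det b • g⁻¹ dg` on `G[1]`, where `g` is the point of `G` that corresponds to a point
of the interior. It is smooth up to the boundary. -/
def maurerCartan (z : Mat 𝕜 × Mat 𝕜) : Mat 𝕜 × Mat 𝕜 →L[ℝ] Mat 𝕜 :=
  ContinuousLinearMap.mul ℝ (Mat 𝕜) (z.2.adjugate * z.1.adjugate) ∘L
    ((ContinuousLinearMap.mul ℝ (Mat 𝕜)).flip z.2 ∘L ContinuousLinearMap.fst ℝ _ _ +
      ContinuousLinearMap.mul ℝ (Mat 𝕜) z.1 ∘L ContinuousLinearMap.snd ℝ _ _) -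
  (bdetDeriv z.2 ∘L ContinuousLinearMap.snd ℝ _ _).smulRight ((1 / 2 : ℝ) • (1 : Mat 𝕜))

lemma maurerCartan_apply (z w : Mat 𝕜 × Mat 𝕜) : maurerCartan z w =
    z.2.adjugate * z.1.adjugate * (w.1 * z.2 + z.1 * w.2) -
      bdetDeriv z.2 w.2 • ((1 / 2 : ℝ) • (1 : Mat 𝕜)) := rfl

lemma contDiff_maurerCartan {n : ℕ∞ω} : ContDiff ℝ n (maurerCartan (𝕜 := 𝕜)) := by
  unfold maurerCartan bdetDeriv
  fun_prop

/-- On the interior `maurerCartan` is `det b • g⁻¹ dg`; the adjugate stands for the inverse. -/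
lemma maurerCartan_eq (p : Interior 𝕜) (w : Mat 𝕜 × Mat 𝕜) :
    maurerCartan (embInterior 𝕜 p) w = bdet (p.1.2 : Mat 𝕜) •
      ((toG p : Mat 𝕜).adjugate * polarMulDeriv (embInterior 𝕜 p) w) := by
  have hδ : 0 < bdet (p.1.2 : Mat 𝕜) := p.1.isInterior_iff.1 p.2
  have hg : (toG p : Mat 𝕜) =
      (√(bdet (p.1.2 : Mat 𝕜)))⁻¹ • ((p.1.1 : Mat 𝕜) * (p.1.2 : Mat 𝕜)) := embG_toG p
  have hadj : (toG p : Mat 𝕜).adjugate = (√(bdet (p.1.2 : Mat 𝕜)))⁻¹ •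
      ((p.1.2 : Mat 𝕜).adjugate * (p.1.1 : Mat 𝕜).adjugate) := by
    rw [hg, real_smul_eq, Matrix.adjugate_smul, Fintype.card_fin, pow_one, Matrix.adjugate_mul_distrib,
      ← real_smul_eq]
  have hxy : (p.1.2 : Mat 𝕜).adjugate * (p.1.1 : Mat 𝕜).adjugate *
      ((p.1.1 : Mat 𝕜) * (p.1.2 : Mat 𝕜)) = bdet (p.1.2 : Mat 𝕜) • (1 : Mat 𝕜) := by
    rw [mul_assoc, ← mul_assoc (p.1.1 : Mat 𝕜).adjugate, Matrix.adjugate_mul, K.det_eq_one, one_smul,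
      one_mul, Matrix.adjugate_mul, real_smul_eq, ofReal_bdet p.1.isHermitian]
  have hs : bdet (p.1.2 : Mat 𝕜) * ((√(bdet (p.1.2 : Mat 𝕜)))⁻¹ *
      (√(bdet (p.1.2 : Mat 𝕜)))⁻¹) = 1 := by
    rw [← mul_inv, Real.mul_self_sqrt hδ.le, mul_inv_cancel₀ hδ.ne']
  have hs2 : bdet (p.1.2 : Mat 𝕜) * ((√(bdet (p.1.2 : Mat 𝕜)))⁻¹ *
      ((√(bdet (p.1.2 : Mat 𝕜)))⁻¹ * (2 * bdet (p.1.2 : Mat 𝕜))⁻¹)) *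
        bdet (p.1.2 : Mat 𝕜) = 1 / 2 := by
    rw [← mul_assoc (√(bdet (p.1.2 : Mat 𝕜)))⁻¹, ← mul_assoc (bdet (p.1.2 : Mat 𝕜)), hs]
    field_simp
  rw [maurerCartan_apply, polarMulDeriv_apply, hadj, mul_sub, smul_mul_smul_comm,
    smul_mul_smul_comm, smul_sub, smul_smul, smul_smul]
  show (p.1.2 : Mat 𝕜).adjugate * (p.1.1 : Mat 𝕜).adjugate *
      (w.1 * (p.1.2 : Mat 𝕜) + (p.1.1 : Mat 𝕜) * w.2) - _ = (_ : ℝ) •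
      ((p.1.2 : Mat 𝕜).adjugate * (p.1.1 : Mat 𝕜).adjugate *
      (w.1 * (p.1.2 : Mat 𝕜) + (p.1.1 : Mat 𝕜) * w.2)) - (_ : ℝ) • (_ : ℝ) • ((p.1.2 : Mat 𝕜).adjugate *
      (p.1.1 : Mat 𝕜).adjugate * ((p.1.1 : Mat 𝕜) * (p.1.2 : Mat 𝕜)))
  rw [hxy, smul_smul, smul_smul]
  show _ = (bdet (p.1.2 : Mat 𝕜) * ((√(bdet (p.1.2 : Mat 𝕜)))⁻¹ *
      (√(bdet (p.1.2 : Mat 𝕜)))⁻¹)) • _ - (bdet (p.1.2 : Mat 𝕜) *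
      ((√(bdet (p.1.2 : Mat 𝕜)))⁻¹ * ((√(bdet (p.1.2 : Mat 𝕜)))⁻¹ *
      (2 * bdet (p.1.2 : Mat 𝕜))⁻¹ * bdetDeriv (p.1.2 : Mat 𝕜) w.2)) *
        bdet (p.1.2 : Mat 𝕜)) • (1 : Mat 𝕜)
  rw [hs, one_smul]
  congr 2
  show bdetDeriv (p.1.2 : Mat 𝕜) w.2 * (1 / 2) = _
  rw [← hs2]
  ring

/-- The differential of `hat v`, expressed by the extensions of the invariant derivatives of `v`. -/
def hatDeriv (v : G 𝕜 → ℂ) (p : Cpt 𝕜) : Mat 𝕜 × Mat 𝕜 →L[ℝ] ℂ :=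
  ∑ j : SlIdx 𝕜, ((slCoord j).comp (maurerCartan (emb 𝕜 p))).smulRight
    (hat (polarSqC 𝕜 * leftDeriv (slBasis j) v) p)

/-- The extension by zero is differentiable on `G[1]`. At the boundary its differential vanishes, because
the function is `O((det b)²)` there. -/
lemma hasFDerivWithinAt_hat {v : G 𝕜 → ℂ} (hv : v ∈ Conormal (rapidFunctions 𝕜)) (p : Cpt 𝕜) :
    HasFDerivWithinAt (Function.extend (emb 𝕜) (hat v) 0) (hatDeriv v p) (Set.range (emb 𝕜))
      (emb 𝕜 p) := by
  by_cases hp : p.IsInterior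
  · set q : Interior 𝕜 := ⟨p, hp⟩ with hq
    have hδ : 0 < bdet (p.2 : Mat 𝕜) := p.isInterior_iff.1 hp
    have hvs := (isStable_conormal _ v hv).1
    have h1 := hasFDerivWithinAt_pullback (ι := embInterior 𝕜) (ι' := embG 𝕜) (φ := toG)
      (Φ := polarMul) embInterior_injective embG_injective (p := q)
      (hasFDerivAt_polarMul (z := embInterior 𝕜 q) hδ).hasFDerivWithinAt embG_toG
      (hasFDerivWithinAt_embG hvs (toG q))
    have hU : {z : Mat 𝕜 × Mat 𝕜 | 0 < bdet z.2} ∈ 𝓝 (emb 𝕜 p) := by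
      have hc : Continuous (fun z : Mat 𝕜 × Mat 𝕜 => bdet z.2) :=
        ContDiff.continuous (𝕜 := ℝ) (n := 0) (by fun_prop)
      exact (isOpen_lt continuous_const hc).mem_nhds hδ
    rw [← hasFDerivWithinAt_inter hU]
    have hsub : ∀ z ∈ Set.range (emb 𝕜) ∩ {z : Mat 𝕜 × Mat 𝕜 | 0 < bdet z.2},
        ∃ r : Interior 𝕜, embInterior 𝕜 r = z := by
      rintro _ ⟨⟨r, rfl⟩, hr⟩
      exact ⟨⟨r, r.isInterior_iff.2 hr⟩, rfl⟩
    have h2 : ∀ r : Interior 𝕜, Function.extend (emb 𝕜) (hat v) 0 (embInterior 𝕜 r) =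
        Function.extend (embInterior 𝕜) (fun p => v (toG p)) 0 (embInterior 𝕜 r) := by
      intro r
      rw [extend_self embInterior_injective]
      exact (extend_self emb_injective _ _).trans (hat_interior v r)
    refine ((h1.mono (s := Set.range (emb 𝕜) ∩ {z | 0 < bdet z.2}) fun z hz => hsub z hz).congr
      (fun z hz => ?_) (h2 q)).congr_fderiv ?_
    · obtain ⟨r, rfl⟩ := hsub z hz
      exact h2 r
    · refine ContinuousLinearMap.ext fun w => ?_
      have h3 := maurerCartan_eq q w
      simp only [hatDeriv, ContinuousLinearMap.comp_apply, sum_apply,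
        ContinuousLinearMap.smulRight_apply]
      refine Finset.sum_congr rfl fun j _ => ?_
      have h4 : slCoord j (maurerCartan (emb 𝕜 p) w) = bdet (p.2 : Mat 𝕜) *
          slCoord j ((toG q : Mat 𝕜).adjugate * polarMulDeriv (embInterior 𝕜 q) w) :=
        (congrArg (slCoord j) h3).trans ((slCoord j).map_smul _ _)
      have h5 : hat (polarSqC 𝕜 * leftDeriv (slBasis j) v) p =
          ((bdet (p.2 : Mat 𝕜))⁻¹ : ℝ) • leftDeriv (slBasis j) v (toG q) := by
        refine (hat_interior _ q).trans ?_
        rw [Pi.mul_apply, polarSqC, polarSq_toG, Complex.real_smul]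
      rw [h4, h5, smul_smul, mul_right_comm, mul_inv_cancel₀ hδ.ne', one_mul]
      rfl
  · have h0 : hatDeriv v p = 0 := by
      refine ContinuousLinearMap.ext fun w => ?_
      simp only [hatDeriv, sum_apply, ContinuousLinearMap.smulRight_apply, hat_boundary _ hp,
        smul_zero, Finset.sum_const_zero, zero_apply]
    rw [h0]
    obtain ⟨C, hC⟩ := norm_hat_le (conormal_subset _ hv)
    refine Asymptotics.IsBigO.hasFDerivWithinAt (n := 2) ?_ (Set.mem_range_self p) one_lt_two
    have hb0 := p.not_isInterior_iff.1 hp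
    have h1 : (fun z : Mat 𝕜 × Mat 𝕜 => bdet z.2) =O[𝓝[Set.range (emb 𝕜)] (emb 𝕜 p)]
        fun z => z - emb 𝕜 p := by
      have h2 : DifferentiableAt ℝ (fun z : Mat 𝕜 × Mat 𝕜 => bdet z.2) (emb 𝕜 p) :=
        (ContDiff.differentiable (n := 1) (by fun_prop) one_ne_zero) _
      have h3 := h2.hasFDerivAt.isBigO_sub
      have h4 : bdet (emb 𝕜 p).2 = 0 := hb0
      simp only [h4, sub_zero] at h3
      exact h3.mono nhdsWithin_le_nhds
    refine Asymptotics.IsBigO.trans (Asymptotics.IsBigO.of_bound C ?_) (h1.norm_right.pow 2)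
    filter_upwards [self_mem_nhdsWithin] with z hz
    obtain ⟨r, rfl⟩ := hz
    rw [extend_self emb_injective, norm_pow, Real.norm_of_nonneg (show 0 ≤ bdet (emb 𝕜 r).2 from r.bdet_nonneg)]
    exact hC r

/-- The differential of an extension by zero is composed of smooth forms and other extensions by zero,
so differentiability bootstraps to smoothness. -/
lemma contDiffOn_hat (n : ℕ) : ∀ {v : G 𝕜 → ℂ}, v ∈ Conormal (rapidFunctions 𝕜) →
    ContDiffOn ℝ n (Function.extend (emb 𝕜) (hat v) 0) (Set.range (emb 𝕜)) := by
  induction n with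
  | zero =>
    intro v hv
    rw [Nat.cast_zero, contDiffOn_zero]
    rintro _ ⟨p, rfl⟩
    exact (hasFDerivWithinAt_hat hv p).continuousWithinAt
  | succ n ih =>
    intro v hv
    rw [Nat.cast_succ, contDiffOn_succ_iff_hasFDerivWithinAt (by simp)]
    refine fun x hx => ⟨Set.range (emb 𝕜), ?_, by simp, fun z => ∑ j : SlIdx 𝕜,
      ((slCoord j).comp (maurerCartan z)).smulRight (Function.extend (emb 𝕜)
        (hat (polarSqC 𝕜 * leftDeriv (slBasis j) v)) 0 z), ?_, ?_⟩
    · rw [Set.insert_eq_of_mem hx]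
      exact self_mem_nhdsWithin
    · rintro _ ⟨p, rfl⟩
      simp only [extend_self emb_injective]
      exact hasFDerivWithinAt_hat hv p
    · refine ContDiffOn.sum fun j _ => ContDiffOn.smulRight ?_ (ih (polarSqC_mul_mem_conormal
        ((isStable_conormal _ v hv).2 _ (trace_slBasis j)).1))
      exact (contDiff_const.clm_comp contDiff_maurerCartan).contDiffOn

lemma isSmooth_hat {v : G 𝕜 → ℂ} (hv : v ∈ Conormal (rapidFunctions 𝕜)) :
    IsSmooth (emb 𝕜) (hat v) :=
  contDiffOn_infty.2 fun n => contDiffOn_hat n hv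

lemma vecDeriv_hat {v : G 𝕜 → ℂ} (hv : v ∈ Conormal (rapidFunctions 𝕜))
    {V : Cpt 𝕜 → Mat 𝕜 × Mat 𝕜} (hV : V ∈ vectorFields 𝕜) (p : Cpt 𝕜) :
    vecDeriv (emb 𝕜) V (hat v) p = ∑ j : SlIdx 𝕜,
      ((slCoord j (maurerCartan (emb 𝕜 p) (V p)) : ℝ) : ℂ) *
        hat (polarSqC 𝕜 * leftDeriv (slBasis j) v) p := by
  refine (dirDeriv_eq (hasFDerivWithinAt_hat hv p) (mem_tanSpan_emb (hV.2 p))).trans ?_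
  simp only [hatDeriv, sum_apply, ContinuousLinearMap.smulRight_apply,
    ContinuousLinearMap.comp_apply, Complex.real_smul]

variable (𝕜) in
/-- The finite sums of products of smooth functions on `G[1]` with extensions by zero. Unlike the
extensions themselves, they are preserved by all differential operators on `G[1]`. -/
def hatSums : AddSubmonoid (Cpt 𝕜 → ℂ) :=
  AddSubmonoid.closure {f | ∃ a v, IsSmooth (emb 𝕜) a ∧ v ∈ Conormal (rapidFunctions 𝕜) ∧
    f = fun p => a p * hat v p}

lemma isSmooth_of_mem_hatSums {f : Cpt 𝕜 → ℂ} (hf : f ∈ hatSums 𝕜) : IsSmooth (emb 𝕜) f := by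
  induction hf using AddSubmonoid.closure_induction with
  | mem f hf =>
    obtain ⟨a, v, ha, hv, rfl⟩ := hf
    exact ha.mul emb_injective (isSmooth_hat hv)
  | zero => exact isSmooth_const emb_injective 0
  | add f g _ _ hf hg => exact hf.add emb_injective hg

lemma eq_zero_of_mem_hatSums {f : Cpt 𝕜 → ℂ} (hf : f ∈ hatSums 𝕜) {p : Cpt 𝕜}
    (hp : ¬ p.IsInterior) : f p = 0 := by
  induction hf using AddSubmonoid.closure_induction with
  | mem f hf =>
    obtain ⟨a, v, ha, hv, rfl⟩ := hf
    show a p * hat v p = 0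
    rw [hat_boundary v hp, mul_zero]
  | zero => rfl
  | add f g _ _ hf hg => rw [Pi.add_apply, hf, hg, add_zero]

lemma vecDeriv_mem_hatSums {V : Cpt 𝕜 → Mat 𝕜 × Mat 𝕜} (hV : V ∈ vectorFields 𝕜)
    {f : Cpt 𝕜 → ℂ} (hf : f ∈ hatSums 𝕜) : vecDeriv (emb 𝕜) V f ∈ hatSums 𝕜 := by
  have hadd : ∀ {f g : Cpt 𝕜 → ℂ}, IsSmooth (emb 𝕜) f → IsSmooth (emb 𝕜) g →
      vecDeriv (emb 𝕜) V (f + g) = vecDeriv (emb 𝕜) V f + vecDeriv (emb 𝕜) V g :=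
    fun hf hg => funext fun p => dirDeriv_add emb_injective hf hg (mem_tanSpan_emb (hV.2 p))
  induction hf using AddSubmonoid.closure_induction with
  | mem f hf =>
    obtain ⟨a, v, ha, hv, rfl⟩ := hf
    have h1 : vecDeriv (emb 𝕜) V (fun p => a p * hat v p) =
        (∑ j : SlIdx 𝕜, fun p => (a p * ((slCoord j (maurerCartan (emb 𝕜 p) (V p)) : ℝ) : ℂ)) *
          hat (polarSqC 𝕜 * leftDeriv (slBasis j) v) p) +
        fun p => vecDeriv (emb 𝕜) V a p * hat v p := by
      funext p
      refine (dirDeriv_mul emb_injective ha (isSmooth_hat hv) (mem_tanSpan_emb (hV.2 p))).trans ?_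
      rw [Pi.add_apply, Finset.sum_apply]
      congr 1
      refine (congrArg (a p * ·) (vecDeriv_hat hv hV p)).trans ?_
      simp only [Finset.mul_sum, mul_assoc]
    rw [h1]
    refine add_mem (sum_mem fun j _ => AddSubmonoid.subset_closure ⟨_, _, ha.mul emb_injective ?_,
      polarSqC_mul_mem_conormal ((isStable_conormal _ v hv).2 _ (trace_slBasis j)).1, rfl⟩)
      (AddSubmonoid.subset_closure ⟨_, _, ha.vecDeriv_emb hV, hv, rfl⟩)
    exact isSmooth_ofReal (((isSmooth_comp_emb emb_injective contDiff_id).prodMk emb_injective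
      hV.1).comp_contDiff emb_injective (g := fun x : (Mat 𝕜 × Mat 𝕜) × (Mat 𝕜 × Mat 𝕜) =>
        slCoord j (maurerCartan x.1 x.2))
      ((slCoord j).contDiff.comp (((contDiff_maurerCartan (𝕜 := 𝕜)).comp contDiff_fst).clm_apply
        contDiff_snd)))
  | zero =>
    have h0 : IsSmooth (emb 𝕜) (0 : Cpt 𝕜 → ℂ) := isSmooth_const emb_injective 0
    have h1 := hadd h0 h0
    rw [add_zero, left_eq_add] at h1
    rw [h1]
    exact zero_mem _
  | add f g hf' hg' hf hg =>
    rw [hadd (isSmooth_of_mem_hatSums hf') (isSmooth_of_mem_hatSums hg')]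
    exact add_mem hf hg

lemma mul_mem_hatSums {a : Cpt 𝕜 → ℂ} (ha : IsSmooth (emb 𝕜) a) {f : Cpt 𝕜 → ℂ}
    (hf : f ∈ hatSums 𝕜) : a * f ∈ hatSums 𝕜 := by
  induction hf using AddSubmonoid.closure_induction with
  | mem f hf =>
    obtain ⟨b, v, hb, hv, rfl⟩ := hf
    refine AddSubmonoid.subset_closure ⟨_, v, ha.mul emb_injective hb, hv, ?_⟩
    funext p
    exact (mul_assoc _ _ _).symm
  | zero =>
    rw [mul_zero]
    exact zero_mem _
  | add f g _ _ hf hg =>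
    rw [mul_add]
    exact add_mem hf hg

lemma IsSmoothOp.map_hatSums {P : (Cpt 𝕜 → ℂ) → (Cpt 𝕜 → ℂ)} (hP : IsSmoothOp P) :
    ∀ f ∈ hatSums 𝕜, P f ∈ hatSums 𝕜 := by
  induction hP with
  | mul a ha => exact fun f hf => mul_mem_hatSums ha hf
  | vec V hV => exact fun f hf => vecDeriv_mem_hatSums hV hf
  | add P Q _ _ hP hQ => exact fun f hf => add_mem (hP f hf) (hQ f hf)
  | comp P Q _ _ hP hQ => exact fun f hf => hP _ (hQ f hf)

/-- The extension by zero of a Schwartz function is flat. -/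
lemma hat_mem_flatFunctions {u : G 𝕜 → ℂ} (hu : u ∈ schwartzSpace 𝕜) :
    hat u ∈ flatFunctions 𝕜 := by
  have hv := schwartz_mem_conormal hu
  have h1 : hat u ∈ hatSums 𝕜 := AddSubmonoid.subset_closure
    ⟨fun _ => 1, u, isSmooth_const emb_injective 1, hv, by simp only [one_mul]⟩
  exact ⟨isSmooth_hat hv, fun P hP p hp => eq_zero_of_mem_hatSums (hP.map_hatSums _ h1) hp⟩

/-- Schwartz functions on `G` are the restrictions of the functions on `G[1]` which vanish to infinite
order at the boundary. -/
theorem schwartzSpace_eq : schwartzSpace 𝕜 =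
    {u | ∃ f ∈ flatFunctions 𝕜, ∀ p : Interior 𝕜, u (toG p) = f p.1} := by
  ext u
  constructor
  · exact fun hu => ⟨hat u, hat_mem_flatFunctions hu, fun p => (hat_interior u p).symm⟩
  · rintro ⟨f, hf, h⟩
    have h1 : u = onG f := funext fun g => by rw [onG, ← h, toG_fromG]
    rw [h1]
    exact onG_mem_schwartzSpace hf

end Extension

/-! ### Comparison of the weights -/

section Weights

variable {𝕜 : Type*} [RCLike 𝕜]

/-- Comparable positive numbers have comparable powers, of either sign. -/
lemma exists_rpow_le {A : ℝ} (hA : 0 < A) (m : ℝ) : ∃ B > 0, ∀ x y : ℝ, 0 < x → 0 < y →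
    x ≤ A * y → y ≤ A * x → x ^ m ≤ B * y ^ m := by
  rcases le_total 0 m with hm | hm
  · refine ⟨A ^ m, Real.rpow_pos_of_pos hA m, fun x y hx hy h1 _ => ?_⟩
    rw [← Real.mul_rpow hA.le hy.le]
    exact Real.rpow_le_rpow hx.le h1 hm
  · refine ⟨A⁻¹ ^ m, Real.rpow_pos_of_pos (inv_pos.2 hA) m, fun x y hx hy _ h2 => ?_⟩
    rw [← Real.mul_rpow (inv_pos.2 hA).le hy.le]
    refine Real.rpow_le_rpow_of_nonpos (by positivity) ?_ hm
    rwa [inv_mul_eq_div, div_le_iff₀ hA, mul_comm]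

/-- A boundary defining function is comparable to `‖g‖⁻²`, and its logarithm to `log ‖g‖`. -/
lemma IsBoundaryDefining.exists_weights {ρ : Cpt 𝕜 → ℝ} (hρ : IsBoundaryDefining ρ)
    (h1 : ∀ p, ρ p < 1) : ∃ A > 0, ∀ p : Interior 𝕜, 0 < ρ p.1 ∧ 0 < Real.log (1 / ρ p.1) ∧
      1 + Real.log ‖embG 𝕜 (toG p)‖ ≤ A * Real.log (1 / ρ p.1) ∧
      Real.log (1 / ρ p.1) ≤ A * (1 + Real.log ‖embG 𝕜 (toG p)‖) ∧
      ‖embG 𝕜 (toG p)‖ ^ 2 ≤ A * (1 / ρ p.1) ∧ 1 / ρ p.1 ≤ A * ‖embG 𝕜 (toG p)‖ ^ 2 := by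
  obtain ⟨c, hc, C, hC, hcC⟩ := hρ.comparable
  have hs : IsSmooth (emb 𝕜) (fun p => 1 - ρ p) :=
    hρ.1.comp_contDiff emb_injective (g := fun x : ℝ => 1 - x) (by fun_prop)
  -- By compactness `ρ ≤ 1 - m`, so that `log (1 / ρ)` is bounded below and absorbs constants.
  obtain ⟨m, hm, hm'⟩ := exists_pos_le_max hs hs (fun p => by
    rw [max_self]
    linarith [h1 p])
  have hA1 : 0 ≤ |Real.log C| := abs_nonneg _
  have hA2 : 0 ≤ |Real.log c| := abs_nonneg _
  have hA3 : 0 ≤ (1 + |Real.log C|) / m := by positivity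
  have hA4 : 0 < 3 / c := by positivity
  refine ⟨(1 + |Real.log C|) / m + 1 + (|Real.log c| + 4) + C + 3 / c, by positivity,
    fun p => ?_⟩
  set A := (1 + |Real.log C|) / m + 1 + (|Real.log c| + 4) + C + 3 / c with hA
  set n := ‖embG 𝕜 (toG p)‖ with hn
  set ℓ := Real.log (1 / ρ p.1) with hℓ
  have hn1 : 1 ≤ n := one_le_norm (toG p)
  have hδ : 0 < bdet (p.1.2 : Mat 𝕜) := p.1.isInterior_iff.1 p.2
  have hδn : (bdet (p.1.2 : Mat 𝕜))⁻¹ = n ^ 2 + 2 := by rw [← polarSq_toG, polarSq_eq]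
  have hρ0 : 0 < ρ p.1 := (mul_pos hc hδ).trans_le (hcC p.1).1
  have hℓm : m ≤ ℓ := by
    have h2 := hm' p.1
    rw [max_self] at h2
    have h3 := Real.log_le_sub_one_of_pos hρ0
    rw [hℓ, one_div, Real.log_inv]
    linarith
  have hℓ0 : 0 < ℓ := hm.trans_le hℓm
  have hlog : 0 ≤ Real.log n := Real.log_nonneg hn1
  have e1 : n ^ 2 ≤ C * (1 / ρ p.1) := by
    have h2 : (bdet (p.1.2 : Mat 𝕜))⁻¹ ≤ C * (1 / ρ p.1) := by
      rw [mul_one_div, le_div_iff₀ hρ0, inv_mul_eq_div, div_le_iff₀ hδ]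
      exact (hcC p.1).2
    linarith
  have e2 : 1 / ρ p.1 ≤ 3 / c * n ^ 2 := by
    have h2 : 1 / ρ p.1 ≤ c⁻¹ * (bdet (p.1.2 : Mat 𝕜))⁻¹ := by
      rw [← mul_inv, one_div]
      exact inv_anti₀ (mul_pos hc hδ) (hcC p.1).1
    rw [hδn] at h2
    have h3 : c⁻¹ * (n ^ 2 + 2) ≤ c⁻¹ * (3 * n ^ 2) :=
      mul_le_mul_of_nonneg_left (by nlinarith) (inv_pos.2 hc).le
    calc 1 / ρ p.1 ≤ c⁻¹ * (3 * n ^ 2) := h2.trans h3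
      _ = 3 / c * n ^ 2 := by ring
  have hn2 : 0 < n ^ 2 := by positivity
  have hρ' : 0 < 1 / ρ p.1 := by positivity
  refine ⟨hρ0, hℓ0, ?_, ?_, ?_, ?_⟩
  · have h2 : 2 * Real.log n ≤ Real.log C + ℓ := by
      have h3 := Real.log_le_log hn2 e1
      rwa [Real.log_mul hC.ne' hρ'.ne', Real.log_pow, Nat.cast_ofNat] at h3
    have h4 : 1 + |Real.log C| ≤ (1 + |Real.log C|) / m * ℓ := by
      rw [div_mul_eq_mul_div, le_div_iff₀ hm]
      exact mul_le_mul_of_nonneg_left hℓm (by linarith)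
    have h5 : ((1 + |Real.log C|) / m + 1) * ℓ ≤ A * ℓ :=
      mul_le_mul_of_nonneg_right (by linarith) hℓ0.le
    linarith [le_abs_self (Real.log C)]
  · have h2 : ℓ ≤ Real.log (3 / c) + 2 * Real.log n := by
      have h3 := Real.log_le_log hρ' e2
      rwa [Real.log_mul hA4.ne' hn2.ne', Real.log_pow, Nat.cast_ofNat] at h3
    rw [Real.log_div three_ne_zero hc.ne'] at h2
    have h3 : Real.log 3 ≤ 2 := by
      have := Real.log_le_sub_one_of_pos (zero_lt_three' ℝ)
      linarith
    have h4 : (|Real.log c| + 4) * (1 + Real.log n) ≤ A * (1 + Real.log n) :=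
      mul_le_mul_of_nonneg_right (by linarith) (by linarith)
    nlinarith [neg_abs_le (Real.log c)]
  · exact e1.trans (mul_le_mul_of_nonneg_right (by linarith) hρ'.le)
  · exact e2.trans (mul_le_mul_of_nonneg_right (by linarith) hn2.le)

lemma inv_pow_finrank {n : ℝ} (hn : 0 < n) {d : ℕ} {κ : ℝ} (hκ : κ = (d : ℝ) / 2) :
    (n ^ d)⁻¹ = (n ^ 2) ^ (-κ) := by
  rw [← Real.rpow_natCast n 2, ← Real.rpow_mul hn.le, ← Real.rpow_natCast, ← Real.rpow_neg hn.le, hκ]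
  congr 1
  push_cast
  ring

lemma inv_rpow_neg {x κ : ℝ} (hx : 0 < x) : (1 / x) ^ (-κ) = x ^ κ := by
  rw [one_div, Real.inv_rpow hx.le, Real.rpow_neg hx.le, inv_inv]

/-- The spherical function in terms of a boundary defining function. The bounds hold on the whole
interior since `ρ < 1`. -/
theorem IsBoundaryDefining.exists_spherical_bounds {ρ : Cpt 𝕜 → ℝ} (hρ : IsBoundaryDefining ρ)
    (h1 : ∀ p, ρ p < 1) {κ : ℝ} (hκ : κ = (Module.finrank ℝ 𝕜 : ℝ) / 2) :
    ∃ c > 0, ∃ C > 0, ∀ p : Interior 𝕜, c * ρ p.1 ^ κ ≤ sphericalFunction (toG p) ∧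
      sphericalFunction (toG p) ≤ C * (ρ p.1 ^ κ * Real.log (1 / ρ p.1)) := by
  obtain ⟨A, hA, h⟩ := hρ.exists_weights h1
  obtain ⟨B, hB, hB'⟩ := exists_rpow_le hA (-κ)
  refine ⟨B⁻¹, inv_pos.2 hB, 4 * 12 ^ Module.finrank ℝ 𝕜 * (B * A), by positivity,
    fun p => ?_⟩
  obtain ⟨hρ0, hℓ, e1, e2, e3, e4⟩ := h p
  have hn := one_pos.trans_le (one_le_norm (toG p))
  have hlog := Real.log_nonneg (one_le_norm (toG p))
  have h2 := inv_pow_finrank hn hκ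
  have hρ' : 0 < 1 / ρ p.1 := by positivity
  have h3 := hB' _ _ (pow_pos hn 2) hρ' e3 e4
  have h4 := hB' _ _ hρ' (pow_pos hn 2) e4 e3
  rw [← h2, inv_rpow_neg hρ0] at h3 h4
  refine ⟨?_, ?_⟩
  · rw [inv_mul_eq_div, div_le_iff₀ hB, mul_comm]
    exact h4.trans (mul_le_mul_of_nonneg_left (le_sphericalFunction _) hB.le)
  · refine (sphericalFunction_le _).trans ?_
    rw [mul_assoc _ (B * A)]
    refine mul_le_mul_of_nonneg_left ?_ (by positivity)
    calc (‖embG 𝕜 (toG p)‖ ^ Module.finrank ℝ 𝕜)⁻¹ * (1 + Real.log ‖embG 𝕜 (toG p)‖)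
        ≤ B * ρ p.1 ^ κ * (A * Real.log (1 / ρ p.1)) :=
          mul_le_mul h3 e1 (by linarith) (by positivity)
      _ = B * A * (ρ p.1 ^ κ * Real.log (1 / ρ p.1)) := by ring

end Weights

/-! ### Harish-Chandra's Schwartz space -/

section HarishChandraSpace

variable {𝕜 : Type*} [RCLike 𝕜]

lemma ilog_rpow {x m : ℝ} (h : 0 < Real.log (1 / x)) : ilog x ^ m = (Real.log (1 / x) ^ m)⁻¹ := by
  rw [ilog, one_div (Real.log (1 / x)), Real.inv_rpow h.le]

/-- The functions on `G` bounded by `(1 + log ‖g‖)⁻ᵐ Ξ`. -/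
def harishChandraBounded (𝕜 : Type*) [RCLike 𝕜] (m : ℝ) : Set (G 𝕜 → ℂ) :=
  {a | ∃ C : ℝ, ∀ g, (1 + Real.log ‖embG 𝕜 g‖) ^ m / sphericalFunction g * ‖a g‖ ≤ C}

lemma harishChandra_weight_pos (g : G 𝕜) (m : ℝ) :
    0 < (1 + Real.log ‖embG 𝕜 g‖) ^ m / sphericalFunction g := by
  have h := Real.log_nonneg (one_le_norm g)
  exact div_pos (Real.rpow_pos_of_pos (by linarith) m) (sphericalFunction_pos g)

lemma add_mem_harishChandraBounded {m : ℝ} {u v : G 𝕜 → ℂ} (hu : u ∈ harishChandraBounded 𝕜 m)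
    (hv : v ∈ harishChandraBounded 𝕜 m) : u + v ∈ harishChandraBounded 𝕜 m := by
  obtain ⟨C, hC⟩ := hu
  obtain ⟨C', hC'⟩ := hv
  refine ⟨C + C', fun g => ?_⟩
  refine (mul_le_mul_of_nonneg_left (norm_add_le (u g) (v g))
    (harishChandra_weight_pos g m).le).trans ?_
  rw [mul_add]
  exact add_le_add (hC g) (hC' g)

lemma mul_mem_harishChandraBounded {m : ℝ} {a u : G 𝕜 → ℂ} (ha : a ∈ bddFunctions 𝕜)
    (hu : u ∈ harishChandraBounded 𝕜 m) : a * u ∈ harishChandraBounded 𝕜 m := by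
  obtain ⟨C, hC⟩ := ha
  obtain ⟨C', hC'⟩ := hu
  refine ⟨C * C', fun g => ?_⟩
  have h0 := (harishChandra_weight_pos g m).le
  rw [Pi.mul_apply, norm_mul, mul_left_comm]
  exact mul_le_mul (hC g) (hC' g) (mul_nonneg h0 (norm_nonneg _)) ((norm_nonneg _).trans (hC g))

/-- The Harish-Chandra Schwartz space consists of the functions which are conormal with weight
`(ilog ρ)ᵐ ρ^κ` for all `m`. -/
theorem IsBoundaryDefining.harishChandraSpace_eq {ρ : Cpt 𝕜 → ℝ} (hρ : IsBoundaryDefining ρ)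
    (h1 : ∀ p, ρ p < 1) {κ : ℝ} (hκ : κ = (Module.finrank ℝ 𝕜 : ℝ) / 2) :
    harishChandraSpace 𝕜 = {u | (fun p : Interior 𝕜 => u (toG p)) ∈ logRapidConormal ρ κ} := by
  obtain ⟨A, hA, hw⟩ := hρ.exists_weights h1
  obtain ⟨c, hc, C, hC, hΞ⟩ := hρ.exists_spherical_bounds h1 hκ
  have hlog : ∀ g : G 𝕜, 0 < 1 + Real.log ‖embG 𝕜 g‖ := fun g => by
    linarith [Real.log_nonneg (one_le_norm g)]
  ext u
  constructor
  · rintro ⟨hus, hu⟩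
    refine Set.mem_iInter.2 fun m => ⟨isSmooth_comp_toG hus, fun P hP => ?_⟩
    -- One more power of the logarithm makes up for the logarithm in the upper bound of `Ξ`.
    have hmem : u ∈ Conormal (harishChandraBounded 𝕜 (m + 1)) :=
      mem_conormal_of_ops hus fun D₁ D₂ => hu (m + 1) D₁ D₂
    obtain ⟨w, hw', hPw⟩ := hP.map_conormal
      (fun _ h _ h' => add_mem_harishChandraBounded h h')
      (fun _ h _ h' => mul_mem_harishChandraBounded h h') u hmem
    obtain ⟨M, hM⟩ := conormal_subset _ hw'
    obtain ⟨B, hB, hB'⟩ := exists_rpow_le hA (m + 1)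
    refine ⟨max M 0 * (C * B), fun p => ?_⟩
    obtain ⟨hρ0, hℓ, e1, e2, -, -⟩ := hw p
    have h2 := hM (toG p)
    have hL := Real.rpow_pos_of_pos (hlog (toG p)) (m + 1)
    have hl := Real.rpow_pos_of_pos hℓ m
    have hκ0 := Real.rpow_pos_of_pos hρ0 κ
    have h3 := hB' _ _ hℓ (hlog (toG p)) e2 e1
    rw [Real.rpow_add_one hℓ.ne'] at h3
    rw [div_mul_eq_mul_div, div_le_iff₀ (sphericalFunction_pos _)] at h2
    show _ ≤ _ * (ilog (ρ p.1) ^ m * ρ p.1 ^ κ)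
    rw [hPw, ilog_rpow hℓ]
    have h4 : (1 + Real.log ‖embG 𝕜 (toG p)‖) ^ (m + 1) * ‖w (toG p)‖ ≤
        max M 0 * (C * (ρ p.1 ^ κ * Real.log (1 / ρ p.1))) :=
      h2.trans (mul_le_mul (le_max_left _ _) (hΞ p).2 (sphericalFunction_pos _).le
        (le_max_right _ _))
    have h5 : Real.log (1 / ρ p.1) ^ m * Real.log (1 / ρ p.1) * ‖w (toG p)‖ ≤
        B * (max M 0 * (C * (ρ p.1 ^ κ * Real.log (1 / ρ p.1)))) := by
      refine (mul_le_mul_of_nonneg_right h3 (norm_nonneg _)).trans ?_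
      rw [mul_assoc]
      exact mul_le_mul_of_nonneg_left h4 hB.le
    have h6 : Real.log (1 / ρ p.1) ^ m * ‖w (toG p)‖ ≤ B * (max M 0 * (C * ρ p.1 ^ κ)) := by
      refine le_of_mul_le_mul_right ?_ hℓ
      linarith
    calc ‖w (toG p)‖ ≤ B * (max M 0 * (C * ρ p.1 ^ κ)) / Real.log (1 / ρ p.1) ^ m := by
          rw [le_div_iff₀ hl, mul_comm]
          exact h6
      _ = _ := by ring
  · intro hu
    have hus : IsSmooth (embG 𝕜) u := by
      have h2 := isSmooth_comp_fromG (Set.mem_iInter.1 hu 0).1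
      simpa only [toG_fromG] using h2
    refine ⟨hus, fun m D₁ D₂ hD₁ hD₂ => ?_⟩
    obtain ⟨P₁, hP₁, h2⟩ := hD₁.exists_bDiffOp
    obtain ⟨P₂, hP₂, h3⟩ := hD₂.exists_bDiffOp
    obtain ⟨M, hM⟩ := (Set.mem_iInter.1 hu m).2 _ (IsDiffOp.comp _ _ hP₁ hP₂)
    obtain ⟨B, hB, hB'⟩ := exists_rpow_le hA m
    refine ⟨B * c⁻¹ * max M 0, fun g => ?_⟩
    obtain ⟨p, rfl⟩ : ∃ p, toG p = g := ⟨fromG g, toG_fromG g⟩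
    obtain ⟨hρ0, hℓ, e1, e2, -, -⟩ := hw p
    have h4 : ‖D₁ (D₂ u) (toG p)‖ ≤ M * (ilog (ρ p.1) ^ m * ρ p.1 ^ κ) := by
      have h5 := congrFun (h2 _ (hD₂.isSmooth hus)) p
      rw [h3 _ hus] at h5
      rw [h5]
      exact hM p
    have hl := Real.rpow_pos_of_pos hℓ m
    have hκ0 := Real.rpow_pos_of_pos hρ0 κ
    rw [ilog_rpow hℓ] at h4
    have h5 := hB' _ _ (hlog (toG p)) hℓ e1 e2
    have h6 : (1 + Real.log ‖embG 𝕜 (toG p)‖) ^ m / sphericalFunction (toG p) ≤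
        B * Real.log (1 / ρ p.1) ^ m / (c * ρ p.1 ^ κ) :=
      div_le_div₀ (by positivity) h5 (by positivity) (hΞ p).1
    calc (1 + Real.log ‖embG 𝕜 (toG p)‖) ^ m / sphericalFunction (toG p) * ‖D₁ (D₂ u) (toG p)‖
        ≤ B * Real.log (1 / ρ p.1) ^ m / (c * ρ p.1 ^ κ) *
            (max M 0 * ((Real.log (1 / ρ p.1) ^ m)⁻¹ * ρ p.1 ^ κ)) :=
          mul_le_mul h6 (h4.trans (mul_le_mul_of_nonneg_right (le_max_left _ _) (by positivity)))
            (norm_nonneg _) (by positivity)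
      _ = B * c⁻¹ * max M 0 := by
          field_simp

end HarishChandraSpace

end SL2Cpt

end

theorem mainTheorem2 :
    -- the case of `SL(2, ℝ)`, with `κ = 1/2`
    ((schwartzSpace ℝ = {u | ∃ f ∈ flatFunctions ℝ, ∀ p : Interior ℝ, u (toG p) = f p.1}) ∧
      ∀ ρ : Cpt ℝ → ℝ, IsBoundaryDefining ρ → (∀ p, ρ p < 1) →
        (harishChandraSpace ℝ =
            {u | (fun p : Interior ℝ => u (toG p)) ∈ logRapidConormal ρ (1 / 2)}) ∧
        ∃ c > 0, ∃ C > 0, ∃ ε > 0, ∀ p : Interior ℝ, ρ p.1 < ε →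
          c * ρ p.1 ^ (1 / 2 : ℝ) ≤ sphericalFunction (toG p) ∧
          sphericalFunction (toG p) ≤ C * (ρ p.1 ^ (1 / 2 : ℝ) * Real.log (1 / ρ p.1))) ∧
    -- the case of `SL(2, ℂ)`, with `κ = 1`
    ((schwartzSpace ℂ = {u | ∃ f ∈ flatFunctions ℂ, ∀ p : Interior ℂ, u (toG p) = f p.1}) ∧
      ∀ ρ : Cpt ℂ → ℝ, IsBoundaryDefining ρ → (∀ p, ρ p < 1) →
        (harishChandraSpace ℂ =
            {u | (fun p : Interior ℂ => u (toG p)) ∈ logRapidConormal ρ 1}) ∧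
        ∃ c > 0, ∃ C > 0, ∃ ε > 0, ∀ p : Interior ℂ, ρ p.1 < ε →
          c * ρ p.1 ^ (1 : ℝ) ≤ sphericalFunction (toG p) ∧
          sphericalFunction (toG p) ≤ C * (ρ p.1 ^ (1 : ℝ) * Real.log (1 / ρ p.1))) := by
  have h : ∀ {𝕜 : Type} [RCLike 𝕜] {κ : ℝ}, κ = (Module.finrank ℝ 𝕜 : ℝ) / 2 →
      ∀ ρ : Cpt 𝕜 → ℝ, IsBoundaryDefining ρ → (∀ p, ρ p < 1) →
        (harishChandraSpace 𝕜 =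
            {u | (fun p : Interior 𝕜 => u (toG p)) ∈ logRapidConormal ρ κ}) ∧
        ∃ c > 0, ∃ C > 0, ∃ ε > 0, ∀ p : Interior 𝕜, ρ p.1 < ε →
          c * ρ p.1 ^ κ ≤ sphericalFunction (toG p) ∧
          sphericalFunction (toG p) ≤ C * (ρ p.1 ^ κ * Real.log (1 / ρ p.1)) := by
    intro 𝕜 _ κ hκ ρ hρ h1
    obtain ⟨c, hc, C, hC, hb⟩ := hρ.exists_spherical_bounds h1 hκ
    exact ⟨hρ.harishChandraSpace_eq h1 hκ, c, hc, C, hC, 1, one_pos, fun p _ => hb p⟩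
  refine ⟨⟨schwartzSpace_eq, h ?_⟩, ⟨schwartzSpace_eq, h ?_⟩⟩
  · rw [Module.finrank_self, Nat.cast_one]
  · rw [Complex.finrank_real_complex, Nat.cast_ofNat, div_self two_ne_zero]
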